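/- All graphs are finite and simple. For vertices $u,v$ of a graph $G$, let $I(u,v)$ be the set of vertices that lie on a shortest path between $u$ and $v$; a set $S\subseteq V(G)$ is a geodetic set if $\bigcup_{u,v\in S} I(u,v)=V(G)$. A solid grid is a graph $G$ that has a grid embedding (distinct integer points in the plane for the vertices, adjacent vertices being at Euclidean distance $1$) all of whose interior faces have unit area; call such an embedding solid. Fix a solid embedding $\mathcal R$. A corner path is a path that follows the boundary of the exterior face of $\mathcal R$, contains no cut-vertex of $G$, and has two distinct end-vertices of degree $2$ and all other vertices of degree $3$. A corner vertex is an end-vertex of a corner path. A corner sequence is a sequence $u_1,\dots,u_k$ of distinct corner vertices such that, for $1\le i<k$, the clockwise traversal of the boundary from $u_i$ to $u_{i+1}$ is a corner path. Let $\mathcal S$ be the set of all maximal corner sequences, where cyclic shifts of the same sequence are counted once and represented by any one of them. Let $t$ be the number of vertices of degree at most $1$. (1) For every solid grid $G$, every solid embedding $\mathcal R$ and every such $\mathcal S$, the set $D$ that consists of the vertices of degree at most $1$ and of every second vertex $u_2,u_4,\dots$ of each sequence in $\mathcal S$ is a geodetic set of minimum cardinality of $G$, and $|D|=t+\sum_{S\in\mathcal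 S}\lfloor |S|/2\rfloor$. (2) There is a linear-time algorithm for computing a minimum geodetic set of a solid grid: there are a program $P$ of a random access machine (with addition, subtraction, comparison and indirect addressing at unit cost) and a constant $c$ such that, for every solid grid $G$ with $n$ vertices, given by arbitrary adjacency lists and without an embedding, $P$ stops after at most $c(n+1)$ steps, with all words bounded by $c(n+1)$, and outputs a geodetic set of minimum cardinality of $G$. Moreover, for every solid embedding of $G$, the output consists of the vertices of degree at most $1$ and of every second vertex of each maximal corner sequence (cyclic shifts again counted once), where each sequence may be read clockwise or counter-clockwise. -/

import Mathlib

/-! ### Geodetic sets -/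

/-- `I(u, v)`: the vertices that lie on some shortest path between `u` and `v`. -/
def geodesicInterval {V : Type*} (G : SimpleGraph V) (u v : V) : Set V :=
  {w | ∃ p : G.Walk u v, p.length = G.dist u v ∧ w ∈ p.support}

/-- Every vertex lies on a shortest path between two vertices of `S`. -/
def IsGeodeticSet {V : Type*} (G : SimpleGraph V) (S : Set V) : Prop :=
  ∀ w, ∃ u ∈ S, ∃ v ∈ S, w ∈ geodesicInterval G u v

/-- A geodetic set of minimum cardinality (used for finite graphs). -/
def IsMinGeodeticSet {V : Type*} (G : SimpleGraph V) (S : Set V) : Prop :=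
  IsGeodeticSet G S ∧ ∀ T : Set V, IsGeodeticSet G T → S.ncard ≤ T.ncard

/-- The degree of a vertex (used for finite graphs). -/
noncomputable def vertexDegree {V : Type*} (G : SimpleGraph V) (v : V) : ℕ :=
  (G.neighborSet v).ncard

/-- `v` separates two other vertices of its connected component. -/
def IsCutVertex {V : Type*} (G : SimpleGraph V) (v : V) : Prop :=
  ∃ u w, u ≠ v ∧ w ≠ v ∧ G.Reachable u w ∧ ∀ p : G.Walk u w, v ∈ p.support

/-! ### Grid embeddings and solid grids -/

/-- Distinct integer points for the vertices, adjacent vertices being at Euclidean distance 1. -/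
structure GridEmbedding {V : Type*} (G : SimpleGraph V) where
  pos : V → ℤ × ℤ
  injective : Function.Injective pos
  unit_length : ∀ u v, G.Adj u v →
    ((pos u).1 - (pos v).1) ^ 2 + ((pos u).2 - (pos v).2) ^ 2 = 1

namespace GridEmbedding

variable {V : Type*} {G : SimpleGraph V}

/-- The unit segment between the points `p` and `q` is drawn, i.e. it is an edge. -/
def Drawn (R : GridEmbedding G) (p q : ℤ × ℤ) : Prop :=
  ∃ u v, G.Adj u v ∧ R.pos u = p ∧ R.pos v = q

/-- The pair `(i, j)` also names the open unit cell with corners `(i, j)`, `(i + 1, j)`,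
`(i, j + 1)`, `(i + 1, j + 1)`. Two cells are joined when they have a common side that is not an
edge. All edges being unit lattice segments, two cells are connected in this graph exactly when
they lie in the same face of the drawing. -/
def cellGraph (R : GridEmbedding G) : SimpleGraph (ℤ × ℤ) :=
  SimpleGraph.fromRel fun a b =>
    (b = (a.1 + 1, a.2) ∧ ¬ R.Drawn (a.1 + 1, a.2) (a.1 + 1, a.2 + 1)) ∨
    (b = (a.1, a.2 + 1) ∧ ¬ R.Drawn (a.1, a.2 + 1) (a.1 + 1, a.2 + 1))

/-- The face that contains the cell `a`, as a set of cells. Its area is its number of cells; it is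
an interior (bounded) face when it is finite and the exterior face when it is infinite. -/
def face (R : GridEmbedding G) (a : ℤ × ℤ) : Set (ℤ × ℤ) :=
  {b | R.cellGraph.Reachable a b}

/-- All interior faces have unit area. -/
def IsSolid (R : GridEmbedding G) : Prop :=
  ∀ a, (R.face a).Finite → (R.face a).ncard = 1

/-- The cell directly to the left of the unit segment traversed from `p` to `q`. -/
def leftCell (p q : ℤ × ℤ) : ℤ × ℤ :=
  (p.1 + ((q.1 - p.1) - (q.2 - p.2) - 1) / 2, p.2 + ((q.2 - p.2) + (q.1 - p.1) - 1) / 2)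

/-- The directed edge from `u` to `v` has the exterior face on its left, which means that it is
traversed when the boundary is followed clockwise. -/
def IsClockwiseBoundary (R : GridEmbedding G) (u v : V) : Prop :=
  G.Adj u v ∧ (R.face (leftCell (R.pos u) (R.pos v))).Infinite

/-- The path `p` is a corner path, and `p` is the clockwise traversal of the boundary from `u` to
`v`: no vertex is a cut-vertex, the two end-vertices have degree 2, and all other vertices have
degree 3. -/
structure IsCornerPath (R : GridEmbedding G) {u v : V} (p : G.Walk u v) : Prop where
  isPath : p.IsPath
  ne : u ≠ v
  boundary : ∀ d ∈ p.darts, R.IsClockwiseBoundary d.fst d.snd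
  not_cut : ∀ w ∈ p.support, ¬ IsCutVertex G w
  degree_fst : vertexDegree G u = 2
  degree_snd : vertexDegree G v = 2
  degree_inner : ∀ w ∈ p.support, w ≠ u → w ≠ v → vertexDegree G w = 3

/-- Some corner path leads clockwise from `u` to `v`. -/
def CornerStep (R : GridEmbedding G) (u v : V) : Prop :=
  ∃ p : G.Walk u v, R.IsCornerPath p

/-- An end-vertex of some corner path. -/
def IsCornerVertex (R : GridEmbedding G) (v : V) : Prop :=
  ∃ u, R.CornerStep u v ∨ R.CornerStep v u

/-- A sequence of distinct corner vertices in which each one is followed by the next corner vertex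
on the clockwise boundary, the stretch of boundary between the two being a corner path. -/
def IsCornerSeq (R : GridEmbedding G) (S : List V) : Prop :=
  S ≠ [] ∧ S.Nodup ∧ (∀ v ∈ S, R.IsCornerVertex v) ∧ S.IsChain R.CornerStep

/-- A corner sequence that is not a proper sub-sequence of another one. -/
def IsMaxCornerSeq (R : GridEmbedding G) (S : List V) : Prop :=
  R.IsCornerSeq S ∧ ∀ T, R.IsCornerSeq T → S <:+: T → T = S

/-- `𝒮` is the set of all maximal corner sequences. If the corner paths close up cyclically (this
happens for rectangles only) then the cyclic shifts of the sequence count as one, and `𝒮` holds one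
of them: each corner vertex lies on exactly one sequence in `𝒮`. -/
def IsCornerSystem (R : GridEmbedding G) (𝒮 : Finset (List V)) : Prop :=
  (∀ S ∈ 𝒮, R.IsMaxCornerSeq S) ∧ ∀ v, R.IsCornerVertex v → ∃! S, S ∈ 𝒮 ∧ v ∈ S

/-- As `IsCornerSystem`, but each sequence may be listed clockwise or counter-clockwise. -/
def IsUnorientedCornerSystem (R : GridEmbedding G) (𝒮 : Finset (List V)) : Prop :=
  (∀ S ∈ 𝒮, R.IsMaxCornerSeq S ∨ R.IsMaxCornerSeq S.reverse) ∧
    ∀ v, R.IsCornerVertex v → ∃! S, S ∈ 𝒮 ∧ v ∈ S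

end GridEmbedding

/-- `G` has a grid embedding all of whose interior faces have unit area. -/
def IsSolidGrid {V : Type*} (G : SimpleGraph V) : Prop :=
  ∃ R : GridEmbedding G, R.IsSolid

/-- The second, fourth, sixth, ... entry of a list. -/
def everySecond {α : Type*} : List α → List α
  | [] => []
  | [_] => []
  | _ :: b :: l => b :: everySecond l

/-- The vertices of degree at most 1. -/
def lowDegreeVertices {V : Type*} (G : SimpleGraph V) : Set V :=
  {v | vertexDegree G v ≤ 1}

/-- The vertices of degree at most 1 and every second vertex of each sequence in `𝒮`. -/
def cornerSelection {V : Type*} (G : SimpleGraph V) (𝒮 : Finset (List V)) : Set V :=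
  lowDegreeVertices G ∪ {v | ∃ S ∈ 𝒮, v ∈ everySecond S}

/-! ### A random access machine with words of bounded size -/

/-- A memory state: registers and arrays of natural numbers. A program names only finitely many
registers and arrays. -/
structure RamState where
  reg : ℕ → ℕ
  arr : ℕ → ℕ → ℕ

namespace RamState

def setReg (s : RamState) (x v : ℕ) : RamState :=
  ⟨Function.update s.reg x v, s.arr⟩

def setArr (s : RamState) (a i v : ℕ) : RamState :=
  ⟨s.reg, Function.update s.arr a (Function.update (s.arr a) i v)⟩

end RamState

/-- Programs of the machine. The arithmetic is addition and truncated subtraction. -/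
inductive RamProg where
  /-- Do nothing. -/
  | skip
  /-- `x := k` for a constant `k`. -/
  | const (x k : ℕ)
  /-- `x := y`. -/
  | copy (x y : ℕ)
  /-- `x := y + z`. -/
  | add (x y z : ℕ)
  /-- `x := y - z`. -/
  | sub (x y z : ℕ)
  /-- `x := a[y]`. -/
  | load (x a y : ℕ)
  /-- `a[x] := y`. -/
  | store (a x y : ℕ)
  | seq (p q : RamProg)
  /-- If `x < y` then `p` else `q`. -/
  | ifLt (x y : ℕ) (p q : RamProg)
  /-- While `x < y` do `p`. -/
  | whileLt (x y : ℕ) (p : RamProg)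

/-- `RamProg.Runs W p s k t`: on a machine whose words hold the numbers from `0` to `W`, the program
`p` started in state `s` stops in state `t` after exactly `k` steps. Each elementary operation and
each evaluation of a test is one step; the result of a computation has to fit into one word (there
is no run otherwise). -/
inductive RamProg.Runs (W : ℕ) : RamProg → RamState → ℕ → RamState → Prop where
  | skip (s) : Runs W .skip s 1 s
  | const (s x k) : k ≤ W → Runs W (.const x k) s 1 (s.setReg x k)
  | copy (s x y) : s.reg y ≤ W → Runs W (.copy x y) s 1 (s.setReg x (s.reg y))
  | add (s x y z) : s.reg y + s.reg z ≤ W →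
      Runs W (.add x y z) s 1 (s.setReg x (s.reg y + s.reg z))
  | sub (s x y z) : s.reg y - s.reg z ≤ W →
      Runs W (.sub x y z) s 1 (s.setReg x (s.reg y - s.reg z))
  | load (s x a y) : s.arr a (s.reg y) ≤ W →
      Runs W (.load x a y) s 1 (s.setReg x (s.arr a (s.reg y)))
  | store (s a x y) : s.reg y ≤ W →
      Runs W (.store a x y) s 1 (s.setArr a (s.reg x) (s.reg y))
  | seq {p q s t r k l} : Runs W p s k t → Runs W q t l r → Runs W (.seq p q) s (k + l) r
  | ifTrue {x y p q s t k} : s.reg x < s.reg y → Runs W p s k t →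
      Runs W (.ifLt x y p q) s (k + 1) t
  | ifFalse {x y p q s t k} : ¬ s.reg x < s.reg y → Runs W q s k t →
      Runs W (.ifLt x y p q) s (k + 1) t
  | whileFalse {x y p s} : ¬ s.reg x < s.reg y → Runs W (.whileLt x y p) s 1 s
  | whileTrue {x y p s t r k l} : s.reg x < s.reg y → Runs W p s k t →
      Runs W (.whileLt x y p) t l r → Runs W (.whileLt x y p) s (k + l + 1) r

/-- Adjacency lists of a graph on `Fin n`: the neighbours of each vertex, in any order. -/
structure AdjacencyLists {n : ℕ} (G : SimpleGraph (Fin n)) where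
  nbrs : Fin n → List (Fin n)
  nodup : ∀ v, (nbrs v).Nodup
  mem_iff : ∀ u v, v ∈ nbrs u ↔ G.Adj u v

namespace AdjacencyLists

variable {n : ℕ} {G : SimpleGraph (Fin n)}

/-- The position at which the list of vertex `i` starts when all lists are written in a row. -/
def offset (L : AdjacencyLists G) (i : ℕ) : ℕ :=
  ∑ v : Fin n, if v.val < i then (L.nbrs v).length else 0

/-- The adjacency lists of the vertices `0, 1, 2, ...`, written in a row. -/
def heads (L : AdjacencyLists G) : List ℕ :=
  (List.ofFn fun v => (L.nbrs v).map Fin.val).flatten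

/-- The initial state: register 0 holds `n`, array 0 holds the `n + 1` offsets, array 1 holds the
lists, and the rest is zero. -/
def input (L : AdjacencyLists G) : RamState where
  reg x := if x = 0 then n else 0
  arr a i :=
    if a = 0 then (if i ≤ n then L.offset i else 0)
    else if a = 1 then L.heads.getD i 0
    else 0

end AdjacencyLists

/-- The set of vertices that a final state represents by its characteristic vector in array 2. -/
def RamState.outputSet (s : RamState) (n : ℕ) : Set (Fin n) :=
  {v | s.arr 2 v.val = 1}

set_option linter.unusedSectionVars false

/-! ### Unit vectors and unit squares -/

/-! Cuts. Every edge is a rung of a maximal straight row of unit squares, its `Ladder`. The cells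
just before and just behind the row are not complete squares, so in a solid embedding they belong to
the exterior face, where winding numbers vanish. The net number of crossings of the rungs by a
closed walk telescopes to a difference of two such winding numbers and is zero
(`Ladder.walkSum_closed`). Hence the rungs form a cut with two well-defined sides, a shortest path
uses at most one rung, and all rungs see a vertex on the same side (`Ladder.dist_lt_iff`). It
follows that two neighbours of `w` that are both closer to `x` span a unit square with `w`
(`IsSolid.quadrangle`), and that a vertex outside `I(a, b)`, in the same component, has a neighbour
that is closer to both `a` and `b` (`IsSolid.exists_common_closer`).

Upper bound. A set that contains the isolated vertices and meets both sides of every cut is geodetic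
(`IsSolid.isGeodeticSet_of_forall`): at an uncovered vertex any two members of its component in the
set would have a common direction, but at most two directions lead towards one vertex, and these are
perpendicular; three suitable members give a contradiction. An inclusion-minimal side consists of
one rail of its ladder, since any other edge leaving the rail would define a smaller side; it is a
vertex of degree 1 or a corner path (`IsSolid.exists_mem_closer`). So it suffices to hit all
vertices of degree at most 1 and all corner paths.

Lower bound. A shortest path that enters and leaves a corner path would use two rungs of one ladder,
so every geodetic set meets every corner path (`IsCornerRail.exists_mem_geodetic`). Corner paths are
straight, and two different ones meet in end-vertices only; the paths that join the first to the
second, the third to the fourth, ... vertex of a sequence are therefore disjoint, and each needs an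
element of its own. Conversely every second vertex meets all corner paths of a sequence. On a cyclic
sequence the closing path is met as well, because consecutive corner paths are perpendicular and the
length is thus even.

Algorithm. Degrees and numbers of 4-cycles do not depend on an embedding, yet they recognise convex
corners and straight boundary vertices (`boundaryType`). Under `BoundaryAdj` these vertices have at
most two neighbours. The components are followed one after the other, first the paths from an end,
then the cycles, and every second corner is marked. Degrees are at most 4, so all local tests take
constant time. The components depend on the graph alone; for each solid embedding the lists of at
least two corners form maximal corner sequences up to reversal (`IsSolid.exists_cornerSystem`). -/

def IsUnitVec (e : ℤ × ℤ) : Prop := e.1 ^ 2 + e.2 ^ 2 = 1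

/-- The vector `e` turned left by a right angle. -/
def rot (e : ℤ × ℤ) : ℤ × ℤ := (-e.2, e.1)

/-- The `i`-th lattice point on the line through `p` in direction `e`. -/
def linePt (p e : ℤ × ℤ) (i : ℤ) : ℤ × ℤ := (p.1 + i * e.1, p.2 + i * e.2)

theorem IsUnitVec.cases {e : ℤ × ℤ} (h : IsUnitVec e) :
    e = (1, 0) ∨ e = (0, 1) ∨ e = (-1, 0) ∨ e = (0, -1) := by
  obtain ⟨x, y⟩ := e
  simp only [IsUnitVec] at h
  have hx : x ≤ 1 := by nlinarith [sq_nonneg y]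
  have hx' : -1 ≤ x := by nlinarith [sq_nonneg y]
  have hy : y ≤ 1 := by nlinarith [sq_nonneg x]
  have hy' : -1 ≤ y := by nlinarith [sq_nonneg x]
  simp only [Prod.mk.injEq]
  interval_cases x <;> interval_cases y <;> simp_all

theorem IsUnitVec.turn {e : ℤ × ℤ} (h : IsUnitVec e) : IsUnitVec (rot e) := by
  simp only [IsUnitVec, rot] at *; linarith [h, neg_sq e.2]

theorem IsUnitVec.neg {e : ℤ × ℤ} (h : IsUnitVec e) : IsUnitVec (-e) := by
  simpa [IsUnitVec] using h

theorem rot_neg (e : ℤ × ℤ) : rot (-e) = -rot e := by simp [rot]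

theorem rot_rot (e : ℤ × ℤ) : rot (rot e) = -e := by
  ext <;> simp [rot]

theorem linePt_zero (p e : ℤ × ℤ) : linePt p e 0 = p := by simp [linePt]

theorem linePt_one (p e : ℤ × ℤ) : linePt p e 1 = p + e := by ext <;> simp [linePt]

theorem linePt_succ (p e : ℤ × ℤ) (i : ℤ) : linePt p e (i + 1) = linePt p e i + e := by
  ext <;> simp [linePt] <;> ring

theorem linePt_sub_one (p e : ℤ × ℤ) (i : ℤ) : linePt p e (i - 1) = linePt p e i - e := by
  ext <;> simp [linePt] <;> ring

theorem linePt_linePt (p e : ℤ × ℤ) (i j : ℤ) : linePt (linePt p e i) e j = linePt p e (i + j) := by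
  ext <;> simp [linePt] <;> ring

theorem linePt_injective (p : ℤ × ℤ) {e : ℤ × ℤ} (he : IsUnitVec e) :
    Function.Injective (linePt p e) := by
  intro i j h
  rcases he.cases with rfl | rfl | rfl | rfl <;> simpa [linePt] using h

/-- The `ℓ¹` distance. -/
def l1Dist (p q : ℤ × ℤ) : ℕ := (p.1 - q.1).natAbs + (p.2 - q.2).natAbs

theorem IsUnitVec.ne_neg {e : ℤ × ℤ} (h : IsUnitVec e) : e ≠ -e := by
  rcases h.cases with rfl | rfl | rfl | rfl <;> simp

theorem IsUnitVec.eq_or {e f : ℤ × ℤ} (he : IsUnitVec e) (hf : IsUnitVec f) :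
    f = e ∨ f = rot e ∨ f = -e ∨ f = -rot e := by
  rcases he.cases with rfl | rfl | rfl | rfl <;> rcases hf.cases with rfl | rfl | rfl | rfl <;>
    simp [rot]

namespace GridEmbedding

variable {V : Type*} {G : SimpleGraph V}

theorem Drawn.symm {R : GridEmbedding G} {p q : ℤ × ℤ} (h : R.Drawn p q) : R.Drawn q p := by
  obtain ⟨u, v, h, hu, hv⟩ := h; exact ⟨v, u, h.symm, hv, hu⟩

theorem drawn_comm (R : GridEmbedding G) {p q : ℤ × ℤ} : R.Drawn p q ↔ R.Drawn q p :=
  ⟨Drawn.symm, Drawn.symm⟩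

theorem drawn_pos_iff (R : GridEmbedding G) {u v : V} : R.Drawn (R.pos u) (R.pos v) ↔ G.Adj u v := by
  constructor
  · rintro ⟨a, b, h, ha, hb⟩
    rwa [← R.injective ha, ← R.injective hb]
  · exact fun h => ⟨u, v, h, rfl, rfl⟩

theorem Drawn.isUnitVec {R : GridEmbedding G} {p q : ℤ × ℤ} (h : R.Drawn p q) :
    IsUnitVec (q - p) := by
  obtain ⟨u, v, h, rfl, rfl⟩ := h
  exact R.unit_length v u h.symm

theorem isUnitVec_sub (R : GridEmbedding G) {u v : V} (h : G.Adj u v) :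
    IsUnitVec (R.pos v - R.pos u) := (R.drawn_pos_iff.2 h).isUnitVec

theorem Drawn.exists_left {R : GridEmbedding G} {p q : ℤ × ℤ} (h : R.Drawn p q) :
    ∃ u, R.pos u = p := by
  obtain ⟨u, v, h, hu, hv⟩ := h; exact ⟨u, hu⟩

theorem Drawn.exists_right {R : GridEmbedding G} {p q : ℤ × ℤ} (h : R.Drawn p q) :
    ∃ u, R.pos u = q := h.symm.exists_left

theorem Drawn.exists_adj {R : GridEmbedding G} {u : V} {q : ℤ × ℤ} (h : R.Drawn (R.pos u) q) :
    ∃ v, G.Adj u v ∧ R.pos v = q := by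
  obtain ⟨a, b, hab, ha, hb⟩ := h
  exact ⟨b, R.injective ha ▸ hab, hb⟩

/-- The four sides of the unit square to the left of the segment from `p` to `p + e` are edges. -/
def IsSquare (R : GridEmbedding G) (p e : ℤ × ℤ) : Prop :=
  R.Drawn p (p + e) ∧ R.Drawn p (p + rot e) ∧ R.Drawn (p + e) (p + e + rot e) ∧
    R.Drawn (p + rot e) (p + e + rot e)

/-- The four sides of the cell `a` are edges. -/
def IsFullCell (R : GridEmbedding G) (a : ℤ × ℤ) : Prop :=
  R.Drawn a (a.1 + 1, a.2) ∧ R.Drawn a (a.1, a.2 + 1) ∧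
    R.Drawn (a.1 + 1, a.2) (a.1 + 1, a.2 + 1) ∧ R.Drawn (a.1, a.2 + 1) (a.1 + 1, a.2 + 1)

/-- The cell to the left of the segment from `p` to `p + e`. -/
def cell (p e : ℤ × ℤ) : ℤ × ℤ := leftCell p (p + e)

theorem cell_east (p : ℤ × ℤ) : cell p (1, 0) = p := by
  ext <;> simp [cell, leftCell]

theorem cell_north (p : ℤ × ℤ) : cell p (0, 1) = (p.1 - 1, p.2) := by
  ext <;> simp [cell, leftCell]; omega

theorem cell_west (p : ℤ × ℤ) : cell p (-1, 0) = (p.1 - 1, p.2 - 1) := by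
  ext <;> simp [cell, leftCell] <;> omega

theorem cell_south (p : ℤ × ℤ) : cell p (0, -1) = (p.1, p.2 - 1) := by
  ext <;> simp [cell, leftCell]; omega

/-- The two segments are consecutive sides in the counter-clockwise tour of one unit square, which
both have on their left. -/
theorem cell_rot {e : ℤ × ℤ} (he : IsUnitVec e) (p : ℤ × ℤ) : cell p (rot e) = cell (p - e) e := by
  rcases he.cases with rfl | rfl | rfl | rfl <;> ext <;>
    simp [cell_east, cell_north, cell_west, cell_south, rot]

theorem isFullCell_cell (R : GridEmbedding G) {e : ℤ × ℤ} (he : IsUnitVec e) (p : ℤ × ℤ) :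
    R.IsFullCell (cell p e) ↔ R.IsSquare p e := by
  obtain ⟨x, y⟩ := p
  rcases he.cases with rfl | rfl | rfl | rfl <;>
    simp only [cell_east, cell_north, cell_west, cell_south, IsFullCell, IsSquare, rot,
      Prod.mk_add_mk, add_zero, neg_zero, sub_add_cancel, neg_neg, ← sub_eq_add_neg]
  · rw [R.drawn_comm (p := (x - 1, y)) (q := (x, y)),
      R.drawn_comm (p := (x - 1, y + 1)) (q := (x, y + 1))]
    tauto
  · rw [R.drawn_comm (p := (x - 1, y - 1)) (q := (x, y - 1)),
      R.drawn_comm (p := (x - 1, y - 1)) (q := (x - 1, y)),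
      R.drawn_comm (p := (x, y - 1)) (q := (x, y)),
      R.drawn_comm (p := (x - 1, y)) (q := (x, y))]
    tauto
  · rw [R.drawn_comm (p := (x, y - 1)) (q := (x, y)),
      R.drawn_comm (p := (x + 1, y - 1)) (q := (x + 1, y))]
    tauto

theorem isSquare_rot_iff (R : GridEmbedding G) {e : ℤ × ℤ} (he : IsUnitVec e) (p : ℤ × ℤ) :
    R.IsSquare p (rot e) ↔ R.IsSquare (p - e) e := by
  rw [← R.isFullCell_cell he, ← R.isFullCell_cell he.turn, cell_rot he]

theorem cellGraph_adj_iff (R : GridEmbedding G) {a b : ℤ × ℤ} :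
    R.cellGraph.Adj a b ↔
      ((b = (a.1 + 1, a.2) ∧ ¬ R.Drawn (a.1 + 1, a.2) (a.1 + 1, a.2 + 1)) ∨
        (b = (a.1, a.2 + 1) ∧ ¬ R.Drawn (a.1, a.2 + 1) (a.1 + 1, a.2 + 1))) ∨
      ((a = (b.1 + 1, b.2) ∧ ¬ R.Drawn (b.1 + 1, b.2) (b.1 + 1, b.2 + 1)) ∨
        (a = (b.1, b.2 + 1) ∧ ¬ R.Drawn (b.1, b.2 + 1) (b.1 + 1, b.2 + 1))) := by
  simp only [cellGraph, SimpleGraph.fromRel_adj, and_iff_right_iff_imp]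
  rintro ((⟨h, -⟩ | ⟨h, -⟩) | (⟨h, -⟩ | ⟨h, -⟩)) <;> rintro rfl <;> simp [Prod.ext_iff] at h

theorem IsFullCell.not_adj {R : GridEmbedding G} {a : ℤ × ℤ} (h : R.IsFullCell a) (b : ℤ × ℤ) :
    ¬ R.cellGraph.Adj a b := by
  obtain ⟨i, j⟩ := a
  obtain ⟨h1, h2, h3, h4⟩ := h
  rw [cellGraph_adj_iff]
  rintro ((⟨hb, h⟩ | ⟨hb, h⟩) | (⟨hb, h⟩ | ⟨hb, h⟩))
  · exact h h3
  · exact h h4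
  · obtain ⟨x, y⟩ := b; simp only [Prod.mk.injEq] at hb; obtain ⟨rfl, rfl⟩ := hb; exact h h2
  · obtain ⟨x, y⟩ := b; simp only [Prod.mk.injEq] at hb; obtain ⟨rfl, rfl⟩ := hb; exact h h1

theorem IsFullCell.face_eq {R : GridEmbedding G} {a : ℤ × ℤ} (h : R.IsFullCell a) :
    R.face a = {a} := by
  ext b
  simp only [face, Set.mem_ofPred_eq, Set.mem_singleton_iff]
  constructor
  · rintro ⟨p⟩
    cases p with
    | nil => rfl
    | cons hab _ => exact absurd hab (h.not_adj _)
  · rintro rfl; exact SimpleGraph.Reachable.refl _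

/-- A finite face is a single cell by solidity, whereas a missing side would join the cell to a
neighbouring one. -/
theorem IsSolid.isFullCell {R : GridEmbedding G} (hR : R.IsSolid) {a : ℤ × ℤ}
    (h : (R.face a).Finite) : R.IsFullCell a := by
  obtain ⟨c, hc⟩ := Set.ncard_eq_one.1 (hR a h)
  have key : ∀ b, ¬ R.cellGraph.Adj a b := by
    intro b hab
    have ha : a ∈ R.face a := SimpleGraph.Reachable.refl _
    have hb : b ∈ R.face a := hab.reachable
    rw [hc] at ha hb
    exact hab.ne (ha.trans hb.symm)
  obtain ⟨i, j⟩ := a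
  simp only [cellGraph_adj_iff] at key
  refine ⟨?_, ?_, ?_, ?_⟩ <;> by_contra hn
  · exact key (i, j - 1) (Or.inr (Or.inr ⟨by simp, by simpa using hn⟩))
  · exact key (i - 1, j) (Or.inr (Or.inl ⟨by simp, by simpa using hn⟩))
  · exact key (i + 1, j) (Or.inl (Or.inl ⟨rfl, hn⟩))
  · exact key (i, j + 1) (Or.inl (Or.inr ⟨rfl, hn⟩))

/-- All uses of solidity pass through this equivalence: faces are replaced by the presence of the
four sides of one square. -/
theorem IsSolid.infinite_face_iff {R : GridEmbedding G} (hR : R.IsSolid) {e : ℤ × ℤ}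
    (he : IsUnitVec e) (p : ℤ × ℤ) : (R.face (cell p e)).Infinite ↔ ¬ R.IsSquare p e := by
  rw [← R.isFullCell_cell he]
  constructor
  · intro h hf
    rw [hf.face_eq] at h
    exact h (Set.finite_singleton _)
  · intro h hf
    exact h (hR.isFullCell hf)

theorem IsSolid.isClockwiseBoundary_iff {R : GridEmbedding G} (hR : R.IsSolid) {u v : V} :
    R.IsClockwiseBoundary u v ↔ G.Adj u v ∧ ¬ R.IsSquare (R.pos u) (R.pos v - R.pos u) := by
  refine and_congr_right fun h => ?_
  rw [← hR.infinite_face_iff (R.isUnitVec_sub h), cell]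
  simp

/-! ### Winding numbers -/

/-- Contribution of the step from `p` to `q` to the signed number of steps from `a` to `b`. -/
def stepSign (a b p q : ℤ × ℤ) : ℤ :=
  (if p = a ∧ q = b then 1 else 0) - (if p = b ∧ q = a then 1 else 0)

/-- The sum of a function over the steps of a walk. -/
def walkSum (R : GridEmbedding G) (f : ℤ × ℤ → ℤ × ℤ → ℤ) {u v : V} (p : G.Walk u v) : ℤ :=
  (p.darts.map fun d => f (R.pos d.fst) (R.pos d.snd)).sum

variable (R : GridEmbedding G)

@[simp] theorem walkSum_nil (f : ℤ × ℤ → ℤ × ℤ → ℤ) (u : V) :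
    R.walkSum f (SimpleGraph.Walk.nil : G.Walk u u) = 0 := by simp [walkSum]

@[simp] theorem walkSum_cons (f : ℤ × ℤ → ℤ × ℤ → ℤ) {u v w : V} (h : G.Adj u v)
    (p : G.Walk v w) :
    R.walkSum f (SimpleGraph.Walk.cons h p) = f (R.pos u) (R.pos v) + R.walkSum f p := by
  simp [walkSum]

theorem walkSum_append (f : ℤ × ℤ → ℤ × ℤ → ℤ) {u v w : V} (p : G.Walk u v) (q : G.Walk v w) :
    R.walkSum f (p.append q) = R.walkSum f p + R.walkSum f q := by
  simp [walkSum, SimpleGraph.Walk.darts_append]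

theorem walkSum_reverse (f : ℤ × ℤ → ℤ × ℤ → ℤ) (hf : ∀ a b, f a b = - f b a) {u v : V}
    (p : G.Walk u v) : R.walkSum f p.reverse = - R.walkSum f p := by
  induction p with
  | nil => simp
  | cons h p ih =>
    simp only [SimpleGraph.Walk.reverse_cons, walkSum_append, ih, walkSum_cons, walkSum_nil]
    rw [hf]; ring

theorem walkSum_congr {f g : ℤ × ℤ → ℤ × ℤ → ℤ}
    (h : ∀ u v, G.Adj u v → f (R.pos u) (R.pos v) = g (R.pos u) (R.pos v))
    {u v : V} (p : G.Walk u v) : R.walkSum f p = R.walkSum g p := by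
  induction p with
  | nil => simp
  | cons e p ih => simp [ih, h _ _ e]

theorem walkSum_sub (f g : ℤ × ℤ → ℤ × ℤ → ℤ) {u v : V} (p : G.Walk u v) :
    R.walkSum (fun a b => f a b - g a b) p = R.walkSum f p - R.walkSum g p := by
  induction p with
  | nil => simp
  | cons e p ih => simp [ih]; ring

theorem walkSum_finset_sum {ι : Type*} (s : Finset ι) (f : ι → ℤ × ℤ → ℤ × ℤ → ℤ) {u v : V}
    (p : G.Walk u v) :
    R.walkSum (fun a b => ∑ i ∈ s, f i a b) p = ∑ i ∈ s, R.walkSum (f i) p := by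
  induction p with
  | nil => simp
  | cons e p ih => simp [ih, Finset.sum_add_distrib]

theorem walkSum_potential (φ : ℤ × ℤ → ℤ) {u v : V} (p : G.Walk u v) :
    R.walkSum (fun a b => φ b - φ a) p = φ (R.pos v) - φ (R.pos u) := by
  induction p with
  | nil => simp
  | cons e p ih => simp [ih]

/-- The contribution of the step from `p` to `q` to the winding number around the cell `c`: the
signed crossing of the vertical ray below the cell. -/
def windStep (c p q : ℤ × ℤ) : ℤ :=
  (if p.1 = c.1 ∧ q.1 = c.1 + 1 ∧ p.2 ≤ c.2 then 1 else 0) -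
    (if q.1 = c.1 ∧ p.1 = c.1 + 1 ∧ p.2 ≤ c.2 then 1 else 0)

/-- The winding number of a closed walk around a cell. -/
def winding {u : V} (p : G.Walk u u) (c : ℤ × ℤ) : ℤ := R.walkSum (windStep c) p

theorem adj_pos_cases {u v : V} (h : G.Adj u v) :
    R.pos v = ((R.pos u).1 + 1, (R.pos u).2) ∨ R.pos v = ((R.pos u).1, (R.pos u).2 + 1) ∨
      R.pos v = ((R.pos u).1 - 1, (R.pos u).2) ∨ R.pos v = ((R.pos u).1, (R.pos u).2 - 1) := by
  have := (R.isUnitVec_sub h).cases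
  simp only [Prod.ext_iff, Prod.fst_sub, Prod.snd_sub] at *
  omega

/-- The rays below the two cells differ in exactly one segment, the common side of the cells. -/
theorem winding_vertical {u : V} (p : G.Walk u u) (x y : ℤ) :
    R.winding p (x, y) - R.winding p (x, y - 1) =
      R.walkSum (stepSign (x, y) (x + 1, y)) p := by
  rw [winding, winding, ← walkSum_sub]
  refine R.walkSum_congr (fun u v h => ?_) p
  rcases R.adj_pos_cases h with h | h | h | h <;> rw [h] <;>
    simp only [windStep, stepSign, Prod.ext_iff] <;> split_ifs <;> omega

theorem winding_horizontal {u : V} (p : G.Walk u u) (x y : ℤ) :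
    R.winding p (x - 1, y) - R.winding p (x, y) =
      R.walkSum (stepSign (x, y) (x, y + 1)) p := by
  -- The rays lie in neighbouring columns. Up to crossings of the common side, the step functions
  -- differ by the increment of the indicator of the lattice ray between them, and this increment
  -- sums to zero on a closed walk.
  have h0 := R.walkSum_potential (fun a => if a.1 = x ∧ a.2 ≤ y then 1 else 0) p
  rw [sub_self] at h0
  rw [winding, winding, ← walkSum_sub, ← sub_eq_zero, ← walkSum_sub, ← h0]
  refine R.walkSum_congr (fun u v h => ?_) p
  rcases R.adj_pos_cases h with h | h | h | h <;> rw [h] <;>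
    simp only [windStep, stepSign, Prod.ext_iff] <;> split_ifs <;> omega

theorem stepSign_comm (a b p q : ℤ × ℤ) : stepSign b a p q = - stepSign a b p q := by
  simp [stepSign]

theorem stepSign_swap (a b p q : ℤ × ℤ) : stepSign a b p q = - stepSign a b q p := by
  simp [stepSign, and_comm]

theorem walkSum_stepSign_comm (a b : ℤ × ℤ) {u v : V} (p : G.Walk u v) :
    R.walkSum (stepSign a b) p = - R.walkSum (stepSign b a) p := by
  induction p with
  | nil => simp
  | cons e p ih => simp [ih, stepSign_comm a b]; ring

/-- The two preceding lemmas in one form for all directions: the winding number on the left minus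
that on the right of a segment is the net number of traversals of it. -/
theorem winding_cell {u : V} (c : G.Walk u u) {e : ℤ × ℤ} (he : IsUnitVec e) (p : ℤ × ℤ) :
    R.winding c (cell p e) - R.winding c (cell (p + e) (-e)) =
      R.walkSum (stepSign p (p + e)) c := by
  obtain ⟨x, y⟩ := p
  rcases he.cases with rfl | rfl | rfl | rfl
  · have := R.winding_vertical c x y
    simpa [cell_east, cell_west] using this
  · have := R.winding_horizontal c x y
    simpa [cell_north, cell_south] using this
  · have := R.winding_vertical c (x - 1) y
    rw [walkSum_stepSign_comm] at this
    simp [cell_east, cell_west, ← sub_eq_add_neg] at *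
    linarith
  · have := R.winding_horizontal c x (y - 1)
    rw [walkSum_stepSign_comm] at this
    simp [cell_north, cell_south, ← sub_eq_add_neg] at *
    linarith

theorem walkSum_stepSign_eq_zero {a b : ℤ × ℤ} (h : ¬ R.Drawn a b) {u v : V} (p : G.Walk u v) :
    R.walkSum (stepSign a b) p = 0 := by
  rw [R.walkSum_congr (g := fun _ _ => 0)]
  · simp [walkSum]
  · intro u v huv
    rw [stepSign, if_neg, if_neg, sub_zero]
    · rintro ⟨hu, hv⟩; exact h ⟨v, u, huv.symm, hv, hu⟩
    · rintro ⟨hu, hv⟩; exact h ⟨u, v, huv, hu, hv⟩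

theorem winding_eq_of_adj {u : V} (p : G.Walk u u) {a b : ℤ × ℤ} (h : R.cellGraph.Adj a b) :
    R.winding p a = R.winding p b := by
  have key : ∀ a b : ℤ × ℤ, ((b = (a.1 + 1, a.2) ∧ ¬ R.Drawn (a.1 + 1, a.2) (a.1 + 1, a.2 + 1)) ∨
        (b = (a.1, a.2 + 1) ∧ ¬ R.Drawn (a.1, a.2 + 1) (a.1 + 1, a.2 + 1))) →
        R.winding p a = R.winding p b := by
    rintro ⟨x, y⟩ b (⟨rfl, h⟩ | ⟨rfl, h⟩)
    · have := R.winding_horizontal p (x + 1) y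
      rw [R.walkSum_stepSign_eq_zero h, add_sub_cancel_right] at this
      linarith
    · have := R.winding_vertical p x (y + 1)
      rw [R.walkSum_stepSign_eq_zero h, add_sub_cancel_right] at this
      linarith
  rw [cellGraph_adj_iff] at h
  rcases h with h | h
  · exact key _ _ h
  · exact (key _ _ h).symm

theorem winding_eq_of_mem_face {u : V} (p : G.Walk u u) {a b : ℤ × ℤ} (h : b ∈ R.face a) :
    R.winding p a = R.winding p b := by
  obtain ⟨q⟩ := h
  induction q with
  | nil => rfl
  | cons h _ ih => exact (R.winding_eq_of_adj p h).trans ih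

/-- The winding number is constant on a face, and an infinite face has a cell outside any bounding
box of the drawing. -/
theorem winding_eq_zero [Finite V] {u : V} (p : G.Walk u u) {a : ℤ × ℤ}
    (h : (R.face a).Infinite) : R.winding p a = 0 := by
  obtain ⟨B, hB⟩ : ∃ B : ℤ, ∀ v, |(R.pos v).1| ≤ B ∧ |(R.pos v).2| ≤ B := by
    have h1 := (Set.finite_range fun v => |(R.pos v).1|).bddAbove
    have h2 := (Set.finite_range fun v => |(R.pos v).2|).bddAbove
    obtain ⟨b1, h1⟩ := h1
    obtain ⟨b2, h2⟩ := h2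
    exact ⟨max b1 b2, fun v => ⟨le_max_of_le_left (h1 ⟨v, rfl⟩), le_max_of_le_right (h2 ⟨v, rfl⟩)⟩⟩
  obtain ⟨b, hb, hb'⟩ : ∃ b ∈ R.face a, b ∉ Set.Icc (-B - 1) B ×ˢ Set.Icc (-B - 1) B := by
    by_contra! hc
    exact h (((Set.finite_Icc _ _).prod (Set.finite_Icc _ _)).subset hc)
  rw [R.winding_eq_of_mem_face p hb]
  obtain ⟨x, y⟩ := b
  simp only [Set.mem_prod, Set.mem_Icc] at hb'
  -- Above the box the ray meets the whole column, so crossings are increments of an indicator and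
  -- cancel; in all other positions outside the box no step crosses the ray.
  by_cases hy : B < y
  · have h0 := R.walkSum_potential (fun a => if x < a.1 then 1 else 0) p
    rw [sub_self] at h0
    rw [winding, ← h0]
    refine R.walkSum_congr (fun u v h => ?_) p
    have hu := abs_le.1 (hB u).2
    rcases R.adj_pos_cases h with h | h | h | h <;> rw [h] <;>
      simp only [windStep] <;> split_ifs <;> omega
  · rw [winding, R.walkSum_congr (g := fun _ _ => 0)]
    · simp [walkSum]
    · intro u v _
      have hu := abs_le.1 (hB u).2
      have hu1 := abs_le.1 (hB u).1
      have hv1 := abs_le.1 (hB v).1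
      simp only [windStep]
      split_ifs <;> omega

end GridEmbedding

namespace GridEmbedding

variable {V : Type*} {G : SimpleGraph V}

/-! ### Distances in grid graphs -/

theorem l1Dist_le_length (R : GridEmbedding G) {u v : V} (p : G.Walk u v) :
    l1Dist (R.pos u) (R.pos v) ≤ p.length := by
  induction p with
  | nil => simp [l1Dist]
  | cons h p ih =>
    have := R.adj_pos_cases h
    simp only [SimpleGraph.Walk.length_cons, l1Dist, Prod.ext_iff] at *
    omega

theorem parity_length (R : GridEmbedding G) {u v : V} (p : G.Walk u v) :
    ((R.pos u).1 + (R.pos u).2 + (R.pos v).1 + (R.pos v).2 + p.length) % 2 = 0 := by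
  induction p with
  | nil => simp; omega
  | cons h p ih =>
    have := R.adj_pos_cases h
    simp only [SimpleGraph.Walk.length_cons, Prod.ext_iff] at *
    omega

/-- Grid graphs are bipartite by the parity of the coordinate sum, so the two distances cannot be
equal. -/
theorem dist_adj_cases (R : GridEmbedding G) {w y x : V} (h : G.Adj w y) (hx : G.Reachable w x) :
    G.dist y x + 1 = G.dist w x ∨ G.dist w x + 1 = G.dist y x := by
  obtain ⟨p, hp⟩ := hx.exists_walk_length_eq_dist
  obtain ⟨q, hq⟩ := (h.symm.reachable.trans hx).exists_walk_length_eq_dist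
  have h1 := R.parity_length p
  have h2 := R.parity_length q
  have h3 := R.parity_length h.toWalk
  have h4 := SimpleGraph.dist_le (SimpleGraph.Walk.cons h q)
  have h5 := SimpleGraph.dist_le (SimpleGraph.Walk.cons h.symm p)
  simp only [SimpleGraph.Walk.length_cons, SimpleGraph.Walk.length_nil] at *
  omega

theorem exists_split_of_mem_darts {u v : V} (p : G.Walk u v) {d : G.Dart} (hd : d ∈ p.darts) :
    ∃ (q : G.Walk u d.fst) (r : G.Walk d.snd v), p.length = q.length + 1 + r.length := by
  induction p with
  | nil => simp at hd
  | cons h p ih =>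
    rw [SimpleGraph.Walk.darts_cons, List.mem_cons] at hd
    rcases hd with rfl | hd
    · exact ⟨.nil, p, by simp; omega⟩
    · obtain ⟨q, r, hqr⟩ := ih hd
      exact ⟨.cons h q, r, by simp; omega⟩

theorem exists_walk_of_adj_succ {v : ℕ → V} {m : ℕ} (h : ∀ i < m, G.Adj (v i) (v (i + 1))) :
    ∃ p : G.Walk (v 0) (v m), p.length = m ∧ p.support = (List.range (m + 1)).map v ∧
      ∀ d ∈ p.darts, ∃ i < m, d.fst = v i ∧ d.snd = v (i + 1) := by
  induction m with
  | zero => exact ⟨.nil, rfl, rfl, by simp⟩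
  | succ m ih =>
    obtain ⟨p, hp, hs, hd⟩ := ih fun i hi => h i (by omega)
    refine ⟨p.concat (h m (by omega)), by simp [hp], ?_, ?_⟩
    · rw [SimpleGraph.Walk.support_concat, hs, List.range_succ (n := m + 1)]
      simp
    · intro d hdd
      rw [SimpleGraph.Walk.darts_concat, List.concat_eq_append, List.mem_append] at hdd
      rcases hdd with hdd | hdd
      · obtain ⟨i, hi, h1⟩ := hd d hdd
        exact ⟨i, by omega, h1⟩
      · simp only [List.mem_singleton] at hdd
        exact ⟨m, by omega, by rw [hdd], by rw [hdd]⟩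

theorem dist_le_of_adj_succ {v : ℕ → V} {m : ℕ} (h : ∀ i < m, G.Adj (v i) (v (i + 1)))
    {i j : ℕ} (hi : i ≤ m) (hj : j ≤ m) :
    G.Reachable (v i) (v j) ∧ G.dist (v i) (v j) ≤ ((i : ℤ) - j).natAbs := by
  have key : ∀ i j, i ≤ j → j ≤ m →
      G.Reachable (v i) (v j) ∧ G.dist (v i) (v j) ≤ ((i : ℤ) - j).natAbs := by
    intro i j hij hj
    obtain ⟨p, hp, -, -⟩ := exists_walk_of_adj_succ (G := G) (v := fun k => v (i + k)) (m := j - i)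
      fun k hk => h (i + k) (by omega)
    have hq := SimpleGraph.dist_le p
    have hr := p.reachable
    simp only [add_zero, Nat.add_sub_cancel' hij] at hq hr
    exact ⟨hr, by omega⟩
  rcases le_total i j with hij | hij
  · exact key i j hij hj
  · have := key j i hij hi
    refine ⟨this.1.symm, ?_⟩
    rw [SimpleGraph.dist_comm]
    omega

/-! ### Ladders -/

/-- A maximal straight row of unit squares; `vert false i` and `vert true i` are the ends of its
`i`-th rung. -/
structure Ladder (R : GridEmbedding G) where
  base : ℤ × ℤ
  dir : ℤ × ℤ
  len : ℕ
  vert : Bool → ℕ → V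
  unit : IsUnitVec dir
  pos_vert : ∀ s, ∀ i ≤ len, R.pos (vert s i) = linePt base dir i + if s then rot dir else 0
  rung : ∀ i ≤ len, G.Adj (vert false i) (vert true i)
  rail : ∀ s, ∀ i < len, G.Adj (vert s i) (vert s (i + 1))
  before : ¬ R.IsSquare (linePt base dir (-1)) dir
  after : ¬ R.IsSquare (linePt base dir len) dir

/-- The row of squares that contains a given edge. -/
theorem exists_ladder [Finite V] (R : GridEmbedding G) {w y : V} (h : G.Adj w y) :
    ∃ K : R.Ladder, ∃ i ≤ K.len, K.vert false i = w ∧ K.vert true i = y := by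
  classical
  set d := R.pos y - R.pos w with hd
  have hdu : IsUnitVec d := R.isUnitVec_sub h
  -- With this choice `rot e` is the given edge, which becomes a rung.
  set e := -rot d with he
  have heu : IsUnitVec e := hdu.turn.neg
  have hde : rot e = d := by rw [he, rot_neg, rot_rot, neg_neg]
  -- There are finitely many vertices, so the row of squares ends in both directions. Below, `a` and
  -- `b` count its squares ahead of and behind the given edge, which is hence the rung with index
  -- `b`.
  have hfin : ∀ g : ℕ → ℤ, Function.Injective g →
      ∃ k, ¬ R.IsSquare (linePt (R.pos w) e (g k)) e := by
    intro g hg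
    by_contra! hc
    choose f hf using fun k => (hc k).1.exists_left
    have : Function.Injective f := by
      intro a b hab
      apply hg
      apply linePt_injective (R.pos w) heu
      rw [← hf, ← hf, hab]
    exact not_injective_infinite_finite f this
  have ha := hfin (fun k => (k : ℤ)) Nat.cast_injective
  have hb := hfin (fun k => -(k : ℤ) - 1) (fun a b h => by simpa using h)
  set a := Nat.find ha with haa
  set b := Nat.find hb with hbb
  have ha1 : ¬ R.IsSquare (linePt (R.pos w) e a) e := Nat.find_spec ha
  have hb1 : ¬ R.IsSquare (linePt (R.pos w) e (-b - 1)) e := Nat.find_spec hb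
  have hsq : ∀ j : ℤ, -b ≤ j → j < a → R.IsSquare (linePt (R.pos w) e j) e := by
    intro j h1 h2
    rcases le_or_gt 0 j with hj | hj
    · obtain ⟨k, rfl⟩ := Int.eq_ofNat_of_zero_le hj
      exact not_not.1 (Nat.find_min ha (m := k) (by omega))
    · have := not_not.1 (Nat.find_min hb (m := (-j - 1).toNat) (by omega))
      rwa [show -(((-j - 1).toNat : ℕ) : ℤ) - 1 = j by omega] at this
  have hrung : ∀ j : ℤ, -b ≤ j → j ≤ a →
      R.Drawn (linePt (R.pos w) e j) (linePt (R.pos w) e j + d) := by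
    intro j h1 h2
    rcases lt_or_eq_of_le h2 with h3 | h3
    · have := (hsq j h1 h3).2.1
      rwa [hde] at this
    · by_cases h4 : j = 0
      · subst h4
        rw [linePt_zero, hd, add_sub_cancel]
        exact R.drawn_pos_iff.2 h
      · have := (hsq (j - 1) (by omega) (by omega)).2.2.1
        rwa [hde, ← linePt_succ, sub_add_cancel] at this
  have hex : ∀ (s : Bool) (i : ℕ), ∃ v : V, i ≤ a + b →
      R.pos v = linePt (linePt (R.pos w) e (-b)) e i + if s then rot e else 0 := by
    intro s i
    by_cases hi : i ≤ a + b
    · have := hrung (-b + i) (by omega) (by omega)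
      rw [← hde] at this
      rw [linePt_linePt]
      cases s
      · obtain ⟨v, hv⟩ := this.exists_left
        exact ⟨v, fun _ => by simp [hv]⟩
      · obtain ⟨v, hv⟩ := this.exists_right
        exact ⟨v, fun _ => by simp [hv]⟩
    · exact ⟨w, fun h => absurd h hi⟩
  choose vert hvert using hex
  refine ⟨⟨linePt (R.pos w) e (-b), e, a + b, vert, heu, fun s i hi => hvert s i hi, ?_, ?_, ?_, ?_⟩,
    b, by simp, ?_, ?_⟩
  · intro i hi
    rw [← R.drawn_pos_iff, hvert _ _ hi, hvert _ _ hi, linePt_linePt]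
    simpa [hde] using hrung (-b + i) (by omega) (by omega)
  · intro s i hi
    rw [← R.drawn_pos_iff, hvert _ _ hi.le, hvert _ _ hi, linePt_linePt, linePt_linePt]
    have := hsq (-b + i) (by omega) (by omega)
    push_cast
    rw [← add_assoc, linePt_succ]
    cases s
    · simpa using this.1
    · simpa using this.2.2.2
  · rw [linePt_linePt]; exact hb1
  · rw [linePt_linePt]; push_cast; simpa using ha1
  · apply R.injective
    rw [hvert _ _ (by simp), linePt_linePt]
    simp [linePt_zero]
  · apply R.injective
    rw [hvert _ _ (by simp), linePt_linePt]
    simp [linePt_zero, hde, hd]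

namespace Ladder

variable {R : GridEmbedding G} (K : R.Ladder)

theorem rung' (s : Bool) {i : ℕ} (hi : i ≤ K.len) : G.Adj (K.vert s i) (K.vert (!s) i) := by
  cases s
  · exact K.rung i hi
  · exact (K.rung i hi).symm

theorem isSquare {i : ℕ} (hi : i < K.len) : R.IsSquare (linePt K.base K.dir i) K.dir := by
  have h1 := R.drawn_pos_iff.2 (K.rail false i hi)
  have h2 := R.drawn_pos_iff.2 (K.rail true i hi)
  have h3 := R.drawn_pos_iff.2 (K.rung i hi.le)
  have h4 := R.drawn_pos_iff.2 (K.rung (i + 1) hi)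
  rw [K.pos_vert _ _ hi.le, K.pos_vert _ _ hi] at h1 h2
  rw [K.pos_vert _ _ hi.le, K.pos_vert _ _ hi.le] at h3
  rw [K.pos_vert _ _ hi, K.pos_vert _ _ hi] at h4
  push_cast at *
  simp only [linePt_succ, add_zero, reduceIte] at *
  exact ⟨h1, h3, h4, h2⟩

theorem l1Dist_vert (s t : Bool) {i j : ℕ} (hi : i ≤ K.len) (hj : j ≤ K.len) :
    l1Dist (R.pos (K.vert s i)) (R.pos (K.vert t j)) =
      ((i : ℤ) - j).natAbs + if s = t then 0 else 1 := by
  rw [K.pos_vert _ _ hi, K.pos_vert _ _ hj]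
  rcases K.unit.cases with h | h | h | h <;> rw [h] <;> cases s <;> cases t <;>
    simp [l1Dist, linePt, rot] <;> omega

/-- Walk along the rail and cross at the end. By `l1Dist_vert` and `l1Dist_le_length` no walk is
shorter, so ladders are isometric subgraphs. -/
theorem reachable_dist_le (s t : Bool) {i j : ℕ} (hi : i ≤ K.len) (hj : j ≤ K.len) :
    G.Reachable (K.vert s i) (K.vert t j) ∧
    G.dist (K.vert s i) (K.vert t j) ≤ ((i : ℤ) - j).natAbs + if s = t then 0 else 1 := by
  have h1 := dist_le_of_adj_succ (K.rail s) hi hj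
  by_cases hst : s = t
  · subst hst; simpa using h1
  · have : t = !s := by cases s <;> cases t <;> simp_all
    subst this
    have h2 := K.rung' s hj
    refine ⟨h1.1.trans h2.reachable, ?_⟩
    have := h2.reachable.dist_triangle_right (K.vert s i)
    rw [SimpleGraph.dist_eq_one_iff_adj.2 h2] at this
    simp
    omega

/-- The signed number of crossings of the ladder by a unit step. -/
def crossing (p q : ℤ × ℤ) : ℤ :=
  ∑ i ∈ Finset.range (K.len + 1),
    stepSign (linePt K.base K.dir i) (linePt K.base K.dir i + rot K.dir) p q

theorem crossing_swap (p q : ℤ × ℤ) : K.crossing p q = - K.crossing q p := by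
  simp only [crossing, ← Finset.sum_neg_distrib]
  exact Finset.sum_congr rfl fun i _ => stepSign_swap _ _ _ _

theorem vert_ne_of_ne (s t : Bool) {i j : ℕ} (hi : i ≤ K.len) (hj : j ≤ K.len)
    (h : K.vert s i = K.vert t j) : s = t ∧ i = j := by
  have := K.l1Dist_vert s t hi hj
  rw [h] at this
  simp only [l1Dist, sub_self, Int.natAbs_zero, add_zero] at this
  by_cases hst : s = t
  · simp [hst] at *; omega
  · simp [hst] at this

theorem crossing_rung (i : ℕ) (hi : i ≤ K.len) :
    K.crossing (R.pos (K.vert false i)) (R.pos (K.vert true i)) = 1 := by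
  have hb : ∀ j ≤ K.len, linePt K.base K.dir j = R.pos (K.vert false j) := fun j hj => by
    simp [K.pos_vert false j hj]
  have ht : ∀ j ≤ K.len, linePt K.base K.dir j + rot K.dir = R.pos (K.vert true j) :=
    fun j hj => by simp [K.pos_vert true j hj]
  rw [crossing, Finset.sum_eq_single i]
  · rw [ht i hi, hb i hi, stepSign, if_pos ⟨rfl, rfl⟩, if_neg, sub_zero]
    rintro ⟨h, -⟩
    exact (K.rung i hi).ne (R.injective h)
  · intro j hj hji
    have hj' : j ≤ K.len := by simpa [Nat.lt_succ_iff] using hj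
    rw [ht j hj', hb j hj', stepSign, if_neg, if_neg, sub_zero]
    · rintro ⟨h, -⟩
      exact absurd (K.vert_ne_of_ne _ _ hi hj' (R.injective h)).1 (by simp)
    · rintro ⟨h, -⟩
      exact hji (K.vert_ne_of_ne _ _ hi hj' (R.injective h)).2.symm
  · intro h; exact absurd (by simpa [Nat.lt_succ_iff] using hi) h

theorem exists_rung_of_crossing_ne_zero {a b : V} (h : K.crossing (R.pos a) (R.pos b) ≠ 0) :
    ∃ s, ∃ i ≤ K.len, a = K.vert s i ∧ b = K.vert (!s) i := by
  obtain ⟨i, hi, hne⟩ := Finset.exists_ne_zero_of_sum_ne_zero h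
  have hi' : i ≤ K.len := by simpa [Nat.lt_succ_iff] using hi
  have hb : linePt K.base K.dir i = R.pos (K.vert false i) := by simp [K.pos_vert false i hi']
  have ht : linePt K.base K.dir i + rot K.dir = R.pos (K.vert true i) := by
    simp [K.pos_vert true i hi']
  rw [ht, hb, stepSign] at hne
  split_ifs at hne with h1 h2 h2
  · simp at hne
  · exact ⟨false, i, hi', R.injective h1.1, R.injective h1.2⟩
  · exact ⟨true, i, hi', R.injective h2.1, R.injective h2.2⟩
  · simp at hne

/-- A closed walk crosses a ladder equally often in both directions. -/
theorem walkSum_closed [Finite V] (hR : R.IsSolid) {u : V} (c : G.Walk u u) :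
    R.walkSum K.crossing c = 0 := by
  -- A rung separates two consecutive cells of the row, so its net number of traversals is the
  -- difference of their winding numbers.
  have h1 : ∀ i : ℤ, R.walkSum (stepSign (linePt K.base K.dir i)
      (linePt K.base K.dir i + rot K.dir)) c =
      R.winding c (cell (linePt K.base K.dir (i - 1)) K.dir) -
        R.winding c (cell (linePt K.base K.dir i) K.dir) := by
    intro i
    rw [← R.winding_cell c K.unit.turn, cell_rot K.unit, linePt_sub_one]
    have := cell_rot K.unit.turn.turn (linePt K.base K.dir i + rot K.dir)
    have h2 := cell_rot K.unit.turn (linePt K.base K.dir i + rot K.dir + K.dir)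
    rw [rot_rot] at this h2
    have h3 := cell_rot K.unit.turn.turn.turn (linePt K.base K.dir i)
    simp only [rot_rot, rot_neg, neg_neg, sub_neg_eq_add] at *
    rw [h3]
  have h2 : R.walkSum K.crossing c = ∑ i ∈ Finset.range (K.len + 1),
      R.walkSum (stepSign (linePt K.base K.dir i) (linePt K.base K.dir i + rot K.dir)) c :=
    R.walkSum_finset_sum _ _ c
  rw [h2]
  -- The sum telescopes to the two cells just outside the row. These are incomplete by `before` and
  -- `after` and therefore exterior.
  have h3 : ∀ n : ℕ, ∑ i ∈ Finset.range (n + 1),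
      R.walkSum (stepSign (linePt K.base K.dir i) (linePt K.base K.dir i + rot K.dir)) c =
      R.winding c (cell (linePt K.base K.dir (-1)) K.dir) -
        R.winding c (cell (linePt K.base K.dir n) K.dir) := by
    intro n
    induction n with
    | zero => rw [Finset.sum_range_one, h1]; simp
    | succ n ih => rw [Finset.sum_range_succ, ih, h1]; push_cast; simp
  rw [h3, R.winding_eq_zero c ((hR.infinite_face_iff K.unit _).2 K.before),
    R.winding_eq_zero c ((hR.infinite_face_iff K.unit _).2 K.after), sub_zero]

/-- The net number of crossings depends on the ends only; this is what gives a ladder two sides. -/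
theorem walkSum_eq [Finite V] (hR : R.IsSolid) {u v : V} (p q : G.Walk u v) :
    R.walkSum K.crossing p = R.walkSum K.crossing q := by
  have := K.walkSum_closed hR (p.append q.reverse)
  rw [R.walkSum_append, R.walkSum_reverse _ K.crossing_swap] at this
  linarith

/-- A shortest path uses at most one rung of a ladder. -/
theorem crossing_eq_zero_of_geodesic (s : Bool) {i : ℕ} (hi : i ≤ K.len) {x : V}
    (q : G.Walk (K.vert (!s) i) x) (hq : q.length + 1 = G.dist (K.vert s i) x) :
    ∀ d ∈ q.darts, K.crossing (R.pos d.fst) (R.pos d.snd) = 0 := by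
  intro d hd
  by_contra hne
  obtain ⟨t, j, hj, ha, hb⟩ := K.exists_rung_of_crossing_ne_zero hne
  obtain ⟨q1, q2, h5⟩ := exists_split_of_mem_darts q hd
  have h1 := R.l1Dist_le_length q1
  have hl := K.l1Dist_vert (!s) t hi hj
  rw [← ha] at hl
  rw [hl] at h1
  -- A direct walk inside the ladder to the far end of the second rung avoids both crossings and is
  -- shorter by two.
  have h2 := K.reachable_dist_le s (!t) hi hj
  rw [← hb] at h2
  have h3 := SimpleGraph.dist_le q2
  have h4 := h2.1.dist_triangle_left x
  have h6 : ((!s) = t) ↔ (s = !t) := by cases s <;> cases t <;> simp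
  simp only [h6] at h1
  omega

theorem walkSum_eq_zero_of_geodesic (s : Bool) {i : ℕ} (hi : i ≤ K.len) {x : V}
    (q : G.Walk (K.vert (!s) i) x) (hq : q.length + 1 = G.dist (K.vert s i) x) :
    R.walkSum K.crossing q = 0 := by
  apply List.sum_eq_zero
  simp only [List.mem_map, forall_exists_index, and_imp, forall_apply_eq_imp_iff₂]
  exact K.crossing_eq_zero_of_geodesic s hi q hq

/-- The crossings may be counted along a shortest path. If the other end of the rung is closer to
`x`, one starts over this rung and crosses no further one; otherwise no rung is used at all. -/
theorem walkSum_from_rung [Finite V] (hR : R.IsSolid) {i : ℕ} (hi : i ≤ K.len) {x : V}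
    (p : G.Walk (K.vert false i) x) :
    R.walkSum K.crossing p =
      if G.dist (K.vert true i) x < G.dist (K.vert false i) x then 1 else 0 := by
  have hadj := K.rung i hi
  rcases R.dist_adj_cases hadj p.reachable with h | h
  · obtain ⟨q, hq⟩ := (hadj.symm.reachable.trans p.reachable).exists_walk_length_eq_dist
    rw [if_pos (by omega), K.walkSum_eq hR p (.cons hadj q), R.walkSum_cons, K.crossing_rung i hi,
      K.walkSum_eq_zero_of_geodesic false hi q (by omega), add_zero]
  · obtain ⟨q, hq⟩ := p.reachable.exists_walk_length_eq_dist
    rw [if_neg (by omega), K.walkSum_eq hR p q,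
      K.walkSum_eq_zero_of_geodesic true hi q (by rw [hq]; exact h)]

theorem crossing_rail (s : Bool) {i : ℕ} (hi : i < K.len) :
    K.crossing (R.pos (K.vert s i)) (R.pos (K.vert s (i + 1))) = 0 := by
  by_contra h
  obtain ⟨t, j, hj, ha, hb⟩ := K.exists_rung_of_crossing_ne_zero h
  have h1 := (K.vert_ne_of_ne _ _ hi.le hj ha)
  have h2 := (K.vert_ne_of_ne _ _ (by omega) hj hb)
  omega

/-- All rungs of a ladder have the same vertices on either side. -/
theorem dist_lt_iff [Finite V] (hR : R.IsSolid) {i j : ℕ} (hi : i ≤ K.len) (hj : j ≤ K.len)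
    {x : V} (hx : G.Reachable (K.vert false i) x) :
    G.dist (K.vert true i) x < G.dist (K.vert false i) x ↔
      G.dist (K.vert true j) x < G.dist (K.vert false j) x := by
  have key : ∀ i, i + 1 ≤ K.len → G.Reachable (K.vert false i) x →
      (G.dist (K.vert true i) x < G.dist (K.vert false i) x ↔
      G.dist (K.vert true (i + 1)) x < G.dist (K.vert false (i + 1)) x) := by
    intro i hi hx
    have hadj := K.rail false i hi
    obtain ⟨q⟩ := hadj.symm.reachable.trans hx
    have h1 := K.walkSum_from_rung hR hi q
    have h2 := K.walkSum_from_rung hR (by omega) (.cons hadj q)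
    rw [R.walkSum_cons, K.crossing_rail false hi, zero_add, h1] at h2
    split_ifs at h2 <;> omega
  have key2 : ∀ i, i ≤ K.len → G.Reachable (K.vert false i) x →
      (G.dist (K.vert true 0) x < G.dist (K.vert false 0) x ↔
      G.dist (K.vert true i) x < G.dist (K.vert false i) x) := by
    intro i
    induction i with
    | zero => simp
    | succ i ih =>
      intro hi hx
      have hx' := (K.rail false i hi).reachable.trans hx
      rw [ih (by omega) hx', key i hi hx']
  rw [← key2 i hi hx, key2 j hj ((K.reachable_dist_le _ _ hj hi).1.trans hx)]

end Ladder

end GridEmbedding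

/-! ### Quadrangles, geodesic intervals and bridges in solid grids -/

namespace GridEmbedding

variable {V : Type*} {G : SimpleGraph V} {R : GridEmbedding G}

theorem isSquare_neg_rot_iff (R : GridEmbedding G) {e : ℤ × ℤ} (he : IsUnitVec e) (p : ℤ × ℤ) :
    R.IsSquare (p + rot e) (-rot e) ↔ R.IsSquare p e := by
  have h3 := R.isSquare_rot_iff he.turn.turn (p + rot e)
  have h2 := R.isSquare_rot_iff he.turn (p + rot e - rot (rot e))
  have h1 := R.isSquare_rot_iff he (p + rot e - rot (rot e) - rot e)
  rw [rot_rot (rot e)] at h3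
  rw [h3, h2, h1, rot_rot, show p + rot e - -e - rot e - e = p by abel]

theorem exists_crossing_of_walkSum_ne_zero {f : ℤ × ℤ → ℤ × ℤ → ℤ} {u v : V} {p : G.Walk u v}
    (h : R.walkSum f p ≠ 0) : ∃ d ∈ p.darts, f (R.pos d.fst) (R.pos d.snd) ≠ 0 := by
  by_contra! hc
  apply h
  apply List.sum_eq_zero
  simpa using hc

theorem exists_split_of_mem_support {u v a : V} (p : G.Walk u v) (ha : a ∈ p.support) :
    ∃ (q : G.Walk u a) (r : G.Walk a v), p.length = q.length + r.length := by
  classical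
  exact ⟨p.takeUntil a ha, p.dropUntil a ha, by
    rw [← SimpleGraph.Walk.length_append, SimpleGraph.Walk.take_spec]⟩

namespace Ladder

theorem crossing_eq_zero_of_ne (K : R.Ladder) {i : ℕ} (hi : i ≤ K.len) {y : V}
    (hy : y ≠ K.vert true i) : K.crossing (R.pos (K.vert false i)) (R.pos y) = 0 := by
  by_contra h
  obtain ⟨s, j, hj, h1, h2⟩ := K.exists_rung_of_crossing_ne_zero h
  obtain ⟨rfl, rfl⟩ := K.vert_ne_of_ne _ _ hi hj h1
  exact hy h2

end Ladder

/-- A unit step that approaches a point on the axis through `p` must follow the axis, as a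
perpendicular step only adds to the distance. -/
theorem eq_add_of_l1Dist_lt {p e f : ℤ × ℤ} {k : ℤ} (he : IsUnitVec e) (hf : IsUnitVec f)
    (h : l1Dist (p + f) (linePt p e k) < k.natAbs) : (0 < k ∧ f = e) ∨ (k < 0 ∧ f = -e) := by
  rcases he.cases with rfl | rfl | rfl | rfl <;> rcases hf.cases with rfl | rfl | rfl | rfl <;>
    simp [l1Dist, linePt] at * <;> omega

/-- Two neighbours of `w` that are both closer to `x` lie on a common unit square with `w`, whose
fourth vertex is still closer to `x`. -/
theorem IsSolid.quadrangle [Finite V] (hR : R.IsSolid) {w y z x : V} (hy : G.Adj w y)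
    (hz : G.Adj w z) (hyz : y ≠ z) (hx : G.Reachable w x) (hyx : G.dist y x < G.dist w x)
    (hzx : G.dist z x < G.dist w x) :
    ∃ c e, G.Adj y c ∧ G.Adj z c ∧ G.dist c x + 2 = G.dist w x ∧ IsUnitVec e ∧
      R.IsSquare (R.pos w) e ∧ ((R.pos y = R.pos w + e ∧ R.pos z = R.pos w + rot e) ∨
        (R.pos z = R.pos w + e ∧ R.pos y = R.pos w + rot e)) := by
  obtain ⟨K, i, hi, rfl, rfl⟩ := exists_ladder R hz
  obtain ⟨q, hq⟩ := (hy.symm.reachable.trans hx).exists_walk_length_eq_dist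
  have hdy : G.dist y x + 1 = G.dist (K.vert false i) x := by
    have := R.dist_adj_cases hy hx; omega
  -- The vertex `x` lies across the ladder of the edge from `w` to `z`, but the step to `y` does not
  -- cross it. So a shortest path from `y` to `x` does, and visits the near end of some rung `j`.
  have h1 := K.walkSum_from_rung hR hi (.cons hy q)
  rw [if_pos hzx, R.walkSum_cons, K.crossing_eq_zero_of_ne hi hyz, zero_add] at h1
  obtain ⟨d, hd, hne⟩ := exists_crossing_of_walkSum_ne_zero (R := R) (f := K.crossing) (p := q)
    (by omega)
  obtain ⟨j, hj, ha⟩ : ∃ j ≤ K.len, K.vert false j ∈ q.support := by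
    obtain ⟨t, j, hj, ha, hb⟩ := K.exists_rung_of_crossing_ne_zero hne
    refine ⟨j, hj, ?_⟩
    cases t
    · rw [← ha]; exact q.dart_fst_mem_support_of_mem_darts hd
    · rw [Bool.not_true] at hb
      rw [← hb]; exact q.dart_snd_mem_support_of_mem_darts hd
  obtain ⟨q1, q2, hq12⟩ := exists_split_of_mem_support q ha
  have h2 := K.reachable_dist_le false false hi hj
  have h3 := h2.1.dist_triangle_left x
  have h4 := SimpleGraph.dist_le q2
  have h5 := R.l1Dist_le_length q1
  have hpi := K.pos_vert false i hi
  have hpj := K.pos_vert false j hj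
  simp only [Bool.false_eq_true, reduceIte, add_zero] at hpi hpj h2
  have hpy : R.pos y = R.pos (K.vert false i) + (R.pos y - R.pos (K.vert false i)) := by simp
  have hpj' : R.pos (K.vert false j) = linePt (R.pos (K.vert false i)) K.dir ((j : ℤ) - i) := by
    rw [hpj, hpi, linePt_linePt]; simp
  rw [hpy, hpj'] at h5
  -- The near end of rung `j` is reached from `w` via `y` on a shortest path, so `y` is closer to it
  -- than `w`. Hence `y` is next to `w` on the rail, and the neighbouring rung supplies the fourth
  -- vertex.
  have h6 := eq_add_of_l1Dist_lt (p := R.pos (K.vert false i)) K.unit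
    (R.isUnitVec_sub hy) (k := (j : ℤ) - i) (by omega)
  have hzp := K.pos_vert true i hi
  simp only [reduceIte] at hzp
  rw [← hpi] at hzp
  rcases h6 with ⟨hlt, hf⟩ | ⟨hlt, hf⟩
  · have hi1 : i + 1 ≤ K.len := by omega
    have hy1 : y = K.vert false (i + 1) := by
      apply R.injective
      rw [hpy, hf, hpi, K.pos_vert _ _ hi1]
      push_cast
      simp [linePt_succ]
    subst hy1
    have hs := K.isSquare (i := i) (by omega)
    rw [← hpi] at hs
    have hd1 := (K.dist_lt_iff hR hi hi1 hx).1 hzx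
    have hd2 := R.dist_adj_cases (K.rung _ hi1) (hy.symm.reachable.trans hx)
    refine ⟨K.vert true (i + 1), K.dir, K.rung _ hi1, K.rail true i (by omega), by omega, K.unit, hs,
      Or.inl ⟨?_, hzp⟩⟩
    rw [hpy, hf]
  · obtain ⟨i, rfl⟩ : ∃ k, i = k + 1 := ⟨i - 1, by omega⟩
    have hi1 : i ≤ K.len := by omega
    have hy1 : y = K.vert false i := by
      apply R.injective
      rw [hpy, hf, hpi, K.pos_vert _ _ hi1]
      push_cast
      simp [linePt_succ]
    subst hy1
    have hs := K.isSquare (i := i) (by omega)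
    have hpe : linePt K.base K.dir i = R.pos (K.vert false (i + 1)) - K.dir := by
      rw [hpi]; push_cast; simp [linePt_succ]
    rw [hpe, ← R.isSquare_rot_iff K.unit] at hs
    have hd1 := (K.dist_lt_iff hR hi hi1 hx).1 hzx
    have hd2 := R.dist_adj_cases (K.rung _ hi1) (hy.symm.reachable.trans hx)
    refine ⟨K.vert true i, rot K.dir, K.rung _ hi1, (K.rail true i (by omega)).symm, by omega,
      K.unit.turn, hs, Or.inr ⟨hzp, ?_⟩⟩
    rw [hpy, hf, rot_rot]

/-- The hypothesis says that `w` is on no shortest path between `x` and `a`. Induction on the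
distance from `w` to `x`: move `x` towards `w`, directly while the strict inequality persists, and
otherwise around a square. -/
theorem IsSolid.exists_common_closer [Finite V] (hR : R.IsSolid) {w a : V}
    (ha : G.Reachable w a) (n : ℕ) : ∀ x, G.Reachable w x → G.dist w x = n →
      G.dist x a < G.dist w a + n →
      ∃ y, G.Adj w y ∧ G.dist y x < G.dist w x ∧ G.dist y a < G.dist w a := by
  induction n using Nat.strong_induction_on with
  | _ n ih =>
    intro x hx hn hlt
    rcases Nat.eq_zero_or_pos n with h0 | hpos
    · rw [h0, hx.dist_eq_zero_iff] at hn
      subst hn; omega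
    have hstep : ∀ x, G.Reachable w x → 0 < G.dist w x → ∃ x', G.Adj x x' ∧
        G.dist w x' + 1 = G.dist w x := by
      intro x hx hpos
      obtain ⟨p, hp⟩ := hx.symm.exists_walk_length_eq_dist
      cases p with
      | nil => simp at hpos
      | cons h p =>
        have h1 := SimpleGraph.dist_le p
        have h2 := R.dist_adj_cases h hx.symm
        rw [SimpleGraph.Walk.length_cons] at hp
        refine ⟨_, h, ?_⟩
        rw [SimpleGraph.dist_comm, SimpleGraph.dist_comm (u := w)]
        omega
    obtain ⟨x', hxx', hd'⟩ := hstep x hx (by omega)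
    have hwx' := hx.trans hxx'.reachable
    -- If `x'` still satisfies the hypothesis, the neighbour found for `x'` also serves `x`.
    by_cases hc : G.dist x' a < G.dist w a + (n - 1)
    · obtain ⟨y, h1, h2, h3⟩ := ih (n - 1) (by omega) x' hwx' (by omega) hc
      have h4 := hxx'.symm.reachable.dist_triangle_right y
      rw [SimpleGraph.dist_eq_one_iff_adj.2 hxx'.symm] at h4
      have h5 := R.dist_adj_cases h1 hx
      have h6 := R.dist_adj_cases h1 hwx'
      exact ⟨y, h1, by omega, h3⟩
    have hxa := hx.symm.trans ha
    have hx'a := hwx'.symm.trans ha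
    have h7 := R.dist_adj_cases hxx'.symm hx'a
    have h8 := ha.symm.dist_triangle_right x'
    have hca : G.dist x' a ≤ G.dist w a + (n - 1) := by
      have h9 := hwx'.symm.dist_triangle_left a
      rw [SimpleGraph.dist_comm (v := w)] at h9
      omega
    rcases Nat.eq_zero_or_pos (G.dist w x') with h0 | hpos'
    · rw [hwx'.dist_eq_zero_iff] at h0
      subst h0
      refine ⟨x, hxx'.symm, ?_, by omega⟩
      rw [SimpleGraph.dist_self]; omega
    obtain ⟨x'', hxx'', hd''⟩ := hstep x' hwx' hpos'
    have hwx'' := hwx'.trans hxx''.reachable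
    have h10 : G.dist x'' a ≤ G.dist w a + (n - 2) := by
      have h9 := hwx''.symm.dist_triangle_left a
      rw [SimpleGraph.dist_comm (v := w)] at h9
      omega
    -- Now `w` is between `x'` and `a`, so both `x` and `x''` are closer to `a` than `x'`. The
    -- fourth vertex `c` of their square has distance `n - 1` from `w` and satisfies the hypothesis
    -- in place of `x'`.
    obtain ⟨c, -, hc1, hc2, hc3, -⟩ := hR.quadrangle hxx'.symm hxx'' (by rintro rfl; omega) hx'a
      (by omega) (by omega)
    have hwc := hx.trans hc1.reachable
    have h11 := R.dist_adj_cases hc1 hx.symm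
    have h12 := R.dist_adj_cases hc2 hwx''.symm
    rw [SimpleGraph.dist_comm (u := c), SimpleGraph.dist_comm (v := w)] at h11 h12
    obtain ⟨y, g1, g2, g3⟩ := ih (n - 1) (by omega) c hwc (by omega) (by omega)
    have h4 := hc1.symm.reachable.dist_triangle_right y
    rw [SimpleGraph.dist_eq_one_iff_adj.2 hc1.symm] at h4
    have h5 := R.dist_adj_cases g1 hx
    exact ⟨y, g1, by omega, g3⟩

theorem mem_geodesicInterval {a b w : V} (ha : G.Reachable a w) (hb : G.Reachable w b)
    (h : G.dist a w + G.dist w b ≤ G.dist a b) : w ∈ geodesicInterval G a b := by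
  obtain ⟨p, hp⟩ := ha.exists_walk_length_eq_dist
  obtain ⟨q, hq⟩ := hb.exists_walk_length_eq_dist
  have := SimpleGraph.dist_le (p.append q)
  rw [SimpleGraph.Walk.length_append] at this
  exact ⟨p.append q, by rw [SimpleGraph.Walk.length_append]; omega, by simp⟩

/-- A local test for intervals: by `exists_common_closer` a strict triangle inequality shows up at a
neighbour of `w`. -/
theorem IsSolid.mem_geodesicInterval_of_forall [Finite V] (hR : R.IsSolid) {a b w : V}
    (ha : G.Reachable w a) (hb : G.Reachable w b)
    (h : ∀ y, G.Adj w y → G.dist y a < G.dist w a → G.dist w b ≤ G.dist y b) :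
    w ∈ geodesicInterval G a b := by
  refine mem_geodesicInterval ha.symm hb ?_
  by_contra! hc
  obtain ⟨y, h1, h2, h3⟩ := hR.exists_common_closer ha _ b hb rfl (by
    rw [SimpleGraph.dist_comm, SimpleGraph.dist_comm (u := w) (v := a)]; omega)
  exact absurd (h y h1 h3) (by omega)

theorem exists_adj_dist_lt {w x : V} (hx : G.Reachable w x) (hne : x ≠ w) :
    ∃ y, G.Adj w y ∧ G.dist y x < G.dist w x := by
  obtain ⟨p, hp⟩ := hx.exists_walk_length_eq_dist
  cases p with
  | nil => exact absurd rfl hne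
  | cons h p => exact ⟨_, h, by
      have := SimpleGraph.dist_le p
      rw [SimpleGraph.Walk.length_cons] at hp; omega⟩

/-- At most two of the unit vectors are pairwise perpendicular. -/
theorem not_pairwise_perp {a b c : ℤ × ℤ} (ha : IsUnitVec a) (hb : IsUnitVec b) (hc : IsUnitVec c)
    (h1 : a.1 * b.1 + a.2 * b.2 = 0) (h2 : b.1 * c.1 + b.2 * c.2 = 0)
    (h3 : a.1 * c.1 + a.2 * c.2 = 0) : False := by
  rcases ha.cases with rfl | rfl | rfl | rfl <;> rcases hb.cases with rfl | rfl | rfl | rfl <;>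
    rcases hc.cases with rfl | rfl | rfl | rfl <;> simp at *

/-- A set of vertices that meets both sides of every edge is geodetic. -/
theorem IsSolid.isGeodeticSet_of_forall [Finite V] (hR : R.IsSolid) {D : Set V}
    (h0 : ∀ w, (∀ y, ¬ G.Adj w y) → w ∈ D)
    (hD : ∀ w y, G.Adj w y → ∃ x ∈ D, G.Reachable w x ∧ G.dist y x < G.dist w x) :
    IsGeodeticSet G D := by
  intro w
  by_cases hw : w ∈ D
  · exact ⟨w, hw, w, hw, .nil, by simp, by simp⟩
  by_contra! hc
  -- An uncovered `w` has a common direction towards any two members of `D` in its component.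
  have hint : ∀ a ∈ D, ∀ b ∈ D, G.Reachable w a → G.Reachable w b →
      ∃ y, G.Adj w y ∧ G.dist y a < G.dist w a ∧ G.dist y b < G.dist w b := by
    intro a ha b hb hwa hwb
    by_contra! h
    exact hc a ha b hb (hR.mem_geodesicInterval_of_forall hwa hwb h)
  have hmiss : ∀ y, G.Adj w y → ∃ x ∈ D, G.Reachable w x ∧ G.dist w x < G.dist y x := by
    intro y hy
    obtain ⟨x, hx, h1, h2⟩ := hD y w hy.symm
    exact ⟨x, hx, hy.reachable.trans h1, h2⟩
  -- Directions towards the same vertex are perpendicular by the quadrangle property, so there are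
  -- at most two of them.
  have hperp : ∀ y z x, G.Adj w y → G.Adj w z → y ≠ z → G.Reachable w x →
      G.dist y x < G.dist w x → G.dist z x < G.dist w x →
      (R.pos y - R.pos w).1 * (R.pos z - R.pos w).1 +
        (R.pos y - R.pos w).2 * (R.pos z - R.pos w).2 = 0 := by
    intro y z x hy hz hyz hx h1 h2
    obtain ⟨c, e, -, -, -, he, -, ⟨h3, h4⟩ | ⟨h3, h4⟩⟩ := hR.quadrangle hy hz hyz hx h1 h2 <;>
      rw [h3, h4] <;> simp [rot] <;> ring
  obtain ⟨y, hy⟩ : ∃ y, G.Adj w y := by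
    by_contra! h
    exact hw (h0 w h)
  -- Choose `x1` in the direction `y`, `x2` away from `y`, and `x3` away from the common direction
  -- `z` of `x1` and `x2`. The common directions `s` of `x1`, `x3` and `t` of `x2`, `x3` differ from
  -- `z`. If `s = t`, then `y`, `z`, `s` all lead to `x1`; otherwise `s`, `z`, `t` are pairwise
  -- perpendicular because of `x1`, `x2`, `x3`.
  obtain ⟨x1, hx1, hr1, hd1⟩ := hD w y hy
  obtain ⟨x2, hx2, hr2, hd2⟩ := hmiss y hy
  obtain ⟨z, hz, hz1, hz2⟩ := hint x1 hx1 x2 hx2 hr1 hr2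
  obtain ⟨x3, hx3, hr3, hd3⟩ := hmiss z hz
  obtain ⟨s, hs, hs1, hs3⟩ := hint x1 hx1 x3 hx3 hr1 hr3
  obtain ⟨t, ht, ht2, ht3⟩ := hint x2 hx2 x3 hx3 hr2 hr3
  have hyz : y ≠ z := by rintro rfl; omega
  have hsz : s ≠ z := by rintro rfl; omega
  have htz : t ≠ z := by rintro rfl; omega
  have hty : t ≠ y := by rintro rfl; omega
  by_cases hst : s = t
  · subst hst
    exact not_pairwise_perp (R.isUnitVec_sub hy) (R.isUnitVec_sub hz) (R.isUnitVec_sub hs)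
      (hperp y z x1 hy hz hyz hr1 hd1 hz1) (hperp z s x1 hz hs hsz.symm hr1 hz1 hs1)
      (hperp y s x1 hy hs hty.symm hr1 hd1 hs1)
  · exact not_pairwise_perp (R.isUnitVec_sub hs) (R.isUnitVec_sub hz) (R.isUnitVec_sub ht)
      (hperp s z x1 hs hz hsz hr1 hs1 hz1) (hperp z t x2 hz ht htz.symm hr2 hz2 ht2)
      (hperp s t x3 hs ht hst hr3 hs3 ht3)

/-- An edge that is on no square is a bridge. -/
theorem IsSolid.isCutVertex_of_not_isSquare [Finite V] (hR : R.IsSolid) {a b z : V}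
    (h : G.Adj a b) (h1 : ¬ R.IsSquare (R.pos a) (R.pos b - R.pos a))
    (h2 : ¬ R.IsSquare (R.pos b) (R.pos a - R.pos b)) (hz : G.Adj b z) (hza : z ≠ a) :
    IsCutVertex G b := by
  obtain ⟨K, i, hi, rfl, rfl⟩ := exists_ladder R h
  have hp : R.pos (K.vert true i) = R.pos (K.vert false i) + rot K.dir := by
    rw [K.pos_vert _ _ hi, K.pos_vert _ _ hi]; simp
  have hpf : R.pos (K.vert false i) = linePt K.base K.dir i := by
    rw [K.pos_vert _ _ hi]; simp
  rw [hp, add_sub_cancel_left, R.isSquare_rot_iff K.unit, hpf, ← linePt_sub_one] at h1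
  rw [hp, sub_add_cancel_left, R.isSquare_neg_rot_iff K.unit, hpf] at h2
  -- Without a square on either side the edge is the only rung of its ladder.
  have hlen : K.len = 0 := by
    by_contra hne
    by_cases hil : i < K.len
    · exact h2 (K.isSquare hil)
    · have := K.isSquare (i := i - 1) (by omega)
      rw [Nat.cast_sub (by omega)] at this
      exact h1 this
  have hi0 : i = 0 := by omega
  subst hi0
  refine ⟨_, z, h.ne, hz.ne', h.reachable.trans hz.reachable, fun p => ?_⟩
  -- Every walk from `a` to `z` has net crossing number 1, like the one through `b`; so it uses the
  -- single rung and visits `b`.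
  have hsum := K.walkSum_eq hR p (.cons h (.cons hz .nil))
  have hbz : K.crossing (R.pos (K.vert true 0)) (R.pos z) = 0 := by
    by_contra hne
    obtain ⟨s, j, hj, e1, e2⟩ := K.exists_rung_of_crossing_ne_zero hne
    obtain ⟨rfl, rfl⟩ := K.vert_ne_of_ne _ _ hi hj e1
    exact hza e2
  simp only [walkSum_cons, K.crossing_rung 0 hi, hbz, walkSum_nil] at hsum
  obtain ⟨d, hd, hne⟩ := exists_crossing_of_walkSum_ne_zero (R := R) (f := K.crossing) (p := p)
    (by omega)
  obtain ⟨s, j, hj, e1, e2⟩ := K.exists_rung_of_crossing_ne_zero hne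
  obtain rfl : j = 0 := by omega
  cases s
  · rw [Bool.not_false] at e2
    rw [← e2]; exact p.dart_snd_mem_support_of_mem_darts hd
  · rw [← e1]; exact p.dart_fst_mem_support_of_mem_darts hd

theorem isSquare_neg_iff (R : GridEmbedding G) {e : ℤ × ℤ} (he : IsUnitVec e) (p : ℤ × ℤ) :
    R.IsSquare (p + e) (-e) ↔ R.IsSquare p (-rot e) := by
  rw [← rot_neg, R.isSquare_rot_iff he.neg, sub_neg_eq_add]

theorem IsSquare.drawn {p e : ℤ × ℤ} (h : R.IsSquare p e) : R.Drawn p (p + e) := h.1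

theorem IsSquare.drawn_rot {p e : ℤ × ℤ} (h : R.IsSquare p e) : R.Drawn p (p + rot e) := h.2.1

theorem pos_cases (R : GridEmbedding G) {v a : V} (h : G.Adj v a) {e : ℤ × ℤ} (he : IsUnitVec e) :
    R.pos a = R.pos v + e ∨ R.pos a = R.pos v + rot e ∨ R.pos a = R.pos v + -e ∨
      R.pos a = R.pos v + -rot e := by
  have h1 := he.eq_or (R.isUnitVec_sub h)
  simpa only [sub_eq_iff_eq_add'] using h1

/-- Each passage of a walk through `v` is replaced by a detour between the two neighbours. In the
induction the second clause of `key` treats a remaining walk that starts at `v`. -/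
theorem not_isCutVertex_of_forall {v : V}
    (h : ∀ a b, G.Adj v a → G.Adj v b → ∃ p : G.Walk a b, v ∉ p.support) : ¬ IsCutVertex G v := by
  have key : ∀ {x w : V} (p : G.Walk x w), w ≠ v → (x ≠ v → ∃ q : G.Walk x w, v ∉ q.support) ∧
      (x = v → ∃ b, G.Adj v b ∧ ∃ q : G.Walk b w, v ∉ q.support) := by
    intro x w p hw
    induction p with
    | nil => exact ⟨fun _ => ⟨.nil, by simpa using hw.symm⟩, fun h => absurd h hw⟩
    | @cons x y w hxy p ih =>
      specialize ih hw
      by_cases hy : y = v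
      · subst hy
        obtain ⟨b, hb, q, hq⟩ := ih.2 rfl
        refine ⟨fun _ => ?_, fun h => absurd h hxy.ne⟩
        obtain ⟨r, hr⟩ := h x b hxy.symm hb
        exact ⟨r.append q, by simp [SimpleGraph.Walk.mem_support_append_iff, hr, hq]⟩
      · obtain ⟨q, hq⟩ := ih.1 hy
        refine ⟨fun hx => ⟨.cons hxy q, by simp [hq, Ne.symm hx]⟩, ?_⟩
        rintro rfl
        exact ⟨y, hxy, q, hq⟩
  rintro ⟨u, w, hu, hw, ⟨p⟩, hall⟩
  obtain ⟨q, hq⟩ := (key p hw).1 hu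
  exact hq (hall q)

theorem IsSquare.exists_walk {v a b : V} {e : ℤ × ℤ} (he : IsUnitVec e)
    (h : R.IsSquare (R.pos v) e) (ha : R.pos a = R.pos v + e) (hb : R.pos b = R.pos v + rot e) :
    ∃ p : G.Walk a b, v ∉ p.support := by
  obtain ⟨-, -, h3, h4⟩ := h
  rw [← ha] at h3
  obtain ⟨c, hac, hc⟩ := h3.exists_adj
  rw [← hb, ← ha, ← hc, R.drawn_pos_iff] at h4
  have hva : v ≠ a := by
    rintro rfl
    rcases he.cases with rfl | rfl | rfl | rfl <;> simp at ha
  have hvb : v ≠ b := by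
    rintro rfl
    rcases he.cases with rfl | rfl | rfl | rfl <;> simp [rot] at hb
  have hvc : v ≠ c := by
    rintro rfl
    rw [ha] at hc
    rcases he.cases with rfl | rfl | rfl | rfl <;> simp [rot, add_assoc] at hc
  exact ⟨.cons hac (.cons h4.symm .nil), by simp [hva, hvb, hvc]⟩

theorem IsSolid.clockwise_iff (hR : R.IsSolid) {v a : V} {e : ℤ × ℤ} (h : G.Adj v a)
    (ha : R.pos a = R.pos v + e) :
    (R.IsClockwiseBoundary v a ↔ ¬ R.IsSquare (R.pos v) e) ∧
      (R.IsClockwiseBoundary a v ↔ ¬ R.IsSquare (R.pos v) (-rot e)) := by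
  have he : IsUnitVec e := by
    have := R.isUnitVec_sub h
    rwa [ha, add_sub_cancel_left] at this
  rw [hR.isClockwiseBoundary_iff, hR.isClockwiseBoundary_iff, and_iff_right h, and_iff_right h.symm,
    ← R.isSquare_neg_iff he, ha]
  simp

end GridEmbedding

/-! ### Degrees and numbers of squares -/

section NeighborSums

variable {V : Type*} [Fintype V] (G : SimpleGraph V)

open Classical in
/-- The sum of `f` over the neighbours of `v`. -/
noncomputable def nbrSum (v : V) (f : V → ℕ) : ℕ := ∑ a, if G.Adj v a then f a else 0

open Classical in
/-- The number of 4-cycles through the edge between `v` and `a`. -/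
noncomputable def squareCount (v a : V) : ℕ :=
  nbrSum G v fun b => nbrSum G a fun c => if b ≠ a ∧ c ≠ v ∧ G.Adj b c then 1 else 0

/-- This is `2` at the ends of straight boundary pieces, `1` at their inner vertices, and `0` at
all other vertices. -/
noncomputable def boundaryType (v : V) : ℕ :=
  if vertexDegree G v = 2 ∧ nbrSum G v (squareCount G v) = 2 then 2
  else if vertexDegree G v = 3 ∧ nbrSum G v (squareCount G v) = 4 then 1 else 0

/-- The two vertices are consecutive on a piece of the boundary without cut-vertices and without
reflex corners. -/
def BoundaryAdj (v a : V) : Prop :=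
  G.Adj v a ∧ squareCount G v a = 1 ∧ 0 < boundaryType G v ∧ 0 < boundaryType G a

variable {G}

theorem nbrSum_congr {v : V} {f g : V → ℕ} (h : ∀ a, G.Adj v a → f a = g a) :
    nbrSum G v f = nbrSum G v g := by
  refine Finset.sum_congr rfl fun a _ => ?_
  split_ifs with ha
  · exact h a ha
  · rfl

theorem vertexDegree_eq_nbrSum (v : V) : vertexDegree G v = nbrSum G v fun _ => 1 := by
  classical
  rw [vertexDegree, nbrSum, Set.ncard_eq_toFinset_card', ← Finset.sum_filter, Finset.card_eq_sum_ones]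
  congr 1
  ext a; simp

theorem squareCount_comm (v a : V) : squareCount G v a = squareCount G a v := by
  classical
  simp only [squareCount, nbrSum]
  have : ∀ v a : V, (∑ b, if G.Adj v b then ∑ c, if G.Adj a c then
        if b ≠ a ∧ c ≠ v ∧ G.Adj b c then 1 else 0 else 0 else 0) =
      ∑ b, ∑ c, if G.Adj v b ∧ G.Adj a c ∧ b ≠ a ∧ c ≠ v ∧ G.Adj b c then 1 else 0 := by
    intro v a
    refine Finset.sum_congr rfl fun b _ => ?_
    split_ifs with h
    · refine Finset.sum_congr rfl fun c _ => ?_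
      split_ifs <;> simp_all
    · simp [h]
  rw [this, this, Finset.sum_comm]
  refine Finset.sum_congr rfl fun b _ => Finset.sum_congr rfl fun c _ => ?_
  rw [G.adj_comm b c]
  congr 1
  simp only [eq_iff_iff]; tauto

theorem BoundaryAdj.symm {v a : V} (h : BoundaryAdj G v a) : BoundaryAdj G a v :=
  ⟨h.1.symm, by rw [squareCount_comm]; exact h.2.1, h.2.2.2, h.2.2.1⟩

theorem BoundaryAdj.ne {v a : V} (h : BoundaryAdj G v a) : v ≠ a := h.1.ne

end NeighborSums

namespace GridEmbedding

variable {V : Type*} [Fintype V] {G : SimpleGraph V} {R : GridEmbedding G}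

-- Only four lattice points can carry neighbours. Writing the summand as a function of the position
-- reduces all local counts to case distinctions on which edges are drawn.
open Classical in
theorem nbrSum_eq (R : GridEmbedding G) (v : V) {e : ℤ × ℤ} (he : IsUnitVec e) {f : V → ℕ}
    (g : ℤ × ℤ → ℕ) (hfg : ∀ a, G.Adj v a → f a = g (R.pos a)) :
    nbrSum G v f =
      (if R.Drawn (R.pos v) (R.pos v + e) then g (R.pos v + e) else 0) +
      (if R.Drawn (R.pos v) (R.pos v + rot e) then g (R.pos v + rot e) else 0) +
      (if R.Drawn (R.pos v) (R.pos v + -e) then g (R.pos v + -e) else 0) +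
      (if R.Drawn (R.pos v) (R.pos v + -rot e) then g (R.pos v + -rot e) else 0) := by
  have hone : ∀ d : ℤ × ℤ, (if R.Drawn (R.pos v) (R.pos v + d) then g (R.pos v + d) else 0) =
      ∑ a, if G.Adj v a ∧ R.pos a = R.pos v + d then g (R.pos v + d) else 0 := by
    intro d
    split_ifs with h
    · obtain ⟨a, ha, hp⟩ := h.exists_adj
      rw [Finset.sum_eq_single a]
      · rw [if_pos ⟨ha, hp⟩]
      · intro b _ hb
        rw [if_neg]
        rintro ⟨-, h2⟩
        exact hb (R.injective (h2.trans hp.symm))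
      · simp
    · refine (Finset.sum_eq_zero fun a _ => if_neg ?_).symm
      rintro ⟨h1, h2⟩
      exact h (h2 ▸ R.drawn_pos_iff.2 h1)
  rw [hone, hone, hone, hone, ← Finset.sum_add_distrib, ← Finset.sum_add_distrib,
    ← Finset.sum_add_distrib, nbrSum]
  refine Finset.sum_congr rfl fun a _ => ?_
  by_cases ha : G.Adj v a
  · have h1 := he.eq_or (R.isUnitVec_sub ha)
    rw [if_pos ha, hfg a ha]
    have h2 : ∀ d, R.pos a = R.pos v + d ↔ R.pos a - R.pos v = d := fun d => by
      rw [sub_eq_iff_eq_add']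
    simp only [ha, true_and, h2]
    have hp : R.pos a = R.pos v + (R.pos a - R.pos v) := by simp
    generalize R.pos a - R.pos v = d at *
    rw [hp]
    rcases he.cases with rfl | rfl | rfl | rfl <;> rcases h1 with rfl | rfl | rfl | rfl <;>
      simp [rot]
  · simp [ha]

open Classical in
theorem vertexDegree_eq (R : GridEmbedding G) (v : V) {e : ℤ × ℤ} (he : IsUnitVec e) :
    vertexDegree G v =
      (if R.Drawn (R.pos v) (R.pos v + e) then 1 else 0) +
      (if R.Drawn (R.pos v) (R.pos v + rot e) then 1 else 0) +
      (if R.Drawn (R.pos v) (R.pos v + -e) then 1 else 0) +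
      (if R.Drawn (R.pos v) (R.pos v + -rot e) then 1 else 0) := by
  rw [vertexDegree_eq_nbrSum, R.nbrSum_eq v he (fun _ => 1) (fun _ _ => rfl)]

-- In a 4-cycle through the edge, the other neighbours of `v` and `a` are at distance one, which
-- forces them to lie on the same side of the edge. So abstract 4-cycles are exactly the unit
-- squares on its two sides.
open Classical in
theorem squareCount_eq (R : GridEmbedding G) {v a : V} {e : ℤ × ℤ} (h : G.Adj v a)
    (ha : R.pos a = R.pos v + e) :
    squareCount G v a = (if R.IsSquare (R.pos v) e then 1 else 0) +
      (if R.IsSquare (R.pos v) (-rot e) then 1 else 0) := by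
  have he : IsUnitVec e := by
    have := R.isUnitVec_sub h
    rwa [ha, add_sub_cancel_left] at this
  have hdr : R.Drawn (R.pos v) (R.pos v + e) := ha ▸ R.drawn_pos_iff.2 h
  have hne : ∀ p q, ¬ IsUnitVec (q - p) → ¬ R.Drawn p q := fun p q hpq hd => hpq hd.isUnitVec
  have hin := fun q => R.nbrSum_eq a he
    (f := fun c => if q ≠ R.pos a ∧ c ≠ v ∧ R.Drawn q (R.pos c) then 1 else 0)
    (fun r => if q ≠ R.pos a ∧ r ≠ R.pos v ∧ R.Drawn q r then 1 else 0) (fun c _ => by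
      simp only [R.injective.ne_iff])
  rw [squareCount, R.nbrSum_eq v he (fun q => nbrSum G a fun c =>
    if q ≠ R.pos a ∧ c ≠ v ∧ R.Drawn q (R.pos c) then 1 else 0) (fun b _ => by
      refine nbrSum_congr fun c _ => ?_
      simp only [R.injective.ne_iff, R.drawn_pos_iff])]
  simp only [hin]
  simp only [ha]
  generalize R.pos v = p at *
  -- Of the nine pairs of further positions next to `v` and `a`, these seven are not at unit
  -- distance.
  have h1 : ¬ R.Drawn (p + rot e) (p + e + e) := hne _ _ fun h => by
    simp only [IsUnitVec, rot, Prod.fst_sub, Prod.snd_sub, Prod.fst_add, Prod.snd_add] at *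
    linarith
  have h2 : ¬ R.Drawn (p + rot e) (p + e + -rot e) := hne _ _ fun h => by
    simp only [IsUnitVec, rot, Prod.fst_sub, Prod.snd_sub, Prod.fst_add, Prod.snd_add,
      Prod.fst_neg, Prod.snd_neg] at *
    linarith
  have h3 : ¬ R.Drawn (p + -rot e) (p + e + e) := hne _ _ fun h => by
    simp only [IsUnitVec, rot, Prod.fst_sub, Prod.snd_sub, Prod.fst_add, Prod.snd_add,
      Prod.fst_neg, Prod.snd_neg] at *
    linarith
  have h4 : ¬ R.Drawn (p + -rot e) (p + e + rot e) := hne _ _ fun h => by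
    simp only [IsUnitVec, rot, Prod.fst_sub, Prod.snd_sub, Prod.fst_add, Prod.snd_add,
      Prod.fst_neg, Prod.snd_neg] at *
    linarith
  have h5 : ¬ R.Drawn (p + -e) (p + e + e) := hne _ _ fun h => by
    simp only [IsUnitVec, rot, Prod.fst_sub, Prod.snd_sub, Prod.fst_add, Prod.snd_add,
      Prod.fst_neg, Prod.snd_neg] at *
    linarith
  have h6 : ¬ R.Drawn (p + -e) (p + e + rot e) := hne _ _ fun h => by
    simp only [IsUnitVec, rot, Prod.fst_sub, Prod.snd_sub, Prod.fst_add, Prod.snd_add,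
      Prod.fst_neg, Prod.snd_neg] at *
    linarith
  have h7 : ¬ R.Drawn (p + -e) (p + e + -rot e) := hne _ _ fun h => by
    simp only [IsUnitVec, rot, Prod.fst_sub, Prod.snd_sub, Prod.fst_add, Prod.snd_add,
      Prod.fst_neg, Prod.snd_neg] at *
    linarith
  have h8 : p + rot e ≠ p + e := by
    rcases he.cases with rfl | rfl | rfl | rfl <;> simp [rot]
  have h9 : p + -rot e ≠ p + e := by
    rcases he.cases with rfl | rfl | rfl | rfl <;> simp [rot]
  have h10 : p + e + rot e ≠ p := by
    rcases he.cases with rfl | rfl | rfl | rfl <;> simp [rot, add_assoc]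
  have h11 : p + e + -rot e ≠ p := by
    rcases he.cases with rfl | rfl | rfl | rfl <;> simp [rot, add_assoc]
  have h12 : p + e + -e = p := by simp
  simp only [h1, h2, h3, h4, h5, h6, h7, h8, h9, h10, h11, h12, ne_eq, not_true_eq_false,
    not_false_eq_true, and_false, false_and, true_and, if_false, ite_self, add_zero, zero_add]
  rw [← R.isSquare_neg_iff he p]
  simp only [IsSquare, rot_neg, h12, hdr, hdr.symm, true_and]
  rw [show p + e + -rot e = p + -rot e + e by abel, show p + e + rot e = p + rot e + e by abel,
    R.drawn_comm (p := p + -rot e + e) (q := p + -rot e)]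
  simp only [and_left_comm (a := R.Drawn (p + e) (p + -rot e + e)), ite_and]

/-! ### The boundary near a vertex -/

variable (R)

/-- The only edges at `p` lead to `p + e` and `p + rot e`, and they are on a square. -/
def CornerAt (p e : ℤ × ℤ) : Prop :=
  R.IsSquare p e ∧ ¬ R.Drawn p (p + -e) ∧ ¬ R.Drawn p (p + -rot e)

/-- The only edges at `p` lead to `p ± e` and `p + rot e`, and they are on two squares. -/
def RailAt (p e : ℤ × ℤ) : Prop :=
  R.IsSquare p e ∧ R.IsSquare p (rot e) ∧ ¬ R.Drawn p (p + -rot e)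

variable {R}

-- Each square at `v` is counted once for each of its two edges at `v`.
open Classical in
theorem nbrSum_squareCount_eq (R : GridEmbedding G) (v : V) {e : ℤ × ℤ} (he : IsUnitVec e) :
    nbrSum G v (squareCount G v) =
      2 * ((if R.IsSquare (R.pos v) e then 1 else 0) +
        (if R.IsSquare (R.pos v) (rot e) then 1 else 0) +
        (if R.IsSquare (R.pos v) (-e) then 1 else 0) +
        (if R.IsSquare (R.pos v) (-rot e) then 1 else 0)) := by
  rw [R.nbrSum_eq v he (fun q => (if R.IsSquare (R.pos v) (q - R.pos v) then 1 else 0) +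
      (if R.IsSquare (R.pos v) (-rot (q - R.pos v)) then 1 else 0)) fun a ha =>
    R.squareCount_eq ha (by simp)]
  generalize R.pos v = p
  have h1 := fun h : R.IsSquare p e => And.intro h.drawn h.drawn_rot
  have h2 := fun h : R.IsSquare p (rot e) => And.intro h.drawn h.drawn_rot
  have h3 := fun h : R.IsSquare p (-e) => And.intro h.drawn h.drawn_rot
  have h4 := fun h : R.IsSquare p (-rot e) => And.intro h.drawn h.drawn_rot
  simp only [rot_neg, rot_rot, neg_neg, add_sub_cancel_left] at *
  generalize R.Drawn p (p + e) = E at *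
  generalize R.Drawn p (p + rot e) = N at *
  generalize R.Drawn p (p + -e) = W at *
  generalize R.Drawn p (p + -rot e) = S at *
  generalize R.IsSquare p e = a at *
  generalize R.IsSquare p (rot e) = b at *
  generalize R.IsSquare p (-e) = c at *
  generalize R.IsSquare p (-rot e) = d at *
  by_cases a <;> by_cases b <;> by_cases c <;> by_cases d <;> simp_all

theorem CornerAt.boundaryType {v : V} {e : ℤ × ℤ} (he : IsUnitVec e)
    (h : R.CornerAt (R.pos v) e) : boundaryType G v = 2 := by
  obtain ⟨h1, h2, h3⟩ := h
  have e1 := R.vertexDegree_eq v he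
  have e2 := R.nbrSum_squareCount_eq v he
  have n1 : ¬ R.IsSquare (R.pos v) (rot e) := fun h => h2 (by simpa [rot_rot] using h.drawn_rot)
  have n2 : ¬ R.IsSquare (R.pos v) (-e) := fun h => h2 h.drawn
  have n3 : ¬ R.IsSquare (R.pos v) (-rot e) := fun h => h3 h.drawn
  simp only [h1.drawn, h1.drawn_rot, h1, h2, h3, n1, n2, n3, if_true, if_false] at e1 e2
  rw [_root_.boundaryType, if_pos ⟨by omega, by omega⟩]

theorem RailAt.boundaryType {v : V} {e : ℤ × ℤ} (he : IsUnitVec e)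
    (h : R.RailAt (R.pos v) e) : boundaryType G v = 1 := by
  obtain ⟨h1, h2, h3⟩ := h
  have e1 := R.vertexDegree_eq v he
  have e2 := R.nbrSum_squareCount_eq v he
  have n2 : ¬ R.IsSquare (R.pos v) (-e) := fun h => h3 (by simpa [rot_neg] using h.drawn_rot)
  have n3 : ¬ R.IsSquare (R.pos v) (-rot e) := fun h => h3 h.drawn
  have h4 := h2.drawn_rot
  rw [rot_rot] at h4
  simp only [h1.drawn, h1.drawn_rot, h1, h2, h3, h4, n2, n3, if_true, if_false] at e1 e2
  rw [_root_.boundaryType, if_neg (by omega), if_pos ⟨by omega, by omega⟩]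

/-- Degree 2 with one square and degree 3 with two squares leave a single local picture each, up to
rotation. This is why the type, which does not mention the embedding, recognises corners and
straight boundary vertices in every embedding. -/
theorem exists_of_boundaryType (R : GridEmbedding G) {v : V} (h : 0 < boundaryType G v) :
    ∃ e, IsUnitVec e ∧ ((R.CornerAt (R.pos v) e ∧ boundaryType G v = 2) ∨
      (R.RailAt (R.pos v) e ∧ boundaryType G v = 1)) := by
  classical
  suffices hs : ∃ e, IsUnitVec e ∧ (R.CornerAt (R.pos v) e ∨ R.RailAt (R.pos v) e) by
    obtain ⟨e, he, h | h⟩ := hs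
    · exact ⟨e, he, Or.inl ⟨h, h.boundaryType he⟩⟩
    · exact ⟨e, he, Or.inr ⟨h, h.boundaryType he⟩⟩
  obtain ⟨e, he⟩ : ∃ e, IsUnitVec e := ⟨(1, 0), by simp [IsUnitVec]⟩
  have e1 := R.vertexDegree_eq v he
  have e2 := R.nbrSum_squareCount_eq v he
  suffices hs : (R.CornerAt (R.pos v) e ∨ R.RailAt (R.pos v) e) ∨
      (R.CornerAt (R.pos v) (rot e) ∨ R.RailAt (R.pos v) (rot e)) ∨
      (R.CornerAt (R.pos v) (-e) ∨ R.RailAt (R.pos v) (-e)) ∨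
      (R.CornerAt (R.pos v) (-rot e) ∨ R.RailAt (R.pos v) (-rot e)) by
    rcases hs with h | h | h | h
    · exact ⟨_, he, h⟩
    · exact ⟨_, he.turn, h⟩
    · exact ⟨_, he.neg, h⟩
    · exact ⟨_, he.turn.neg, h⟩
  have hd : (vertexDegree G v = 2 ∧ nbrSum G v (squareCount G v) = 2) ∨
      (vertexDegree G v = 3 ∧ nbrSum G v (squareCount G v) = 4) := by
    rw [_root_.boundaryType] at h
    split_ifs at h with h1 h2
    · exact Or.inl h1
    · exact Or.inr h2
    · omega
  rw [e1, e2] at hd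
  clear e1 e2 h
  have h1 := fun h : R.IsSquare (R.pos v) e => And.intro h.drawn h.drawn_rot
  have h2 := fun h : R.IsSquare (R.pos v) (rot e) => And.intro h.drawn h.drawn_rot
  have h3 := fun h : R.IsSquare (R.pos v) (-e) => And.intro h.drawn h.drawn_rot
  have h4 := fun h : R.IsSquare (R.pos v) (-rot e) => And.intro h.drawn h.drawn_rot
  simp only [CornerAt, RailAt, rot_neg, rot_rot, neg_neg] at *
  generalize R.pos v = p at *
  generalize R.Drawn p (p + e) = E at *
  generalize R.Drawn p (p + rot e) = N at *
  generalize R.Drawn p (p + -e) = W at *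
  generalize R.Drawn p (p + -rot e) = S at *
  generalize R.IsSquare p e = a at *
  generalize R.IsSquare p (rot e) = b at *
  generalize R.IsSquare p (-e) = c at *
  generalize R.IsSquare p (-rot e) = d at *
  by_cases a <;> by_cases b <;> by_cases c <;> by_cases d <;> simp_all <;>
    by_cases E <;> by_cases N <;> by_cases W <;> by_cases S <;> simp_all

theorem IsSolid.cornerAt_adj (hR : R.IsSolid) {v a : V} {e : ℤ × ℤ} (he : IsUnitVec e)
    (hv : R.CornerAt (R.pos v) e) (h : G.Adj v a) :
    squareCount G v a = 1 ∧
    ((R.pos a = R.pos v + e ∧ R.IsClockwiseBoundary a v ∧ ¬ R.IsClockwiseBoundary v a) ∨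
      (R.pos a = R.pos v + rot e ∧ R.IsClockwiseBoundary v a ∧ ¬ R.IsClockwiseBoundary a v)) := by
  classical
  obtain ⟨h1, h2, h3⟩ := hv
  have n1 : ¬ R.IsSquare (R.pos v) (rot e) := fun h => h2 (by simpa [rot_rot] using h.drawn_rot)
  have n3 : ¬ R.IsSquare (R.pos v) (-rot e) := fun h => h3 h.drawn
  have hd := R.drawn_pos_iff.2 h
  rcases R.pos_cases h he with ha | ha | ha | ha
  · have := hR.clockwise_iff h ha
    rw [R.squareCount_eq h ha, if_pos h1, if_neg n3, this.1, this.2]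
    simp [h1, n3, ha]
  · have := hR.clockwise_iff h ha
    rw [R.squareCount_eq h ha, this.1, this.2]
    simp [h1, n1, ha, rot_rot]
  · exact absurd (ha ▸ hd) h2
  · exact absurd (ha ▸ hd) h3

/-- The clockwise boundary comes from `v + e` and goes on to `v - e`. The third edge has squares on
both sides, so that the square count tells it apart. -/
theorem IsSolid.railAt_adj (hR : R.IsSolid) {v a : V} {e : ℤ × ℤ} (he : IsUnitVec e)
    (hv : R.RailAt (R.pos v) e) (h : G.Adj v a) :
    (squareCount G v a = 1 ∧
      ((R.pos a = R.pos v + e ∧ R.IsClockwiseBoundary a v ∧ ¬ R.IsClockwiseBoundary v a) ∨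
      (R.pos a = R.pos v + -e ∧ R.IsClockwiseBoundary v a ∧ ¬ R.IsClockwiseBoundary a v))) ∨
    (squareCount G v a ≠ 1 ∧ R.pos a = R.pos v + rot e) := by
  classical
  obtain ⟨h1, h2, h3⟩ := hv
  have n2 : ¬ R.IsSquare (R.pos v) (-e) := fun h => h3 (by simpa [rot_neg] using h.drawn_rot)
  have n3 : ¬ R.IsSquare (R.pos v) (-rot e) := fun h => h3 h.drawn
  have hd := R.drawn_pos_iff.2 h
  rcases R.pos_cases h he with ha | ha | ha | ha
  · have := hR.clockwise_iff h ha
    rw [R.squareCount_eq h ha, this.1, this.2]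
    simp [h1, n3, ha]
  · rw [R.squareCount_eq h ha]
    simp [h1, h2, ha, rot_rot]
  · have := hR.clockwise_iff h ha
    rw [R.squareCount_eq h ha, this.1, this.2]
    simp [h2, n2, ha, rot_neg]
  · exact absurd (ha ▸ hd) h3

/-! ### Vertices that are not cut-vertices -/

/-- The one or two squares at `v` join all its neighbours by paths that avoid `v`. -/
theorem not_isCutVertex_of_boundaryType (R : GridEmbedding G) {v : V}
    (h : 0 < boundaryType G v) : ¬ IsCutVertex G v := by
  have hsymm : ∀ {a b : V}, (∃ p : G.Walk a b, v ∉ p.support) → ∃ p : G.Walk b a, v ∉ p.support := by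
    rintro a b ⟨p, hp⟩; exact ⟨p.reverse, by simpa using hp⟩
  have htrans : ∀ {a b c : V}, (∃ p : G.Walk a b, v ∉ p.support) →
      (∃ p : G.Walk b c, v ∉ p.support) → ∃ p : G.Walk a c, v ∉ p.support := by
    rintro a b c ⟨p, hp⟩ ⟨q, hq⟩
    exact ⟨p.append q, by simp [SimpleGraph.Walk.mem_support_append_iff, hp, hq]⟩
  have hrefl : ∀ {a b : V}, G.Adj v a → R.pos a = R.pos b →
      ∃ p : G.Walk a b, v ∉ p.support := by
    intro a b ha hab
    obtain rfl := R.injective hab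
    exact ⟨.nil, by simpa using ha.ne⟩
  apply not_isCutVertex_of_forall
  intro a b ha hb
  obtain ⟨e, he, ⟨⟨h1, h2, h3⟩, -⟩ | ⟨⟨h1, h2, h3⟩, -⟩⟩ := R.exists_of_boundaryType h
  · have hc : ∀ {a}, G.Adj v a → R.pos a = R.pos v + e ∨ R.pos a = R.pos v + rot e := by
      intro a ha
      have hda := R.drawn_pos_iff.2 ha
      rcases R.pos_cases ha he with pa | pa | pa | pa
      · exact Or.inl pa
      · exact Or.inr pa
      · exact absurd (pa ▸ hda) h2
      · exact absurd (pa ▸ hda) h3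
    rcases hc ha with pa | pa <;> rcases hc hb with pb | pb <;>
      first
      | exact hrefl ha (pa.trans pb.symm)
      | exact h1.exists_walk he pa pb
      | exact hsymm (h1.exists_walk he pb pa)
  · have hda := R.drawn_pos_iff.2 ha
    have hdb := R.drawn_pos_iff.2 hb
    obtain ⟨r, hr, pr⟩ := h2.drawn.exists_adj
    have hw : ∀ {a}, R.pos a = R.pos v + -e → ∃ p : G.Walk r a, v ∉ p.support :=
      fun pa => h2.exists_walk he.turn pr (by rw [rot_rot]; exact pa)
    have he' : ∀ {a}, R.pos a = R.pos v + e → ∃ p : G.Walk a r, v ∉ p.support :=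
      fun pa => h1.exists_walk he pa pr
    have hc : ∀ {a}, G.Adj v a → R.Drawn (R.pos v) (R.pos a) →
        ∃ p : G.Walk a r, v ∉ p.support := by
      intro a ha hda
      rcases R.pos_cases ha he with pa | pa | pa | pa
      · exact he' pa
      · exact hrefl ha (pa.trans pr.symm)
      · exact hsymm (hw pa)
      · exact absurd (pa ▸ hda) h3
    exact htrans (hc ha hda) (hsymm (hc hb hdb))

end GridEmbedding

namespace GridEmbedding

variable {V : Type*} [Fintype V] {G : SimpleGraph V} {R : GridEmbedding G}

theorem boundaryType_eq_two {v : V} (h : boundaryType G v = 2) : vertexDegree G v = 2 := by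
  rw [boundaryType] at h
  split_ifs at h with h1
  · exact h1.1
  · omega

theorem boundaryType_eq_one {v : V} (h : boundaryType G v = 1) : vertexDegree G v = 3 := by
  rw [boundaryType] at h
  split_ifs at h with h1 h2
  · omega
  · exact h2.1

/-! ### Corner paths are straight -/

/-- A corner path in coordinates: it leads from `u` to `v` in direction `-e`, with unit squares on
its right. -/
structure IsCornerRail (R : GridEmbedding G) (u v : V) (e : ℤ × ℤ) (m : ℕ) : Prop where
  unit : IsUnitVec e
  one_le : 1 ≤ m
  pos_eq : R.pos u = linePt (R.pos v) e m
  corner_left : R.CornerAt (R.pos v) e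
  corner_right : R.CornerAt (R.pos u) (rot e)
  inner : ∀ i : ℕ, 0 < i → i < m → R.RailAt (linePt (R.pos v) e i) e

namespace IsCornerRail

variable {u v : V} {e : ℤ × ℤ} {m : ℕ}

theorem isSquare (h : R.IsCornerRail u v e m) {i : ℕ} (hi : i < m) :
    R.IsSquare (linePt (R.pos v) e i) e := by
  rcases Nat.eq_zero_or_pos i with rfl | h0
  · simpa [linePt_zero] using h.corner_left.1
  · exact (h.inner i h0 hi).1

theorem drawn_succ (h : R.IsCornerRail u v e m) {i : ℕ} (hi : i < m) :
    R.Drawn (linePt (R.pos v) e i) (linePt (R.pos v) e (i + 1)) := by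
  rw [linePt_succ]; exact (h.isSquare hi).drawn

theorem exists_vertices (h : R.IsCornerRail u v e m) :
    ∃ x : ℕ → V, (∀ i ≤ m, R.pos (x i) = linePt (R.pos v) e i) ∧ x 0 = v ∧ x m = u := by
  have hex : ∀ i : ℕ, ∃ x, i ≤ m → R.pos x = linePt (R.pos v) e i := by
    intro i
    by_cases hi : i < m
    · obtain ⟨x, hx⟩ := (h.drawn_succ hi).exists_left
      exact ⟨x, fun _ => hx⟩
    · refine ⟨u, fun hi' => ?_⟩
      rw [h.pos_eq, show i = m by omega]
  choose x hx using hex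
  refine ⟨x, hx, R.injective ?_, R.injective ?_⟩
  · rw [hx 0 (by omega)]; simp [linePt_zero]
  · rw [hx m le_rfl, h.pos_eq]

theorem boundaryType_left (h : R.IsCornerRail u v e m) : boundaryType G v = 2 :=
  h.corner_left.boundaryType h.unit

theorem boundaryType_right (h : R.IsCornerRail u v e m) : boundaryType G u = 2 :=
  h.corner_right.boundaryType h.unit.turn

theorem boundaryType_inner (h : R.IsCornerRail u v e m) {x : V} {i : ℕ} (h0 : 0 < i) (hi : i < m)
    (hx : R.pos x = linePt (R.pos v) e i) : boundaryType G x = 1 :=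
  (hx ▸ h.inner i h0 hi : R.RailAt (R.pos x) e).boundaryType h.unit

/-- Consecutive vertices of the path. -/
theorem boundaryAdj (hR : R.IsSolid) (h : R.IsCornerRail u v e m) {x y : V} {i : ℕ} (hi : i < m)
    (hx : R.pos x = linePt (R.pos v) e i) (hy : R.pos y = linePt (R.pos v) e (i + 1)) :
    BoundaryAdj G y x ∧ R.IsClockwiseBoundary y x := by
  have hadj : G.Adj x y := by
    rw [← R.drawn_pos_iff, hx, hy]
    exact h.drawn_succ hi
  have hpe : R.pos y = R.pos x + e := by rw [hy, linePt_succ, hx]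
  have hxt : 0 < boundaryType G x := by
    rcases Nat.eq_zero_or_pos i with rfl | h0
    · obtain rfl := R.injective (a₁ := x) (a₂ := v) (by rw [hx]; simp [linePt_zero])
      rw [h.boundaryType_left]; omega
    · rw [h.boundaryType_inner h0 hi hx]; omega
  have hyt : 0 < boundaryType G y := by
    by_cases h1 : i + 1 < m
    · rw [h.boundaryType_inner (i := i + 1) (by omega) h1 (by rw [hy]; push_cast; rfl)]; omega
    · obtain rfl := R.injective (a₁ := y) (a₂ := u) (by
        rw [hy, h.pos_eq, show m = i + 1 by omega]; push_cast; rfl)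
      rw [h.boundaryType_right]; omega
  have key : squareCount G x y = 1 ∧ R.IsClockwiseBoundary y x := by
    rcases Nat.eq_zero_or_pos i with rfl | h0
    · obtain rfl := R.injective (a₁ := x) (a₂ := v) (by rw [hx]; simp [linePt_zero])
      obtain ⟨h1, ⟨-, h2, -⟩ | ⟨h2, -⟩⟩ := hR.cornerAt_adj h.unit h.corner_left hadj
      · exact ⟨h1, h2⟩
      · rw [hpe, add_right_inj] at h2
        exfalso
        rcases h.unit.cases with rfl | rfl | rfl | rfl <;> simp [rot] at h2
    · rcases hR.railAt_adj h.unit (hx ▸ h.inner i h0 hi) hadj with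
        ⟨h1, ⟨-, h2, -⟩ | ⟨h2, -⟩⟩ | ⟨-, h2⟩
      · exact ⟨h1, h2⟩
      · rw [hpe, add_right_inj] at h2
        exact absurd h2 h.unit.ne_neg
      · rw [hpe, add_right_inj] at h2
        exfalso
        rcases h.unit.cases with rfl | rfl | rfl | rfl <;> simp [rot] at h2
  exact ⟨⟨hadj.symm, by rw [squareCount_comm]; exact key.1, hyt, hxt⟩, key.2⟩

end IsCornerRail

/-- A clockwise stretch of the boundary between two convex corners is a corner path. -/
theorem cornerStep_of_seq (R : GridEmbedding G) {x : ℕ → V} {m : ℕ} (hm : 1 ≤ m)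
    (hinj : ∀ i ≤ m, ∀ j ≤ m, x i = x j → i = j)
    (hcw : ∀ i < m, R.IsClockwiseBoundary (x i) (x (i + 1)))
    (h0 : boundaryType G (x 0) = 2) (hm2 : boundaryType G (x m) = 2)
    (hin : ∀ i, 0 < i → i < m → boundaryType G (x i) = 1) : R.CornerStep (x 0) (x m) := by
  obtain ⟨p, -, hs, hd⟩ := exists_walk_of_adj_succ fun i hi => (hcw i hi).1
  have hmem : ∀ w ∈ p.support, ∃ i ≤ m, w = x i := by
    intro w hw
    rw [hs, List.mem_map] at hw
    obtain ⟨i, hi, rfl⟩ := hw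
    exact ⟨i, by simpa [Nat.lt_succ_iff] using hi, rfl⟩
  refine ⟨p, ⟨?_, ?_, ?_, ?_, boundaryType_eq_two h0, boundaryType_eq_two hm2, ?_⟩⟩
  · rw [SimpleGraph.Walk.isPath_def, hs]
    refine List.Nodup.map_on ?_ List.nodup_range
    intro i hi j hj hij
    simp only [List.mem_range, Nat.lt_succ_iff] at hi hj
    exact hinj i hi j hj hij
  · intro h
    have := hinj 0 (by omega) m le_rfl h
    omega
  · intro d hdd
    obtain ⟨i, hi, h1, h2⟩ := hd d hdd
    rw [h1, h2]
    exact hcw i hi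
  · intro w hw
    obtain ⟨i, hi, rfl⟩ := hmem w hw
    apply R.not_isCutVertex_of_boundaryType
    by_cases h1 : i = 0
    · rw [h1, h0]; omega
    by_cases h2 : i = m
    · rw [h2, hm2]; omega
    rw [hin i (by omega) (by omega)]; omega
  · intro w hw hw0 hwm
    obtain ⟨i, hi, rfl⟩ := hmem w hw
    apply boundaryType_eq_one
    apply hin
    · rcases Nat.eq_zero_or_pos i with rfl | h
      · exact absurd rfl hw0
      · exact h
    · rcases lt_or_eq_of_le hi with h | rfl
      · exact h
      · exact absurd rfl hwm

theorem IsCornerRail.cornerStep (hR : R.IsSolid) {u v : V} {e : ℤ × ℤ} {m : ℕ}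
    (h : R.IsCornerRail u v e m) : R.CornerStep u v := by
  obtain ⟨x, hx, hx0, hxm⟩ := h.exists_vertices
  have := R.cornerStep_of_seq (x := fun i => x (m - i)) h.one_le ?_ ?_ ?_ ?_ ?_
  · simpa [hx0, hxm] using this
  · intro i hi j hj hij
    have := linePt_injective (R.pos v) h.unit
      ((hx _ (by omega)).symm.trans ((congrArg R.pos hij).trans (hx _ (by omega))))
    omega
  · intro i hi
    refine (h.boundaryAdj hR (i := m - (i + 1)) (by omega) (hx _ (by omega)) ?_).2
    rw [hx _ (by omega)]
    congr 1; omega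
  · simpa [hxm] using h.boundaryType_right
  · simpa [hx0] using h.boundaryType_left
  · intro i h0 hi
    exact h.boundaryType_inner (i := m - i) (by omega) (by omega) (hx _ (by omega))

/-- The left side of the edge is exterior. Without a square on its right the edge would be a bridge,
and its end `b` of degree at least 2 a cut-vertex. -/
theorem IsSolid.isSquare_of_corner_path (hR : R.IsSolid) {a b : V} (h : G.Adj a b)
    (hcw : R.IsClockwiseBoundary a b) (hcut : ¬ IsCutVertex G b) (hdeg : 2 ≤ vertexDegree G b) :
    R.IsSquare (R.pos b) (R.pos a - R.pos b) := by
  by_contra hn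
  obtain ⟨z, hz, hza⟩ := Set.exists_ne_of_one_lt_ncard (s := G.neighborSet b) hdeg a
  exact hcut (hR.isCutVertex_of_not_isSquare h (hR.isClockwiseBoundary_iff.1 hcw).2 hn hz hza)

/-- A corner path goes straight on at its inner vertices. -/
theorem IsSolid.railAt_of_path (hR : R.IsSolid) {a b c : V} (hab : G.Adj a b) (hbc : G.Adj b c)
    (hac : a ≠ c) (h1 : R.IsClockwiseBoundary a b) (h2 : R.IsClockwiseBoundary b c)
    (hs1 : R.IsSquare (R.pos b) (R.pos a - R.pos b))
    (hs2 : R.IsSquare (R.pos c) (R.pos b - R.pos c))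
    (hcut : ¬ IsCutVertex G b) (hdeg : vertexDegree G b = 3) :
    R.RailAt (R.pos b) (R.pos a - R.pos b) ∧ R.pos b - R.pos c = R.pos a - R.pos b := by
  classical
  set e := R.pos a - R.pos b with he
  have hu : IsUnitVec e := R.isUnitVec_sub hab.symm
  have ha : R.pos a = R.pos b + e := by simp [e]
  have hq1 := (hR.clockwise_iff hab.symm ha).2.1 h1
  have hdg := R.vertexDegree_eq b hu
  rw [hdeg, if_pos hs1.drawn, if_pos hs1.drawn_rot] at hdg
  -- An edge at `b` other than that to `a` has to lie on a square, as `b` is no cut-vertex.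
  have hbridge : ∀ z, G.Adj b z → ∀ f, R.pos z = R.pos b + f → ¬ R.IsSquare (R.pos b) f →
      ¬ R.IsSquare (R.pos b) (-rot f) → z ≠ a → False := by
    intro z hz f hf n1 n2 hza
    have huf : IsUnitVec f := by
      have := R.isUnitVec_sub hz
      rwa [hf, add_sub_cancel_left] at this
    refine hcut (hR.isCutVertex_of_not_isSquare hz.symm ?_ ?_ hab.symm hza.symm)
    · rw [← R.isSquare_neg_iff huf, ← hf] at n2
      rwa [show R.pos b - R.pos z = -f by rw [hf]; abel]
    · rwa [hf, add_sub_cancel_left]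
  have hs2' : ∀ g, R.pos c = R.pos b + g → R.IsSquare (R.pos b) (-rot g) := by
    intro g hg
    have hug : IsUnitVec g := by
      have := R.isUnitVec_sub hbc
      rwa [hg, add_sub_cancel_left] at this
    rw [← R.isSquare_neg_iff hug, ← hg]
    rwa [show -g = R.pos b - R.pos c by rw [hg]; abel]
  have hdc := R.drawn_pos_iff.2 hbc
  have hne : ∀ f, f ≠ e → ∀ z, R.pos z = R.pos b + f → z ≠ a := by
    rintro f hf z hz rfl
    exact hf (by rw [ha] at hz; exact (add_left_cancel hz).symm)
  have hene := hu.ne_neg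
  have hre : rot e ≠ e := by rcases hu.cases with h | h | h | h <;> rw [h] <;> simp [rot]
  rcases R.pos_cases hbc hu with hc | hc | hc | hc
  · exact absurd (R.injective (ha.trans hc.symm)) hac
  -- The path turns around the square at `b`: the third edge at `b`, in either of its possible
  -- positions, is then on no square.
  · exfalso
    have n1 := (hR.clockwise_iff hbc hc).1.1 h2
    by_cases hW : R.Drawn (R.pos b) (R.pos b + -e)
    · rw [if_pos hW] at hdg
      have hS : ¬ R.Drawn (R.pos b) (R.pos b + -rot e) := by
        intro h; rw [if_pos h] at hdg; omega
      obtain ⟨z, hz, hpz⟩ := hW.exists_adj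
      refine hbridge z hz _ hpz (fun h => hS (by simpa [rot_neg] using h.drawn_rot)) ?_
        (hne _ hene.symm z hpz)
      rwa [rot_neg, neg_neg]
    · rw [if_neg hW] at hdg
      have hS : R.Drawn (R.pos b) (R.pos b + -rot e) := by
        by_contra h; rw [if_neg h] at hdg; omega
      obtain ⟨z, hz, hpz⟩ := hS.exists_adj
      refine hbridge z hz _ hpz hq1 (fun h => hW ?_) (hne _ ?_ z hpz)
      · simpa [rot_neg, rot_rot] using h.drawn
      · rcases hu.cases with h | h | h | h <;> rw [h] <;> simp [rot]
  · have hW : R.Drawn (R.pos b) (R.pos b + -e) := hc ▸ hdc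
    refine ⟨⟨hs1, by simpa [rot_neg] using hs2' _ hc, ?_⟩, by rw [hc]; abel⟩
    intro h
    rw [if_pos hW, if_pos h] at hdg
    omega
  -- The path turns away from that square: the square along its next edge adds a fourth edge at `b`.
  · exfalso
    have hS : R.Drawn (R.pos b) (R.pos b + -rot e) := hc ▸ hdc
    have hW : R.Drawn (R.pos b) (R.pos b + -e) := by
      have := (hs2' _ hc).drawn
      rwa [rot_neg, rot_rot, neg_neg] at this
    rw [if_pos hW, if_pos hS] at hdg
    omega

/-- Induction along the rest of the path, with the edge from `a` to `b` just traversed as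
accumulator; `railAt_of_path` shows that the next edge keeps its direction. -/
theorem IsSolid.exists_rail_of_path (hR : R.IsSolid) {v : V} {b : V} (q : G.Walk b v) :
    ∀ a, G.Adj a b → R.IsClockwiseBoundary a b → R.IsSquare (R.pos b) (R.pos a - R.pos b) →
      a ∉ q.support → q.IsPath →
      (∀ d ∈ q.darts, R.IsClockwiseBoundary d.fst d.snd) → (∀ w ∈ q.support, ¬ IsCutVertex G w) →
      vertexDegree G v = 2 → (∀ w ∈ q.support, w ≠ v → vertexDegree G w = 3) →
      ∃ m : ℕ, R.pos a = linePt (R.pos v) (R.pos a - R.pos b) (m + 1) ∧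
        R.CornerAt (R.pos v) (R.pos a - R.pos b) ∧
        ∀ i : ℕ, 0 < i → i < m + 1 →
          R.RailAt (linePt (R.pos v) (R.pos a - R.pos b) i) (R.pos a - R.pos b) := by
  classical
  induction q with
  | nil =>
    intro a hab hcw hs _ _ _ _ hdeg _
    refine ⟨0, by simp [linePt_one], ⟨hs, ?_, ?_⟩, by omega⟩
    all_goals
      intro hd
      rw [R.vertexDegree_eq _ (R.isUnitVec_sub hab.symm), if_pos hs.drawn, if_pos hs.drawn_rot,
        if_pos hd] at hdeg
      split_ifs at hdeg
      all_goals omega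
  | @cons b c v hbc q ih =>
    intro a hab hcw hs hna hpath hdarts hcut hdv hdeg
    rw [SimpleGraph.Walk.cons_isPath_iff] at hpath
    simp only [SimpleGraph.Walk.darts_cons, SimpleGraph.Walk.support_cons, List.mem_cons,
      forall_eq_or_imp, not_or] at hdarts hcut hdeg hna
    have hbv : b ≠ v := fun h => hpath.2 (h ▸ q.end_mem_support)
    have hac : a ≠ c := fun h => hna.2 (h ▸ q.start_mem_support)
    have hdc : 2 ≤ vertexDegree G c := by
      by_cases hcv : c = v
      · rw [hcv, hdv]
      · rw [hdeg.2 c q.start_mem_support hcv]; omega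
    have hs2 := hR.isSquare_of_corner_path hbc hdarts.1 (hcut.2 c q.start_mem_support) hdc
    obtain ⟨hrail, hstr⟩ := hR.railAt_of_path hab hbc hac hcw hdarts.1 hs hs2 hcut.1 (hdeg.1 hbv)
    obtain ⟨m, h1, h2, h3⟩ := ih b hbc hdarts.1 hs2 hpath.2 hpath.1 hdarts.2 hcut.2 hdv hdeg.2
    rw [hstr] at h1 h2 h3
    refine ⟨m + 1, ?_, h2, ?_⟩
    · push_cast
      rw [linePt_succ, ← h1]; simp
    · intro i h0 hi
      by_cases him : i < m + 1
      · exact h3 i h0 him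
      · have : i = m + 1 := by omega
        subst this
        push_cast
        rwa [← h1]

/-- The converse of `IsCornerRail.cornerStep`. Together they replace the walks of the definition by
straight segments in coordinates. -/
theorem IsSolid.exists_cornerRail (hR : R.IsSolid) {u v : V} (h : R.CornerStep u v) :
    ∃ e m, R.IsCornerRail u v e m := by
  classical
  obtain ⟨p, hp⟩ := h
  obtain ⟨hpath, hne, hdarts, hcut, hdu, hdv, hdeg⟩ := hp
  cases p with
  | nil => exact absurd rfl hne
  | @cons _ b _ hub q =>
    rw [SimpleGraph.Walk.cons_isPath_iff] at hpath
    simp only [SimpleGraph.Walk.darts_cons, SimpleGraph.Walk.support_cons, List.mem_cons,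
      forall_eq_or_imp] at hdarts hcut hdeg
    have hdeg' : ∀ w ∈ q.support, w ≠ v → vertexDegree G w = 3 := fun w hw hwv =>
      hdeg.2 w hw (fun h => hpath.2 (h ▸ hw)) hwv
    have hdb : 2 ≤ vertexDegree G b := by
      by_cases hcv : b = v
      · rw [hcv, hdv]
      · rw [hdeg' b q.start_mem_support hcv]; omega
    have hs := hR.isSquare_of_corner_path hub hdarts.1 (hcut.2 b q.start_mem_support) hdb
    obtain ⟨m, h1, h2, h3⟩ := hR.exists_rail_of_path q u hub hdarts.1 hs hpath.2 hpath.1 hdarts.2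
      hcut.2 hdv hdeg'
    have hu := R.isUnitVec_sub hub.symm
    have hs' : R.IsSquare (R.pos u) (rot (R.pos u - R.pos b)) := by
      rw [R.isSquare_rot_iff hu, sub_sub_cancel]; exact hs
    refine ⟨_, m + 1, hu, by omega, by push_cast; exact h1, h2, ⟨hs', ?_, ?_⟩, fun i h0 hi => h3 i h0 hi⟩
    all_goals
      intro hd
      rw [R.vertexDegree_eq _ hu.turn, if_pos hs'.drawn, if_pos hs'.drawn_rot,
        if_pos hd] at hdu
      split_ifs at hdu
      all_goals omega

/-! ### Uniqueness and disjointness of corner paths -/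

theorem CornerAt.dir_unique {p e f : ℤ × ℤ} (he : IsUnitVec e) (hf : IsUnitVec f)
    (h : R.CornerAt p e) (h' : R.CornerAt p f) : f = e := by
  obtain ⟨-, h2, h3⟩ := h
  rcases he.eq_or hf with rfl | rfl | rfl | rfl
  · rfl
  · exact absurd (by simpa [rot_rot] using h'.1.drawn_rot) h2
  · exact absurd h'.1.drawn h2
  · exact absurd h'.1.drawn h3

theorem RailAt.dir_unique {p e f : ℤ × ℤ} (he : IsUnitVec e) (hf : IsUnitVec f)
    (h : R.RailAt p e) (h' : R.RailAt p f) : f = e := by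
  obtain ⟨h1, -, h3⟩ := h
  rcases he.eq_or hf with rfl | rfl | rfl | rfl
  · rfl
  · have := h'.2.2
    rw [rot_rot, neg_neg] at this
    exact absurd h1.drawn this
  · exact absurd (by simpa [rot_neg] using h'.1.drawn_rot) h3
  · exact absurd h'.1.drawn h3

theorem rot_injective {e f : ℤ × ℤ} (h : rot e = rot f) : e = f := by
  simp only [rot, Prod.ext_iff] at *; constructor <;> linarith [h.1, h.2]

namespace IsCornerRail

variable {u v u' v' : V} {e e' : ℤ × ℤ} {m m' : ℕ}

theorem not_drawn_beyond (h : R.IsCornerRail u v e m) :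
    ¬ R.Drawn (linePt (R.pos v) e m) (linePt (R.pos v) e (m + 1)) := by
  have := h.corner_right.2.2
  rwa [rot_rot, neg_neg, h.pos_eq, ← linePt_succ] at this

/-- The local picture at `v` determines the direction, and the path ends at the first missing edge
in this direction. -/
theorem eq_of_left (h : R.IsCornerRail u v e m) (h' : R.IsCornerRail u' v e' m') : u = u' := by
  obtain rfl := h.corner_left.dir_unique h.unit h'.unit h'.corner_left
  have hm : m = m' := by
    rcases lt_trichotomy m m' with hlt | heq | hlt
    · exact absurd (h'.drawn_succ hlt) h.not_drawn_beyond
    · exact heq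
    · exact absurd (h.drawn_succ hlt) h'.not_drawn_beyond
  exact R.injective (by rw [h.pos_eq, h'.pos_eq, hm])

theorem eq_of_right (h : R.IsCornerRail u v e m) (h' : R.IsCornerRail u v' e' m') : v = v' := by
  obtain rfl := rot_injective (h.corner_right.dir_unique h.unit.turn h'.unit.turn h'.corner_right)
  have key : ∀ {v v' : V} {m m' : ℕ}, R.IsCornerRail u v e' m → R.IsCornerRail u v' e' m' →
      ¬ m < m' := by
    intro v v' m m' h h' hlt
    have hp : R.pos v = linePt (R.pos v') e' (m' - m) := by
      have := h.pos_eq.symm.trans h'.pos_eq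
      simp only [linePt, Prod.ext_iff] at *
      constructor
      · linarith [this.1]
      · linarith [this.2]
    have hd := (h'.drawn_succ (i := m' - m - 1) (by omega)).symm
    have h2 := h.corner_left.2.1
    rw [hp, ← sub_eq_add_neg, ← linePt_sub_one] at h2
    apply h2
    convert hd using 2 <;> omega
  have hm : m = m' := by
    have := key h h'
    have := key h' h
    omega
  subst hm
  apply R.injective
  have := h.pos_eq.symm.trans h'.pos_eq
  simp only [linePt, Prod.ext_iff] at *
  constructor
  · linarith [this.1]
  · linarith [this.2]

/-- Two corner paths that meet are equal or meet in an end-vertex of both. -/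
theorem eq_or_end (h : R.IsCornerRail u v e m) (h' : R.IsCornerRail u' v' e' m') {x : V}
    (hx : ∃ i : ℕ, i ≤ m ∧ R.pos x = linePt (R.pos v) e i)
    (hx' : ∃ i : ℕ, i ≤ m' ∧ R.pos x = linePt (R.pos v') e' i) :
    (u = u' ∧ v = v') ∨ ((x = u ∨ x = v) ∧ (x = u' ∨ x = v')) := by
  obtain ⟨i, hi, hxi⟩ := hx
  obtain ⟨j, hj, hxj⟩ := hx'
  have hend : ∀ {u v e m} {i : ℕ}, R.IsCornerRail u v e m → i ≤ m →
      R.pos x = linePt (R.pos v) e i → (x = u ∨ x = v) ∨ (0 < i ∧ i < m) := by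
    intro u v e m i h hi hxi
    rcases Nat.eq_zero_or_pos i with rfl | h0
    · exact Or.inl (Or.inr (R.injective (by rw [hxi]; simp [linePt_zero])))
    rcases lt_or_eq_of_le hi with h1 | rfl
    · exact Or.inr ⟨h0, h1⟩
    · exact Or.inl (Or.inl (R.injective (by rw [hxi, h.pos_eq])))
  have htype : ∀ {u v e m}, R.IsCornerRail u v e m → (x = u ∨ x = v) → boundaryType G x = 2 := by
    rintro u v e m h (rfl | rfl)
    · exact h.boundaryType_right
    · exact h.boundaryType_left
  rcases hend h hi hxi with h1 | ⟨h1, h1'⟩ <;> rcases hend h' hj hxj with h2 | ⟨h2, h2'⟩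
  · exact Or.inr ⟨h1, h2⟩
  · have := htype h h1
    rw [h'.boundaryType_inner h2 h2' hxj] at this
    omega
  · have := htype h' h2
    rw [h.boundaryType_inner h1 h1' hxi] at this
    omega
  · left
    have r1 := h.inner i h1 h1'
    have r2 := h'.inner j h2 h2'
    rw [← hxi] at r1
    rw [← hxj] at r2
    obtain rfl := r1.dir_unique h.unit h'.unit r2
    -- Both paths have the same direction at `x`. If their starts differed, the start of one would
    -- be an inner vertex of the other, of type 1 and 2 at once.
    have key : ∀ {u v u' v' : V} {m m' i j : ℕ}, R.IsCornerRail u v e' m →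
        R.IsCornerRail u' v' e' m' → j < m' → R.pos x = linePt (R.pos v) e' i →
        R.pos x = linePt (R.pos v') e' j → ¬ i < j := by
      intro u v u' v' m m' i j h h' hj hxi hxj hlt
      have hp : R.pos v = linePt (R.pos v') e' (j - i : ℕ) := by
        have := hxi.symm.trans hxj
        rw [Nat.cast_sub hlt.le]
        simp only [linePt, Prod.ext_iff] at *
        constructor
        · linarith [this.1]
        · linarith [this.2]
      have := h'.boundaryType_inner (i := j - i) (by omega) (by omega) hp
      rw [h.boundaryType_left] at this
      omega
    have hij : i = j := by
      have := key h h' h2' hxi hxj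
      have := key h' h h1' hxj hxi
      omega
    subst hij
    have hv : v = v' := by
      apply R.injective
      have := hxi.symm.trans hxj
      simp only [linePt, Prod.ext_iff] at *
      constructor
      · linarith [this.1]
      · linarith [this.2]
    subst hv
    exact ⟨h.eq_of_left h', rfl⟩

/-- The neighbours of a vertex of the path are on the path or directly next to it. -/
theorem drawn_cases (h : R.IsCornerRail u v e m) {i : ℕ} (hi : i ≤ m) {q : ℤ × ℤ}
    (hq : R.Drawn (linePt (R.pos v) e i) q) :
    q = linePt (R.pos v) e i + rot e ∨ ∃ k : ℕ, k ≤ m ∧ q = linePt (R.pos v) e k := by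
  have h1 := h.one_le
  have hu := hq.isUnitVec
  rcases h.unit.eq_or hu with hc | hc | hc | hc <;> rw [sub_eq_iff_eq_add'] at hc
  · rw [← linePt_succ] at hc
    by_cases him : i < m
    · exact Or.inr ⟨i + 1, him, by rw [hc]; push_cast; rfl⟩
    · obtain rfl : i = m := by omega
      exact absurd (hc ▸ hq) h.not_drawn_beyond
  · exact Or.inl hc
  · rcases Nat.eq_zero_or_pos i with rfl | h0
    · rw [Nat.cast_zero, linePt_zero] at hc hq
      exact absurd (hc ▸ hq) h.corner_left.2.1
    · refine Or.inr ⟨i - 1, by omega, ?_⟩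
      rw [hc, Nat.cast_sub h0, ← sub_eq_add_neg, ← linePt_sub_one]
      rfl
  · exfalso
    rcases Nat.eq_zero_or_pos i with rfl | h0
    · rw [Nat.cast_zero, linePt_zero] at hc hq
      exact h.corner_left.2.2 (hc ▸ hq)
    by_cases him : i < m
    · exact (h.inner i h0 him).2.2 (hc ▸ hq)
    · obtain rfl : i = m := by omega
      rw [← h.pos_eq] at hc hq
      exact h.corner_right.2.1 (hc ▸ hq)

/-- Every geodetic set meets every corner path. -/
theorem exists_mem_geodetic (h : R.IsCornerRail u v e m) {T : Set V} (hT : IsGeodeticSet G T) :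
    ∃ x ∈ T, ∃ i : ℕ, i ≤ m ∧ R.pos x = linePt (R.pos v) e i := by
  by_contra! hno
  set S : Set V := {x | ∃ i : ℕ, i ≤ m ∧ R.pos x = linePt (R.pos v) e i} with hS
  have hvS : v ∈ S := ⟨0, by omega, by simp [linePt_zero]⟩
  have hTS : ∀ x ∈ T, x ∉ S := fun x hx ⟨i, hi, hxi⟩ => hno x hx i hi hxi
  -- The squares along the corner path belong to one ladder, and the path is part of its rail
  -- `false`.
  obtain ⟨z, hz, hpz⟩ := h.corner_left.1.drawn_rot.exists_adj
  obtain ⟨K, i, hi, hKv, hKz⟩ := exists_ladder R hz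
  have hdir : K.dir = e := by
    apply rot_injective
    have h1 := K.pos_vert true i hi
    have h2 := K.pos_vert false i hi
    rw [hKz, hpz] at h1
    rw [hKv] at h2
    simp only [reduceIte, Bool.false_eq_true, add_zero] at h1 h2
    rw [h2] at h1
    exact (add_left_cancel h1).symm
  have hbase : ∀ j : ℤ, linePt (R.pos v) e j = linePt K.base K.dir (i + j) := by
    intro j
    rw [← hKv, K.pos_vert _ _ hi, hdir]
    simp [linePt_linePt]
  have hlen : i + m ≤ K.len := by
    by_contra hc
    have := h.isSquare (i := K.len - i) (by omega)
    rw [hbase, Nat.cast_sub hi, ← hdir] at this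
    exact K.after (by simpa using this)
  -- A corner path can be left over rungs only.
  have hrung : ∀ x y, x ∈ S → y ∉ S → G.Adj x y → ∃ j ≤ K.len, x = K.vert false j ∧
      y = K.vert true j := by
    rintro x y ⟨j, hj, hxj⟩ hy hxy
    have hd := R.drawn_pos_iff.2 hxy
    rw [hxj] at hd
    rcases h.drawn_cases hj hd with h1 | ⟨k, hk, h1⟩
    · refine ⟨i + j, by omega, R.injective ?_, R.injective ?_⟩
      · rw [hxj, hbase, K.pos_vert _ _ (by omega)]; simp
      · rw [h1, hbase, K.pos_vert _ _ (by omega), hdir]; simp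
    · exact absurd ⟨k, hk, h1⟩ hy
  obtain ⟨a, ha, b, hb, p, hp, hv⟩ := hT v
  obtain ⟨q, r, hqr⟩ := exists_split_of_mem_support p hv
  obtain ⟨d, hd, hd1, hd2⟩ := q.exists_boundary_dart Sᶜ (hTS a ha) (by simpa using hvS)
  obtain ⟨d', hd', hd1', hd2'⟩ := r.exists_boundary_dart S hvS (hTS b hb)
  rw [Set.mem_compl_iff, not_not] at hd2
  obtain ⟨j, hj, e1, e2⟩ := hrung _ _ hd2 hd1 d.adj.symm
  obtain ⟨j', hj', e1', e2'⟩ := hrung _ _ hd1' hd2' d'.adj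
  -- The shortest path through `v` enters over the rung `j`. Its part from there on is still
  -- shortest, yet it leaves over a second rung `j'` of the same ladder.
  obtain ⟨q1, q2, hq⟩ := exists_split_of_mem_darts q hd
  have h1 := SimpleGraph.dist_le ((q1.append d.adj.toWalk).append (q2.append r))
  have h2 := SimpleGraph.dist_le q1
  have h3 := q1.reachable.dist_triangle_left b
  have h4 := SimpleGraph.dist_le (SimpleGraph.Walk.cons d.adj (q2.append r))
  simp only [SimpleGraph.Walk.length_append, SimpleGraph.Walk.length_cons] at h1 h4
  have hlen2 : (q2.append r).length + 1 = G.dist d.fst b := by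
    rw [SimpleGraph.Walk.length_append]; omega
  obtain ⟨⟨x, y⟩, hxy⟩ := d
  simp only at *
  subst e1 e2
  have := K.crossing_eq_zero_of_geodesic true hj (q2.append r) hlen2 d' (by
    rw [SimpleGraph.Walk.darts_append, List.mem_append]; exact Or.inr hd')
  rw [e1', e2', K.crossing_rung j' hj'] at this
  omega

end IsCornerRail

/-- An inner vertex of a shortest path has different neighbours towards the two ends, so a vertex of
degree at most 1 can only be an end. -/
theorem mem_geodetic_of_vertexDegree_le_one {T : Set V} (hT : IsGeodeticSet G T) {v : V}
    (hv : vertexDegree G v ≤ 1) : v ∈ T := by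
  obtain ⟨a, ha, b, hb, p, hp, hvp⟩ := hT v
  by_cases hav : a = v
  · exact hav ▸ ha
  by_cases hbv : b = v
  · exact hbv ▸ hb
  exfalso
  obtain ⟨q, r, hqr⟩ := exists_split_of_mem_support p hvp
  obtain ⟨y, hy, hya⟩ := exists_adj_dist_lt q.reachable.symm hav
  obtain ⟨z, hz, hzb⟩ := exists_adj_dist_lt r.reachable hbv
  have hyz : y = z := (Set.ncard_le_one_iff (Set.toFinite _)).1 hv hy hz
  subst hyz
  have h1 := SimpleGraph.dist_le q
  have h2 := SimpleGraph.dist_le r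
  have h3 := (q.reachable.trans hy.reachable).dist_triangle_left b
  have h4 := SimpleGraph.dist_comm (G := G) (u := y) (v := a)
  have h5 := SimpleGraph.dist_comm (G := G) (u := v) (v := a)
  omega

/-! ### Sets that meet all corner paths -/

/-- A set that contains the vertices of degree at most 1 and an end of every corner path meets both
sides of every edge. -/
theorem IsSolid.exists_mem_closer (hR : R.IsSolid) {D : Set V} (hlow : lowDegreeVertices G ⊆ D)
    (hcorner : ∀ u v, R.CornerStep u v → u ∈ D ∨ v ∈ D) (n : ℕ) :
    ∀ w y, G.Adj w y → {x | G.Reachable w x ∧ G.dist w x < G.dist y x}.ncard = n →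
      ∃ x ∈ D, G.Reachable w x ∧ G.dist w x < G.dist y x := by
  induction n using Nat.strong_induction_on with
  | _ n ih =>
    intro w y hwy hn
    obtain ⟨K, i, hi, rfl, rfl⟩ := exists_ladder R hwy
    -- The side of `w` can be read off at any rung of the ladder.
    have hside : ∀ j ≤ K.len, ∀ x, G.Reachable (K.vert false i) x →
        (G.dist (K.vert false i) x < G.dist (K.vert true i) x ↔
          G.dist (K.vert false j) x < G.dist (K.vert true j) x) := by
      intro j hj x hx
      have h1 := K.dist_lt_iff hR hi hj hx
      have h2 := R.dist_adj_cases (K.rung i hi) hx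
      have h3 := R.dist_adj_cases (K.rung j hj) ((K.reachable_dist_le _ _ hj hi).1.trans hx)
      constructor <;> intro h <;> by_contra h'
      · have := h1.2 (by omega); omega
      · have := h1.1 (by omega); omega
    have hself : ∀ j ≤ K.len, G.Reachable (K.vert false i) (K.vert false j) ∧
        G.dist (K.vert false i) (K.vert false j) < G.dist (K.vert true i) (K.vert false j) := by
      intro j hj
      have hr := (K.reachable_dist_le false false hi hj).1
      refine ⟨hr, (hside j hj _ hr).2 ?_⟩
      rw [SimpleGraph.dist_self, SimpleGraph.dist_eq_one_iff_adj.2 (K.rung j hj).symm]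
      omega
    have hpb : ∀ j ≤ K.len, R.pos (K.vert false j) = linePt K.base K.dir j := fun j hj => by
      rw [K.pos_vert _ _ hj]; simp
    have hpt : ∀ j ≤ K.len, R.pos (K.vert true j) = linePt K.base K.dir j + rot K.dir :=
      fun j hj => by rw [K.pos_vert _ _ hj]; simp
    by_cases hex : ∃ j ≤ K.len, ∃ z, G.Adj (K.vert false j) z ∧ z ≠ K.vert true j ∧
        ∀ k ≤ K.len, z ≠ K.vert false k
    · obtain ⟨j, hj, z, hz, hzt, hzk⟩ := hex
      -- An edge leaves the rail away from the ladder. Its far side is contained in the side of `w`,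
      -- and properly, since it misses `vert false j`; so induction applies to it.
      have hsub : ∀ x, G.Reachable z x → G.dist z x < G.dist (K.vert false j) x →
          G.Reachable (K.vert false i) x ∧
          G.dist (K.vert false i) x < G.dist (K.vert true i) x := by
        intro x hx hlt
        have hjx := hz.reachable.trans hx
        have hix := (hself j hj).1.trans hjx
        refine ⟨hix, (hside j hj x hix).2 ?_⟩
        -- If `x` were also across the rung, `z` and the rung would span a square. This square would
        -- put `z` on the rail or extend the ladder beyond its ends.
        by_contra hc
        have h3 := R.dist_adj_cases (K.rung j hj) hjx
        obtain ⟨c, e, -, -, -, he, hsq, hpos⟩ := hR.quadrangle hz (K.rung j hj) hzt hjx hlt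
          (by omega)
        rw [hpt j hj, ← hpb j hj, add_right_inj, add_right_inj] at hpos
        rcases hpos with ⟨h1, h2⟩ | ⟨h1, h2⟩
        · obtain rfl := rot_injective h2
          by_cases hjl : j < K.len
          · apply hzk (j + 1) hjl
            apply R.injective
            rw [h1, hpb _ hj, hpb _ hjl]
            push_cast
            rw [linePt_succ]
          · obtain rfl : j = K.len := by omega
            rw [hpb _ hj] at hsq
            exact K.after hsq
        · subst h1
          rw [R.isSquare_rot_iff K.unit, hpb _ hj, ← linePt_sub_one] at hsq
          rcases Nat.eq_zero_or_pos j with rfl | h0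
          · exact K.before (by simpa using hsq)
          · apply hzk (j - 1) (by omega)
            apply R.injective
            rw [h2, hpb _ hj, hpb _ (by omega), rot_rot, Nat.cast_sub h0, ← sub_eq_add_neg,
              ← linePt_sub_one]
            rfl
      obtain ⟨x, hxD, hx1, hx2⟩ := ih _ (by
        rw [← hn]
        refine Set.ncard_lt_ncard (Set.ssubset_iff_exists.2 ⟨fun x hx => hsub x hx.1 hx.2,
          K.vert false j, hself j hj, ?_⟩) (Set.toFinite _)
        rintro ⟨-, h⟩
        rw [SimpleGraph.dist_self] at h
        omega) z (K.vert false j) hz.symm rfl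
      exact ⟨x, hxD, hsub x hx1 hx2⟩
    -- No edge leaves the rail except rungs. A rail of one vertex is then a vertex of degree 1, and
    -- a longer rail is a corner path.
    · push Not at hex
      suffices h : ∃ j ≤ K.len, K.vert false j ∈ D by
        obtain ⟨j, hj, hD⟩ := h
        exact ⟨_, hD, hself j hj⟩
      rcases Nat.eq_zero_or_pos K.len with h0 | hpos
      · refine ⟨0, by omega, hlow ?_⟩
        rw [lowDegreeVertices, Set.mem_ofPred_eq, vertexDegree, Set.ncard_le_one_iff (Set.toFinite _)]
        have key : ∀ z, G.Adj (K.vert false 0) z → z = K.vert true 0 := by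
          intro z hz
          by_contra hne
          obtain ⟨k, hk, rfl⟩ := hex 0 (by omega) z hz hne
          obtain rfl : k = 0 := by omega
          exact hz.ne rfl
        intro a b ha hb
        rw [key a ha, key b hb]
      · have hnot : ∀ j ≤ K.len, ∀ q, q ≠ linePt K.base K.dir j + rot K.dir →
            (∀ k : ℕ, k ≤ K.len → q ≠ linePt K.base K.dir k) → ¬ R.Drawn (linePt K.base K.dir j) q := by
          intro j hj q h1 h2 hd
          rw [← hpb j hj] at hd
          obtain ⟨z, hz, rfl⟩ := hd.exists_adj
          rw [← hpt j hj] at h1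
          obtain ⟨k, hk, rfl⟩ := hex j hj z hz (fun h => h1 (by rw [h]))
          exact h2 k hk (hpb k hk)
        have hbelow : ∀ j ≤ K.len,
            ¬ R.Drawn (linePt K.base K.dir j) (linePt K.base K.dir j + -rot K.dir) := by
          intro j hj
          refine hnot j hj _ ?_ ?_
          · rw [Ne, add_right_inj]
            exact K.unit.turn.ne_neg.symm
          · intro k hk
            rcases K.unit.cases with h | h | h | h <;> rw [h] <;> simp [linePt, rot]
        have hsq0 := K.isSquare (i := 0) hpos
        have hsql := K.isSquare (i := K.len - 1) (by omega)
        rw [Nat.cast_sub hpos] at hsql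
        have hrail : R.IsCornerRail (K.vert false K.len) (K.vert false 0) K.dir K.len := by
          have hp0 : R.pos (K.vert false 0) = K.base := by
            rw [hpb 0 (by omega)]; simp [linePt_zero]
          refine ⟨K.unit, hpos, by rw [hp0, hpb _ le_rfl], ?_, ?_, ?_⟩
          · rw [hpb 0 (by omega)]
            refine ⟨hsq0, ?_, hbelow 0 (by omega)⟩
            refine hnot 0 (by omega) _ ?_ ?_
            · rw [Ne, add_right_inj]
              rcases K.unit.cases with h | h | h | h <;> rw [h] <;> simp [rot]
            · intro k hk h
              rw [← sub_eq_add_neg, ← linePt_sub_one] at h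
              have := linePt_injective K.base K.unit h
              omega
          · rw [hpb _ le_rfl]
            refine ⟨?_, hbelow _ le_rfl, ?_⟩
            · rw [R.isSquare_rot_iff K.unit, ← linePt_sub_one]; exact hsql
            · rw [rot_rot, neg_neg]
              refine hnot _ le_rfl _ ?_ ?_
              · rw [Ne, add_right_inj]
                rcases K.unit.cases with h | h | h | h <;> rw [h] <;> simp [rot]
              · intro k hk h
                rw [← linePt_succ] at h
                have := linePt_injective K.base K.unit h
                omega
          · intro k hk0 hk
            rw [hp0]
            have hs1 := K.isSquare (i := k - 1) (by omega)
            rw [Nat.cast_sub hk0] at hs1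
            refine ⟨K.isSquare hk, ?_, hbelow k hk.le⟩
            rw [R.isSquare_rot_iff K.unit, ← linePt_sub_one]
            exact hs1
        rcases hcorner _ _ (hrail.cornerStep hR) with h | h
        · exact ⟨_, le_rfl, h⟩
        · exact ⟨0, by omega, h⟩

theorem IsSolid.isGeodeticSet (hR : R.IsSolid) {D : Set V} (hlow : lowDegreeVertices G ⊆ D)
    (hcorner : ∀ u v, R.CornerStep u v → u ∈ D ∨ v ∈ D) : IsGeodeticSet G D := by
  refine hR.isGeodeticSet_of_forall (fun w hw => hlow ?_) fun w y hwy => ?_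
  · rw [lowDegreeVertices, Set.mem_ofPred_eq, vertexDegree, Set.ncard_le_one_iff (Set.toFinite _)]
    intro a b ha
    exact absurd ha (hw a)
  · obtain ⟨x, hx, h1, h2⟩ := hR.exists_mem_closer hlow hcorner _ y w hwy.symm rfl
    exact ⟨x, hx, hwy.reachable.trans h1, h2⟩

end GridEmbedding

/-! ### Every second entry of a list -/

section Lists

variable {α : Type*}

/-- The pairs formed by the first and second, third and fourth, ... entries. -/
def disjointPairs : List α → List (α × α)
  | [] => []
  | [_] => []
  | a :: b :: l => (a, b) :: disjointPairs l

theorem map_snd_disjointPairs : ∀ l : List α, (disjointPairs l).map Prod.snd = everySecond l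
  | [] => rfl
  | [_] => rfl
  | _ :: b :: l => by simp [disjointPairs, everySecond, map_snd_disjointPairs l]

theorem length_everySecond : ∀ l : List α, (everySecond l).length = l.length / 2
  | [] => by simp [everySecond]
  | [_] => by simp [everySecond]
  | _ :: b :: l => by simp [everySecond, length_everySecond l]; omega

theorem everySecond_sublist : ∀ l : List α, (everySecond l).Sublist l
  | [] => .slnil
  | [_] => List.nil_sublist _
  | _ :: _ :: l => .cons _ (.cons_cons _ (everySecond_sublist l))

theorem mem_everySecond_iff {l : List α} {b : α} :
    b ∈ everySecond l ↔ ∃ a, (a, b) ∈ disjointPairs l := by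
  rw [← map_snd_disjointPairs, List.mem_map]
  constructor
  · rintro ⟨⟨a, b⟩, h, rfl⟩; exact ⟨a, h⟩
  · rintro ⟨a, h⟩; exact ⟨_, h, rfl⟩

theorem exists_append_of_mem_disjointPairs {a b : α} : ∀ {l : List α}, (a, b) ∈ disjointPairs l →
    ∃ l₁ l₂, l = l₁ ++ a :: b :: l₂
  | [], h => by simp [disjointPairs] at h
  | [_], h => by simp [disjointPairs] at h
  | x :: y :: l, h => by
    rw [disjointPairs, List.mem_cons] at h
    rcases h with h | h
    · obtain ⟨rfl, rfl⟩ := Prod.mk.inj h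
      exact ⟨[], l, rfl⟩
    · obtain ⟨l₁, l₂, rfl⟩ := exists_append_of_mem_disjointPairs h
      exact ⟨x :: y :: l₁, l₂, rfl⟩

theorem mem_of_mem_disjointPairs {a b : α} {l : List α} (h : (a, b) ∈ disjointPairs l) :
    a ∈ l ∧ b ∈ l := by
  obtain ⟨l₁, l₂, rfl⟩ := exists_append_of_mem_disjointPairs h
  simp

theorem disjointPairs_disjoint {a b c d x : α} : ∀ {l : List α}, l.Nodup →
    (a, b) ∈ disjointPairs l → (c, d) ∈ disjointPairs l → (x = a ∨ x = b) → (x = c ∨ x = d) → b = d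
  | [], _, h, _, _, _ => by simp [disjointPairs] at h
  | [_], _, h, _, _, _ => by simp [disjointPairs] at h
  | u :: v :: l, hl, h, h', hx, hx' => by
    simp only [List.nodup_cons, List.mem_cons, not_or] at hl
    rw [disjointPairs, List.mem_cons] at h h'
    rcases h with h | h <;> rcases h' with h' | h'
    · rw [← h'] at h; exact (Prod.mk.inj h).2
    · obtain ⟨rfl, rfl⟩ := Prod.mk.inj h
      have h2 := mem_of_mem_disjointPairs h'
      exfalso
      rcases hx with rfl | rfl <;> rcases hx' with rfl | rfl
      · exact hl.1.2 h2.1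
      · exact hl.1.2 h2.2
      · exact hl.2.1 h2.1
      · exact hl.2.1 h2.2
    · obtain ⟨rfl, rfl⟩ := Prod.mk.inj h'
      have h2 := mem_of_mem_disjointPairs h
      exfalso
      rcases hx with rfl | rfl <;> rcases hx' with rfl | rfl
      · exact hl.1.2 h2.1
      · exact hl.2.1 h2.1
      · exact hl.1.2 h2.2
      · exact hl.2.1 h2.2
    · exact disjointPairs_disjoint hl.2.2 h h' hx hx'

theorem mem_everySecond_of_append {a b : α} {l₂ : List α} : ∀ l₁ : List α,
    a ∈ everySecond (l₁ ++ a :: b :: l₂) ∨ b ∈ everySecond (l₁ ++ a :: b :: l₂)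
  | [] => Or.inr (by simp [everySecond])
  | [_] => Or.inl (by simp [everySecond])
  | x :: y :: l => by
    simp only [List.cons_append, everySecond, List.mem_cons]
    rcases mem_everySecond_of_append (a := a) (b := b) (l₂ := l₂) l with h | h
    · exact Or.inl (Or.inr h)
    · exact Or.inr (Or.inr h)

/-- Needed for cyclic corner sequences, where a corner path also joins the last entry to the first.
-/
theorem mem_everySecond_concat {a : α} : ∀ l : List α, (l ++ [a]).length % 2 = 0 →
    a ∈ everySecond (l ++ [a])
  | [], h => by simp at h
  | [_], _ => by simp [everySecond]
  | x :: y :: l, h => by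
    simp only [List.cons_append, everySecond, List.mem_cons]
    refine Or.inr (mem_everySecond_concat l ?_)
    simp only [List.length_append, List.length_cons, List.length_nil] at *
    omega

end Lists

namespace GridEmbedding

variable {V : Type*} [Fintype V] {G : SimpleGraph V} {R : GridEmbedding G}

/-! ### Corner sequences -/

theorem IsSolid.cornerStep_left_unique (hR : R.IsSolid) {u u' v : V} (h : R.CornerStep u v)
    (h' : R.CornerStep u' v) : u = u' := by
  obtain ⟨e, m, h⟩ := hR.exists_cornerRail h
  obtain ⟨e', m', h'⟩ := hR.exists_cornerRail h'
  exact h.eq_of_left h'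

theorem IsSolid.cornerStep_right_unique (hR : R.IsSolid) {u v v' : V} (h : R.CornerStep u v)
    (h' : R.CornerStep u v') : v = v' := by
  obtain ⟨e, m, h⟩ := hR.exists_cornerRail h
  obtain ⟨e', m', h'⟩ := hR.exists_cornerRail h'
  exact h.eq_of_right h'

theorem CornerStep.ne {u v : V} (h : R.CornerStep u v) : u ≠ v := by
  obtain ⟨p, hp⟩ := h; exact hp.ne

theorem IsSolid.boundaryType_cornerVertex (hR : R.IsSolid) {v : V} (h : R.IsCornerVertex v) :
    boundaryType G v = 2 := by
  obtain ⟨u, h | h⟩ := h <;> obtain ⟨e, m, h⟩ := hR.exists_cornerRail h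
  · exact h.boundaryType_left
  · exact h.boundaryType_right

/-- Consecutive corner paths are perpendicular. -/
theorem IsCornerRail.turn {u v w : V} {e f : ℤ × ℤ} {m k : ℕ} (h : R.IsCornerRail u v e m)
    (h' : R.IsCornerRail v w f k) : f.2 = 0 ↔ ¬ e.2 = 0 := by
  have h1 := h.corner_left.dir_unique h.unit h'.unit.turn h'.corner_right
  have h2 := h.unit.cases
  simp only [rot, Prod.ext_iff] at *
  omega

/-- Corner paths alternate between horizontal and vertical, so the length of the chain relates the
directions at its two ends by parity. -/
theorem IsSolid.direction_chain (hR : R.IsSolid) {u v : V} {e : ℤ × ℤ} {m : ℕ}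
    (h : R.IsCornerRail u v e m) (l : List V) : ∀ x, (x :: l).IsChain R.CornerStep →
      (x :: l).getLast (List.cons_ne_nil _ _) = u → ∃ w f k, R.IsCornerRail x w f k ∧
        (f.2 = 0 ↔ (e.2 = 0 ↔ l.length % 2 = 0)) := by
  induction l with
  | nil =>
    rintro x - rfl
    exact ⟨v, e, m, h, by simp⟩
  | cons y l ih =>
    intro x hc hl
    rw [List.isChain_cons_cons] at hc
    obtain ⟨w, f, k, hw, hf⟩ := ih y hc.2 (by rw [List.getLast_cons (List.cons_ne_nil _ _)] at hl; exact hl)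
    obtain ⟨g, j, hg⟩ := hR.exists_cornerRail hc.1
    refine ⟨y, g, j, hg, ?_⟩
    have := hg.turn hw
    rw [hf] at this
    rw [List.length_cons]
    by_cases hl2 : l.length % 2 = 0
    · have h3 : ¬ (l.length + 1) % 2 = 0 := by omega
      simp only [hl2, h3, iff_true, iff_false] at *
      tauto
    · have h3 : (l.length + 1) % 2 = 0 := by omega
      simp only [hl2, h3, iff_true, iff_false] at *
      tauto

/-- The closing path is perpendicular to the first path of the sequence, so the alternation has to
close up after an even number of paths. -/
theorem IsSolid.even_length_of_cyclic (hR : R.IsSolid) {u v : V} {l : List V}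
    (hc : (v :: l ++ [u]).IsChain R.CornerStep) (huv : R.CornerStep u v) :
    (v :: l ++ [u]).length % 2 = 0 := by
  obtain ⟨e, m, h⟩ := hR.exists_cornerRail huv
  obtain ⟨w, f, k, hw, hf⟩ := hR.direction_chain h (l ++ [u]) v hc (by simp)
  have := h.turn hw
  rw [hf] at this
  simp only [List.cons_append, List.length_cons, List.length_append] at *
  by_cases h2 : (l.length + 1) % 2 = 0
  · simp [h2] at this
  · simp
    simp at h2
    omega

/-- A corner path joins two consecutive entries of a maximal corner sequence, or the last to the
first entry of a cyclic one. -/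
theorem IsSolid.mem_maxCornerSeq (hR : R.IsSolid) {T : List V} (hT : R.IsMaxCornerSeq T) {u v : V}
    (huv : R.CornerStep u v) (hv : v ∈ T) :
    (∃ l₁ l₂, T = l₁ ++ u :: v :: l₂) ∨ ∃ l, T = v :: l ++ [u] ∧ T.length % 2 = 0 := by
  obtain ⟨⟨hne, hnd, hcv, hch⟩, hmax⟩ := hT
  obtain ⟨l₁, l₂, rfl⟩ := List.append_of_mem hv
  rcases List.eq_nil_or_concat l₁ with rfl | ⟨l₁, x, rfl⟩
  · right
    rw [List.nil_append] at *
    by_cases hu : u ∈ v :: l₂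
    · rw [List.mem_cons] at hu
      have hu2 := hu.resolve_left huv.ne
      obtain ⟨a, b, rfl⟩ := List.append_of_mem hu2
      cases b with
      | nil =>
        exact ⟨a, rfl, hR.even_length_of_cyclic hch huv⟩
      | cons c b =>
        exfalso
        have h1 : R.CornerStep u c := by
          have : (v :: a ++ u :: c :: b).IsChain R.CornerStep := hch
          rw [List.isChain_append] at this
          exact (List.isChain_cons_cons.1 this.2.1).1
        obtain rfl := hR.cornerStep_right_unique huv h1
        simp at hnd
    · exfalso
      have := hmax (u :: v :: l₂) ⟨by simp, List.nodup_cons.2 ⟨hu, hnd⟩, ?_, ?_⟩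
        (List.infix_cons List.infix_rfl)
      · have := congrArg List.length this
        simp at this
      · intro w hw
        rw [List.mem_cons] at hw
        rcases hw with rfl | hw
        · exact ⟨v, Or.inr huv⟩
        · exact hcv w hw
      · exact List.isChain_cons_cons.2 ⟨huv, hch⟩
  · left
    rw [List.concat_eq_append, List.append_assoc, List.singleton_append] at hch ⊢
    rw [List.isChain_append] at hch
    obtain rfl := hR.cornerStep_left_unique huv (List.isChain_cons_cons.1 hch.2.1).1
    exact ⟨l₁, l₂, rfl⟩

/-- The selected vertices meet all corner paths. -/
theorem IsSolid.mem_cornerSelection_of_cornerStep (hR : R.IsSolid) {𝒮 : Finset (List V)}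
    (h𝒮 : R.IsUnorientedCornerSystem 𝒮) {u v : V} (huv : R.CornerStep u v) :
    u ∈ cornerSelection G 𝒮 ∨ v ∈ cornerSelection G 𝒮 := by
  obtain ⟨S, ⟨hS, hvS⟩, -⟩ := h𝒮.2 v ⟨u, Or.inl huv⟩
  suffices h : u ∈ everySecond S ∨ v ∈ everySecond S by
    rcases h with h | h
    · exact Or.inl (Or.inr ⟨S, hS, h⟩)
    · exact Or.inr (Or.inr ⟨S, hS, h⟩)
  rcases h𝒮.1 S hS with h | h
  · rcases hR.mem_maxCornerSeq h huv hvS with ⟨l₁, l₂, rfl⟩ | ⟨l, rfl, hl⟩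
    · exact mem_everySecond_of_append l₁
    · exact Or.inl (mem_everySecond_concat _ hl)
  · rcases hR.mem_maxCornerSeq h huv (by simpa using hvS) with ⟨l₁, l₂, h1⟩ | ⟨l, h1, hl⟩
    · have : S = l₂.reverse ++ v :: u :: l₁.reverse := by
        rw [← List.reverse_reverse S, h1]; simp
      rw [this]
      exact (mem_everySecond_of_append l₂.reverse).symm
    · have : S = (u :: l.reverse) ++ [v] := by
        rw [← List.reverse_reverse S, h1]; simp
      rw [List.length_reverse] at hl
      rw [this] at hl ⊢
      exact Or.inr (mem_everySecond_concat _ hl)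

theorem IsUnorientedCornerSystem.properties {𝒮 : Finset (List V)}
    (h𝒮 : R.IsUnorientedCornerSystem 𝒮) {S : List V} (hS : S ∈ 𝒮) :
    S.Nodup ∧ (∀ v ∈ S, R.IsCornerVertex v) ∧
      S.IsChain (fun a b => R.CornerStep a b ∨ R.CornerStep b a) := by
  rcases h𝒮.1 S hS with h | h
  · exact ⟨h.1.2.1, h.1.2.2.1, h.1.2.2.2.imp fun _ _ => Or.inl⟩
  · refine ⟨List.nodup_reverse.1 h.1.2.1, fun v hv => h.1.2.2.1 v (by simpa using hv), ?_⟩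
    have := h.1.2.2.2
    rw [List.isChain_reverse] at this
    exact this.imp fun _ _ => Or.inr

/-- Selected vertices are mapped injectively to `T`: a vertex of degree at most 1 to itself, and the
second vertex of a pair to an element of `T` on the corner path of that pair. -/
theorem IsSolid.ncard_le_of_isGeodeticSet (hR : R.IsSolid) {𝒮 : Finset (List V)}
    (h𝒮 : R.IsUnorientedCornerSystem 𝒮) {T : Set V} (hT : IsGeodeticSet G T) :
    (cornerSelection G 𝒮).ncard ≤ T.ncard := by
  set P : V → V → Prop := fun x t => (vertexDegree G x ≤ 1 ∧ t = x) ∨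
    ∃ S ∈ 𝒮, ∃ a, (a, x) ∈ disjointPairs S ∧ ∃ u v e m, R.IsCornerRail u v e m ∧
      ((u = a ∧ v = x) ∨ (u = x ∧ v = a)) ∧ ∃ i : ℕ, i ≤ m ∧ R.pos t = linePt (R.pos v) e i with hP
  have hex : ∀ x ∈ cornerSelection G 𝒮, ∃ t ∈ T, P x t := by
    rintro x (hx | ⟨S, hS, hx⟩)
    · exact ⟨x, mem_geodetic_of_vertexDegree_le_one hT hx, Or.inl ⟨hx, rfl⟩⟩
    · obtain ⟨a, ha⟩ := mem_everySecond_iff.1 hx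
      obtain ⟨l₁, l₂, h1⟩ := exists_append_of_mem_disjointPairs ha
      have hch := (h𝒮.properties hS).2.2
      rw [h1, List.isChain_append] at hch
      rcases (List.isChain_cons_cons.1 hch.2.1).1 with hst | hst <;>
        obtain ⟨e, m, hr⟩ := hR.exists_cornerRail hst <;>
        obtain ⟨t, ht, hti⟩ := hr.exists_mem_geodetic hT
      · exact ⟨t, ht, Or.inr ⟨S, hS, a, ha, _, _, e, m, hr, Or.inl ⟨rfl, rfl⟩, hti⟩⟩
      · exact ⟨t, ht, Or.inr ⟨S, hS, a, ha, _, _, e, m, hr, Or.inr ⟨rfl, rfl⟩, hti⟩⟩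
  have hdeg : ∀ {t u v e m}, R.IsCornerRail u v e m →
      (∃ i : ℕ, i ≤ m ∧ R.pos t = linePt (R.pos v) e i) → 2 ≤ vertexDegree G t := by
    rintro t u v e m h ⟨i, hi, ht⟩
    rcases Nat.eq_zero_or_pos i with rfl | h0
    · obtain rfl := R.injective (a₁ := t) (a₂ := v) (by rw [ht]; simp [linePt_zero])
      rw [boundaryType_eq_two h.boundaryType_left]
    rcases lt_or_eq_of_le hi with h1 | rfl
    · rw [boundaryType_eq_one (h.boundaryType_inner h0 h1 ht)]; omega
    · obtain rfl := R.injective (a₁ := t) (a₂ := u) (by rw [ht, h.pos_eq])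
      rw [boundaryType_eq_two h.boundaryType_right]
  have hinj : ∀ x y t, P x t → P y t → x = y := by
    rintro x y t (⟨hx, rfl⟩ | ⟨S, hS, a, ha, u, v, e, m, hr, hax, hti⟩)
      (⟨hy, h⟩ | ⟨S', hS', a', ha', u', v', e', m', hr', hax', hti'⟩)
    · exact h
    · have := hdeg hr' hti'; omega
    · subst h; have := hdeg hr hti; omega
    -- Two corner paths with a common point share an end-vertex `z`. It lies on one sequence of the
    -- system only, and there in one pair only.
    · obtain ⟨z, hz, hz'⟩ : ∃ z, (z = u ∨ z = v) ∧ (z = u' ∨ z = v') := by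
        rcases hr.eq_or_end hr' hti hti' with ⟨rfl, rfl⟩ | h
        · exact ⟨u, Or.inl rfl, Or.inl rfl⟩
        · exact ⟨t, h⟩
      have hz1 : z = a ∨ z = x := by
        rcases hax with ⟨rfl, rfl⟩ | ⟨rfl, rfl⟩
        · exact hz
        · exact hz.symm
      have hz2 : z = a' ∨ z = y := by
        rcases hax' with ⟨rfl, rfl⟩ | ⟨rfl, rfl⟩
        · exact hz'
        · exact hz'.symm
      have m1 := mem_of_mem_disjointPairs ha
      have m2 := mem_of_mem_disjointPairs ha'
      have hzS : z ∈ S := by rcases hz1 with rfl | rfl; exacts [m1.1, m1.2]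
      have hzS' : z ∈ S' := by rcases hz2 with rfl | rfl; exacts [m2.1, m2.2]
      obtain rfl := (h𝒮.2 z ((h𝒮.properties hS).2.1 z hzS)).unique ⟨hS, hzS⟩ ⟨hS', hzS'⟩
      exact disjointPairs_disjoint (h𝒮.properties hS).1 ha ha' hz1 hz2
  choose! φ hφ using hex
  refine Set.ncard_le_ncard_of_injOn φ (fun x hx => (hφ x hx).1) ?_ (Set.toFinite _)
  intro x hx y hy hxy
  exact hinj x y (φ x) (hφ x hx).2 (hxy ▸ (hφ y hy).2)

theorem IsSolid.isMinGeodeticSet_cornerSelection (hR : R.IsSolid) {𝒮 : Finset (List V)}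
    (h𝒮 : R.IsUnorientedCornerSystem 𝒮) : IsMinGeodeticSet G (cornerSelection G 𝒮) :=
  ⟨hR.isGeodeticSet Set.subset_union_left fun _ _ => hR.mem_cornerSelection_of_cornerStep h𝒮,
    fun _ => hR.ncard_le_of_isGeodeticSet h𝒮⟩

theorem IsSolid.ncard_cornerSelection (hR : R.IsSolid) {𝒮 : Finset (List V)}
    (h𝒮 : R.IsUnorientedCornerSystem 𝒮) :
    (cornerSelection G 𝒮).ncard = (lowDegreeVertices G).ncard + ∑ S ∈ 𝒮, S.length / 2 := by
  classical
  have hmem : ∀ {S v}, S ∈ 𝒮 → v ∈ everySecond S → v ∈ S ∧ R.IsCornerVertex v := by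
    intro S v hS hv
    have := (everySecond_sublist S).subset hv
    exact ⟨this, (h𝒮.properties hS).2.1 v this⟩
  rw [cornerSelection, Set.ncard_union_eq ?_ (Set.toFinite _) (Set.toFinite _)]
  · congr 1
    have : {v | ∃ S ∈ 𝒮, v ∈ everySecond S} =
        ((𝒮.biUnion fun S => (everySecond S).toFinset : Finset V) : Set V) := by
      ext v; simp
    rw [this, Set.ncard_coe_finset, Finset.card_biUnion]
    · refine Finset.sum_congr rfl fun S hS => ?_
      rw [List.toFinset_card_of_nodup ((h𝒮.properties hS).1.sublist (everySecond_sublist S)),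
        length_everySecond]
    · intro S hS S' hS' hne
      rw [Function.onFun, Finset.disjoint_left]
      intro v hv hv'
      rw [List.mem_toFinset] at hv hv'
      have h1 := hmem hS hv
      have h2 := hmem hS' hv'
      exact hne ((h𝒮.2 v h1.2).unique ⟨hS, h1.1⟩ ⟨hS', h2.1⟩)
  · rw [Set.disjoint_left]
    rintro v hv ⟨S, hS, hvS⟩
    have h1 := boundaryType_eq_two (hR.boundaryType_cornerVertex (hmem hS hvS).2)
    rw [lowDegreeVertices, Set.mem_ofPred_eq] at hv
    omega

theorem IsCornerSystem.unoriented {𝒮 : Finset (List V)} (h : R.IsCornerSystem 𝒮) :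
    R.IsUnorientedCornerSystem 𝒮 := ⟨fun S hS => Or.inl (h.1 S hS), h.2⟩

end GridEmbedding

/-! ### Chains of boundary vertices -/

section Chains

variable {V : Type*} [Fintype V] (G : SimpleGraph V)

/-- The ends of straight boundary pieces in a list. -/
noncomputable def cornersOf (l : List V) : List V := l.filter fun v => boundaryType G v = 2

/-- Pairwise disjoint lists, each of which enumerates a connected component of `BoundaryAdj` along
a path. -/
structure IsChainFamily (C : List (List V)) : Prop where
  nodup : C.flatten.Nodup
  chain : ∀ l ∈ C, l.IsChain (BoundaryAdj G)
  pos : ∀ l ∈ C, ∀ x ∈ l, 0 < boundaryType G x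
  closed : ∀ l ∈ C, ∀ x ∈ l, ∀ y, BoundaryAdj G x y → y ∈ l

variable {G}

theorem mem_cornersOf {l : List V} {v : V} :
    v ∈ cornersOf G l ↔ v ∈ l ∧ boundaryType G v = 2 := by simp [cornersOf]

theorem IsChainFamily.eq_of_mem {C : List (List V)} (h : IsChainFamily G C) {l l' : List V}
    (hl : l ∈ C) (hl' : l' ∈ C) {v : V} (hv : v ∈ l) (hv' : v ∈ l') : l = l' := by
  by_contra hne
  have hd := (List.nodup_flatten.1 h.nodup).2
  have : Std.Symm (List.Disjoint (α := V)) := ⟨fun _ _ h => h.symm⟩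
  exact (hd.forall hl hl' hne) hv hv'

/-- A path that cannot be continued at its end fills a component, provided that each vertex has at
most two neighbours, and that the first vertex has at most one or all vertices have two. -/
theorem closed_of_stuck {F : V → V → Prop} (hsymm : ∀ a b, F a b → F b a)
    (hirr : ∀ a b, F a b → a ≠ b)
    (htwo : ∀ v a b c, F v a → F v b → F v c → a = b ∨ a = c ∨ b = c) {x : ℕ → V} {m : ℕ}
    (hinj : ∀ i ≤ m, ∀ j ≤ m, x i = x j → i = j) (hF : ∀ i < m, F (x i) (x (i + 1)))
    (hlast : ∀ y, F (x m) y → ∃ i ≤ m, y = x i)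
    (hstart : (∀ y z, F (x 0) y → F (x 0) z → y = z) ∨
      ∀ i ≤ m, ∃ y z, y ≠ z ∧ F (x i) y ∧ F (x i) z) :
    ∀ i ≤ m, ∀ y, F (x i) y → ∃ j ≤ m, y = x j := by
  have hinner : ∀ i, 0 < i → i < m → ∀ y, F (x i) y → y = x (i - 1) ∨ y = x (i + 1) := by
    intro i h0 him y hy
    obtain ⟨i, rfl⟩ : ∃ k, i = k + 1 := ⟨i - 1, by omega⟩
    rcases htwo _ _ _ _ hy (hsymm _ _ (hF i (by omega))) (hF (i + 1) him) with h | h | h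
    · exact Or.inl h
    · exact Or.inr h
    · have := hinj i (by omega) (i + 1 + 1) (by omega) h
      omega
  intro i hi y hy
  rcases lt_or_eq_of_le hi with him | rfl
  swap
  · exact hlast y hy
  rcases Nat.eq_zero_or_pos i with rfl | h0
  swap
  · rcases hinner i h0 him y hy with h | h
    · exact ⟨_, by omega, h⟩
    · exact ⟨_, him, h⟩
  rcases hstart with hs | hs
  · exact ⟨1, him, hs _ _ hy (hF 0 him)⟩
  by_contra hno
  -- The last vertex has a second neighbour on the path. Inner vertices have no neighbour to spare,
  -- so this is `x 0`, the path closes to a cycle, and `x 0` has its two neighbours on it.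
  obtain ⟨z, hz, hzp⟩ : ∃ z, F (x m) z ∧ z ≠ x (m - 1) := by
    obtain ⟨a, b, hab, ha, hb⟩ := hs m le_rfl
    by_cases h : a = x (m - 1)
    · exact ⟨b, hb, fun h' => hab (h.trans h'.symm)⟩
    · exact ⟨a, ha, h⟩
  obtain ⟨j, hj, rfl⟩ := hlast z hz
  have hjm : j ≠ m - 1 := fun h => hzp (by rw [h])
  rcases Nat.eq_zero_or_pos j with rfl | hj0
  · rcases htwo _ _ _ _ hy (hF 0 him) (hsymm _ _ hz) with h | h | h
    · exact hno ⟨_, him, h⟩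
    · exact hno ⟨_, le_rfl, h⟩
    · have := hinj _ (by omega) _ le_rfl h
      omega
  rcases lt_or_eq_of_le hj with hjlt | rfl
  · rcases hinner j hj0 hjlt _ (hsymm _ _ hz) with h | h
    · have := hinj _ le_rfl _ (by omega) h; omega
    · have := hinj _ le_rfl _ (by omega) h; omega
  · exact hirr _ _ hz rfl

end Chains

/-! ### Components of `BoundaryAdj` and maximal corner sequences -/

namespace GridEmbedding

variable {V : Type*} [Fintype V] {G : SimpleGraph V} {R : GridEmbedding G}

/-- The clockwise boundary enters `v` from one position `i` and leaves to one position `o`. This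
gives both the degree bound and the orientation of `BoundaryAdj`. -/
theorem IsSolid.boundaryAdj_clockwise (hR : R.IsSolid) {v : V} (hv : 0 < boundaryType G v) :
    ∃ o i : ℤ × ℤ, ∀ a, BoundaryAdj G v a →
      (R.pos a = i ∧ R.IsClockwiseBoundary a v ∧ ¬ R.IsClockwiseBoundary v a) ∨
      (R.pos a = o ∧ R.IsClockwiseBoundary v a ∧ ¬ R.IsClockwiseBoundary a v) := by
  obtain ⟨e, he, ⟨h, -⟩ | ⟨h, -⟩⟩ := R.exists_of_boundaryType hv
  · exact ⟨R.pos v + rot e, R.pos v + e, fun a ha => (hR.cornerAt_adj he h ha.1).2⟩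
  · refine ⟨R.pos v + -e, R.pos v + e, fun a ha => ?_⟩
    rcases hR.railAt_adj he h ha.1 with h1 | h1
    · exact h1.2
    · exact absurd ha.2.1 h1.1

theorem IsSolid.boundaryAdj_two (hR : R.IsSolid) {v a b c : V} (ha : BoundaryAdj G v a)
    (hb : BoundaryAdj G v b) (hc : BoundaryAdj G v c) : a = b ∨ a = c ∨ b = c := by
  obtain ⟨o, i, h⟩ := hR.boundaryAdj_clockwise ha.2.2.1
  have key : ∀ {a b : V} {p : ℤ × ℤ}, R.pos a = p → R.pos b = p → a = b :=
    fun h h' => R.injective (h.trans h'.symm)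
  rcases h a ha with h1 | h1 <;> rcases h b hb with h2 | h2 <;> rcases h c hc with h3 | h3
  · exact Or.inl (key h1.1 h2.1)
  · exact Or.inl (key h1.1 h2.1)
  · exact Or.inr (Or.inl (key h1.1 h3.1))
  · exact Or.inr (Or.inr (key h2.1 h3.1))
  · exact Or.inr (Or.inr (key h2.1 h3.1))
  · exact Or.inr (Or.inl (key h1.1 h3.1))
  · exact Or.inl (key h1.1 h2.1)
  · exact Or.inl (key h1.1 h2.1)

/-- The boundary is followed in the same direction on both sides of a vertex. -/
theorem IsSolid.clockwise_next (hR : R.IsSolid) {x y z : V} (hx : BoundaryAdj G x y)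
    (hz : BoundaryAdj G y z) (hxz : x ≠ z) (h : R.IsClockwiseBoundary x y) :
    R.IsClockwiseBoundary y z := by
  obtain ⟨o, i, ho⟩ := hR.boundaryAdj_clockwise hx.2.2.2
  rcases ho x hx.symm with h1 | h1
  · rcases ho z hz with h2 | h2
    · exact absurd (R.injective (h1.1.trans h2.1.symm)) hxz
    · exact h2.2.1
  · exact absurd h h1.2.2

theorem IsSolid.clockwise_total (hR : R.IsSolid) {x y : V} (hx : BoundaryAdj G x y) :
    R.IsClockwiseBoundary x y ∨ R.IsClockwiseBoundary y x := by
  obtain ⟨o, i, ho⟩ := hR.boundaryAdj_clockwise hx.2.2.1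
  rcases ho y hx with h1 | h1
  · exact Or.inr h1.2.1
  · exact Or.inl h1.2.1

theorem IsSolid.isChain_clockwise (hR : R.IsSolid) (l : List V) : ∀ x y,
    (x :: y :: l).Nodup → (x :: y :: l).IsChain (BoundaryAdj G) → R.IsClockwiseBoundary x y →
      (x :: y :: l).IsChain R.IsClockwiseBoundary := by
  induction l with
  | nil => intro x y _ _ h; simpa using h
  | cons z l ih =>
    intro x y hn hc h
    rw [List.isChain_cons_cons] at hc ⊢
    refine ⟨h, ih y z (List.nodup_cons.1 hn).2 hc.2
      (hR.clockwise_next hc.1 (List.isChain_cons_cons.1 hc.2).1 ?_ h)⟩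
    rintro rfl
    simp at hn

/-- The orientation of the first edge propagates along the list. The list itself is found without
the embedding, so its direction is unknown. -/
theorem IsSolid.isChain_clockwise_or (hR : R.IsSolid) {l : List V} (hn : l.Nodup)
    (hc : l.IsChain (BoundaryAdj G)) :
    l.IsChain R.IsClockwiseBoundary ∨ l.reverse.IsChain R.IsClockwiseBoundary := by
  match l, hn, hc with
  | [], _, _ => simp
  | [x], _, _ => simp
  | x :: y :: l, hn, hc =>
    rcases hR.clockwise_total (List.isChain_cons_cons.1 hc).1 with h | h
    · exact Or.inl (hR.isChain_clockwise l x y hn hc h)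
    · right
      have key : ∀ (l : List V) (x y : V), (x :: y :: l).Nodup →
          (x :: y :: l).IsChain (BoundaryAdj G) → R.IsClockwiseBoundary y x →
          (x :: y :: l).IsChain (flip R.IsClockwiseBoundary) := by
        intro l
        induction l with
        | nil => intro x y _ _ h; simpa [flip] using h
        | cons z l ih =>
          intro x y hn hc h
          rw [List.isChain_cons_cons] at hc ⊢
          refine ⟨h, ih y z (List.nodup_cons.1 hn).2 hc.2 ?_⟩
          have hyz := (List.isChain_cons_cons.1 hc.2).1
          rcases hR.clockwise_total hyz with h' | h'
          · obtain ⟨o, i, ho⟩ := hR.boundaryAdj_clockwise hyz.2.2.1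
            exfalso
            have hxz : x ≠ z := by rintro rfl; simp at hn
            rcases ho x hc.1.symm with h1 | h1
            · exact h1.2.2 h
            · rcases ho z hyz with h2 | h2
              · exact h2.2.2 h'
              · exact hxz (R.injective (h1.1.trans h2.1.symm))
          · exact h'
      rw [List.isChain_reverse]
      exact key l x y hn hc h

/-- The stretch of the boundary between two consecutive corners is a corner path. -/
theorem cornerStep_of_list {c d : V} {r : List V} (hn : (c :: r ++ [d]).Nodup)
    (hc : (c :: r ++ [d]).IsChain R.IsClockwiseBoundary) (h1 : boundaryType G c = 2)
    (h2 : boundaryType G d = 2) (hr : ∀ x ∈ r, boundaryType G x = 1) : R.CornerStep c d := by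
  set L := c :: r ++ [d] with hL
  have hlen : L.length = r.length + 2 := by simp [hL]
  have hget : ∀ i (hi : i < L.length), L.getD i c = L[i] := fun i hi => by
    rw [List.getD_eq_getElem]
  have h0 : L.getD 0 c = c := by simp [hL]
  have hm : L.getD (r.length + 1) c = d := by simp [hL]
  have hmid : ∀ i, 0 < i → i < r.length + 1 → L.getD i c ∈ r := by
    intro i h0 hi
    obtain ⟨i, rfl⟩ : ∃ k, i = k + 1 := ⟨i - 1, by omega⟩
    have hi' : i < r.length := by omega
    have : L.getD (i + 1) c = r[i] := by
      simp [hL, List.getElem?_append_left hi', hi']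
    rw [this]
    exact List.getElem_mem _
  have := R.cornerStep_of_seq (x := fun i => L.getD i c) (m := r.length + 1) (by omega) ?_ ?_ ?_ ?_ ?_
  · simpa only [h0, hm] using this
  · intro i hi j hj hij
    simp only [hget i (by omega), hget j (by omega)] at hij
    exact (hn.getElem_inj_iff).1 hij
  · intro i hi
    simp only [hget i (by omega), hget (i + 1) (by omega)]
    exact List.isChain_iff_getElem.1 hc i (by omega)
  · simpa only [h0] using h1
  · simpa only [hm] using h2
  · intro i h0 hi
    exact hr _ (hmid i h0 hi)

/-- `c` is the latest corner, and `r` collects the straight boundary vertices after it until the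
next corner completes a corner path. -/
theorem isChain_cornersOf_cons (m : List V) : ∀ (r : List V) (c : V), (c :: r ++ m).Nodup →
    (c :: r ++ m).IsChain R.IsClockwiseBoundary → boundaryType G c = 2 →
    (∀ x ∈ r, boundaryType G x = 1) → (∀ x ∈ m, 0 < boundaryType G x) →
    (c :: cornersOf G m).IsChain R.CornerStep := by
  induction m with
  | nil => intro r c _ _ _ _ _; simp [cornersOf]
  | cons y m ih =>
    intro r c hn hc h2 hr hm
    by_cases hy : boundaryType G y = 2
    · have e : cornersOf G (y :: m) = y :: cornersOf G m := by simp [cornersOf, hy]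
      have e2 : c :: r ++ y :: m = (c :: r ++ [y]) ++ m := by simp
      rw [e, List.isChain_cons_cons]
      constructor
      · rw [e2] at hn hc
        exact cornerStep_of_list (List.nodup_append.1 hn).1 (List.isChain_append.1 hc).1 h2 hy hr
      · exact ih [] y (List.nodup_append.1 hn).2.1 (List.isChain_append.1 hc).2.1 hy (by simp)
          fun x hx => hm x (List.mem_cons_of_mem _ hx)
    · have e : cornersOf G (y :: m) = cornersOf G m := by simp [cornersOf, hy]
      have e2 : c :: r ++ y :: m = c :: (r ++ [y]) ++ m := by simp
      have hy1 : boundaryType G y = 1 := by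
        have := hm y List.mem_cons_self
        rw [boundaryType] at *
        split_ifs at * <;> omega
      rw [e]
      rw [e2] at hn hc
      refine ih (r ++ [y]) c hn hc h2 ?_ fun x hx => hm x (List.mem_cons_of_mem _ hx)
      intro x hx
      rw [List.mem_append, List.mem_singleton] at hx
      rcases hx with hx | rfl
      · exact hr x hx
      · exact hy1

theorem isChain_cornersOf (m : List V) (hn : m.Nodup) (hc : m.IsChain R.IsClockwiseBoundary)
    (hm : ∀ x ∈ m, 0 < boundaryType G x) : (cornersOf G m).IsChain R.CornerStep := by
  induction m with
  | nil => simp [cornersOf]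
  | cons y m ih =>
    by_cases hy : boundaryType G y = 2
    · have e : cornersOf G (y :: m) = y :: cornersOf G m := by simp [cornersOf, hy]
      rw [e]
      exact isChain_cornersOf_cons m [] y hn hc hy (by simp)
        fun x hx => hm x (List.mem_cons_of_mem _ hx)
    · have e : cornersOf G (y :: m) = cornersOf G m := by simp [cornersOf, hy]
      rw [e]
      exact ih (List.nodup_cons.1 hn).2 (List.isChain_cons.1 hc).2
        fun x hx => hm x (List.mem_cons_of_mem _ hx)

/-- Consecutive vertices of a corner path are related by `BoundaryAdj`, so the path stays in one
component. -/
theorem IsSolid.mem_iff_of_cornerStep (hR : R.IsSolid) {s : Set V}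
    (hs : ∀ x ∈ s, ∀ y, BoundaryAdj G x y → y ∈ s) {u v : V} (h : R.CornerStep u v) :
    u ∈ s ↔ v ∈ s := by
  obtain ⟨e, m, h⟩ := hR.exists_cornerRail h
  obtain ⟨x, hx, hx0, hxm⟩ := h.exists_vertices
  have key : ∀ i ≤ m, (x 0 ∈ s ↔ x i ∈ s) := by
    intro i
    induction i with
    | zero => simp
    | succ i ih =>
      intro hi
      rw [ih (by omega)]
      have := (h.boundaryAdj hR (i := i) (by omega) (hx i (by omega))
        (by rw [hx (i + 1) hi]; push_cast; rfl)).1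
      exact ⟨fun hxi => hs _ hxi _ this.symm, fun hxi => hs _ hxi _ this⟩
  rw [← hx0, ← hxm, key m le_rfl]

theorem isCornerVertex_of_mem_chain {L : List V} (hc : L.IsChain R.CornerStep)
    (hlen : 2 ≤ L.length) : ∀ v ∈ L, R.IsCornerVertex v := by
  intro v hv
  obtain ⟨l₁, l₂, rfl⟩ := List.append_of_mem hv
  cases l₂ with
  | cons w l₂ =>
    rw [List.isChain_append] at hc
    exact ⟨w, Or.inr (List.isChain_cons_cons.1 hc.2.1).1⟩
  | nil =>
    rcases List.eq_nil_or_concat l₁ with rfl | ⟨l₁, x, rfl⟩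
    · simp at hlen
    · rw [List.concat_eq_append, List.append_assoc, List.singleton_append,
        List.isChain_append] at hc
      exact ⟨x, Or.inl (List.isChain_cons_cons.1 hc.2.1).1⟩

/-- An extension would start or end with a corner path at a corner of the component; its other end
belongs to the component too and would be repeated. A lone corner need not be a corner vertex,
whence the bound on the length. -/
theorem IsSolid.isMaxCornerSeq_cornersOf (hR : R.IsSolid) {m : List V} (hn : m.Nodup)
    (hc : m.IsChain R.IsClockwiseBoundary) (hm : ∀ x ∈ m, 0 < boundaryType G x)
    (hcl : ∀ x ∈ m, ∀ y, BoundaryAdj G x y → y ∈ m) (hlen : 2 ≤ (cornersOf G m).length) :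
    R.IsMaxCornerSeq (cornersOf G m) := by
  have hch := isChain_cornersOf m hn hc hm
  have hstep : ∀ {u v}, R.CornerStep u v → (u ∈ cornersOf G m ↔ v ∈ cornersOf G m) := by
    intro u v h
    have h1 := hR.boundaryType_cornerVertex ⟨v, Or.inr h⟩
    have h2 := hR.boundaryType_cornerVertex ⟨u, Or.inl h⟩
    have := hR.mem_iff_of_cornerStep (s := {x | x ∈ m}) hcl h
    simp only [Set.mem_ofPred_eq] at this
    simp only [mem_cornersOf, h1, h2, this]
  refine ⟨⟨?_, hn.filter _, isCornerVertex_of_mem_chain hch hlen, hch⟩, ?_⟩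
  · intro h; rw [h] at hlen; simp at hlen
  · rintro T ⟨hT0, hTn, -, hTc⟩ ⟨s, t, hT⟩
    have hs : s = [] := by
      rcases List.eq_nil_or_concat s with rfl | ⟨s, x, rfl⟩
      · rfl
      exfalso
      obtain ⟨c, L, hL⟩ : ∃ c L, cornersOf G m = c :: L :=
        List.exists_cons_of_length_pos (by omega)
      rw [← hT, hL, List.concat_eq_append] at hTc
      rw [← hT, List.concat_eq_append] at hTn
      have h1 : R.CornerStep x c := by
        have e : s ++ [x] ++ c :: L ++ t = s ++ x :: c :: (L ++ t) := by simp
        rw [e, List.isChain_append] at hTc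
        exact (List.isChain_cons_cons.1 hTc.2.1).1
      have h2 : x ∈ cornersOf G m := (hstep h1).2 (by rw [hL]; simp)
      have := List.nodup_append.1 (List.nodup_append.1 hTn).1
      exact this.2.2 x (by simp) x h2 rfl
    have ht : t = [] := by
      subst hs
      rcases t with - | ⟨x, t⟩
      · rfl
      exfalso
      rcases List.eq_nil_or_concat (cornersOf G m) with h | ⟨L, c, hL⟩
      · rw [h] at hlen; simp at hlen
      rw [← hT, hL, List.concat_eq_append] at hTc
      rw [← hT] at hTn
      have h1 : R.CornerStep c x := by
        have e : [] ++ (L ++ [c]) ++ x :: t = L ++ c :: x :: t := by simp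
        rw [e, List.isChain_append] at hTc
        exact (List.isChain_cons_cons.1 hTc.2.1).1
      have h2 : x ∈ cornersOf G m := (hstep h1).1 (by rw [hL]; simp)
      exact (List.nodup_append.1 hTn).2.2 x (by simpa using h2) x (by simp) rfl
    rw [← hT, hs, ht]; simp

/-- The corners of the components of `BoundaryAdj` form a system of maximal corner sequences. -/
theorem IsSolid.exists_cornerSystem (hR : R.IsSolid) {C : List (List V)} (hC : IsChainFamily G C)
    (hcov : ∀ v, 0 < boundaryType G v → ∃ l ∈ C, v ∈ l) :
    ∃ 𝒮 : Finset (List V), R.IsUnorientedCornerSystem 𝒮 ∧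
      cornerSelection G 𝒮 =
        lowDegreeVertices G ∪ {v | ∃ l ∈ C, v ∈ everySecond (cornersOf G l)} := by
  classical
  -- Components with fewer than two corners carry no corner path, and `everySecond` selects nothing
  -- from them.
  refine ⟨((C.map (cornersOf G)).filter fun S => 2 ≤ S.length).toFinset, ⟨?_, ?_⟩, ?_⟩
  · intro S hS
    simp only [List.mem_toFinset, List.mem_filter, List.mem_map, decide_eq_true_eq] at hS
    obtain ⟨⟨l, hl, rfl⟩, hlen⟩ := hS
    have hn := (List.nodup_flatten.1 hC.nodup).1 l hl
    rcases hR.isChain_clockwise_or hn (hC.chain l hl) with h | h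
    · exact Or.inl (hR.isMaxCornerSeq_cornersOf hn h (hC.pos l hl) (hC.closed l hl) hlen)
    · right
      have e : (cornersOf G l).reverse = cornersOf G l.reverse := by
        simp [cornersOf, List.filter_reverse]
      rw [e]
      refine hR.isMaxCornerSeq_cornersOf (List.nodup_reverse.2 hn) h ?_ ?_ ?_
      · simpa using hC.pos l hl
      · simpa using hC.closed l hl
      · rw [← e]; simpa using hlen
  · intro v hv
    have hv2 := hR.boundaryType_cornerVertex hv
    obtain ⟨l, hl, hvl⟩ := hcov v (by omega)
    have hmem : v ∈ cornersOf G l := mem_cornersOf.2 ⟨hvl, hv2⟩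
    obtain ⟨u, hul, huv⟩ : ∃ u ∈ cornersOf G l, u ≠ v := by
      obtain ⟨u, hu | hu⟩ := hv
      · refine ⟨u, mem_cornersOf.2 ⟨?_, hR.boundaryType_cornerVertex ⟨v, Or.inr hu⟩⟩, hu.ne⟩
        exact (hR.mem_iff_of_cornerStep (s := {x | x ∈ l}) (hC.closed l hl) hu).2 hvl
      · refine ⟨u, mem_cornersOf.2 ⟨?_, hR.boundaryType_cornerVertex ⟨v, Or.inl hu⟩⟩, (CornerStep.ne hu).symm⟩
        exact (hR.mem_iff_of_cornerStep (s := {x | x ∈ l}) (hC.closed l hl) hu).1 hvl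
    have hlen : 2 ≤ (cornersOf G l).length := by
      by_contra hc
      have h1 : (cornersOf G l).length = 1 := by
        have := List.length_pos_of_mem hmem
        omega
      obtain ⟨z, hz⟩ := List.length_eq_one_iff.1 h1
      rw [hz, List.mem_singleton] at hmem hul
      exact huv (hul.trans hmem.symm)
    refine ⟨cornersOf G l, ⟨?_, hmem⟩, ?_⟩
    · simp only [List.mem_toFinset, List.mem_filter, List.mem_map, decide_eq_true_eq]
      exact ⟨⟨l, hl, rfl⟩, hlen⟩
    · rintro S ⟨hS, hvS⟩
      simp only [List.mem_toFinset, List.mem_filter, List.mem_map, decide_eq_true_eq] at hS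
      obtain ⟨⟨l', hl', rfl⟩, -⟩ := hS
      rw [hC.eq_of_mem hl hl' hvl (mem_cornersOf.1 hvS).1]
  · rw [cornerSelection]
    congr 1
    ext v
    simp only [List.mem_toFinset, List.mem_filter, List.mem_map, decide_eq_true_eq,
      Set.mem_ofPred_eq]
    constructor
    · rintro ⟨S, ⟨⟨l, hl, rfl⟩, -⟩, hv⟩
      exact ⟨l, hl, hv⟩
    · rintro ⟨l, hl, hv⟩
      refine ⟨_, ⟨⟨l, hl, rfl⟩, ?_⟩, hv⟩
      have h1 := List.length_pos_of_mem hv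
      rw [length_everySecond] at h1
      omega

end GridEmbedding

/-! ### Arithmetic expressions of the random access machine -/

/-- Arithmetic expressions over named variables. The last one is the sum of `e` over all values of
the variable `y` that are neighbours of `x`. -/
inductive RamExpr where
  | var (x : ℕ)
  | const (k : ℕ)
  | add (e f : RamExpr)
  | sub (e f : RamExpr)
  | load (a : ℕ) (e : RamExpr)
  | ifLt (e f g h : RamExpr)
  | sum (x y : ℕ) (e : RamExpr)

namespace RamExpr

/-- The value of an expression, for the neighbour lists `A` and the array contents `M`. -/
def eval (A : ℕ → List ℕ) (M : ℕ → ℕ → ℕ) : RamExpr → (ℕ → ℕ) → ℕ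
  | var x, ρ => ρ x
  | const k, _ => k
  | add e f, ρ => e.eval A M ρ + f.eval A M ρ
  | sub e f, ρ => e.eval A M ρ - f.eval A M ρ
  | load a e, ρ => M a (e.eval A M ρ)
  | ifLt e f g h, ρ => if e.eval A M ρ < f.eval A M ρ then g.eval A M ρ else h.eval A M ρ
  | sum x y e, ρ => ((A (ρ x)).map fun a => e.eval A M (Function.update ρ y a)).sum

/-- A program that leaves the value of the expression in register `r` and changes no register
below `r`. The variable `x` is kept in register `m x`. -/
def compile : RamExpr → (ℕ → ℕ) → ℕ → RamProg
  | var x, m, r => .copy r (m x)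
  | const k, _, r => .const r k
  | add e f, m, r => .seq (e.compile m r) (.seq (f.compile m (r + 1)) (.add r r (r + 1)))
  | sub e f, m, r => .seq (e.compile m r) (.seq (f.compile m (r + 1)) (.sub r r (r + 1)))
  | load a e, m, r => .seq (e.compile m r) (.load r a r)
  | ifLt e f g h, m, r => .seq (e.compile m r) (.seq (f.compile m (r + 1))
      (.ifLt r (r + 1) (g.compile m r) (h.compile m r)))
  -- Register `r` accumulates the sum, `r + 1` and `r + 2` hold the current and the final position
  -- in array 1, `r + 3` holds the neighbour bound to `y`, and the body works from `r + 4` on.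
  | sum x y e, m, r => .seq (.const r 0) (.seq (.load (r + 1) 0 (m x)) (.seq (.const (r + 2) 1)
      (.seq (.add (r + 2) (m x) (r + 2)) (.seq (.load (r + 2) 0 (r + 2))
        (.whileLt (r + 1) (r + 2) (.seq (.load (r + 3) 1 (r + 1))
          (.seq (e.compile (Function.update m y (r + 3)) (r + 4)) (.seq (.add r r (r + 4))
            (.seq (.const (r + 4) 1) (.add (r + 1) (r + 1) (r + 4)))))))))))

/-- A bound for the running time, if all neighbour lists have length at most 4. -/
def cost : RamExpr → ℕ
  | var _ => 1
  | const _ => 1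
  | add e f => e.cost + f.cost + 1
  | sub e f => e.cost + f.cost + 1
  | load _ e => e.cost + 1
  | ifLt e f g h => e.cost + f.cost + g.cost + h.cost + 1
  -- Four instructions and a test per iteration besides the body; five instructions before the loop
  -- and the final test.
  | sum _ _ e => 4 * (e.cost + 5) + 6

/-- A bound for all intermediate results, in multiples of a bound for the variables. -/
def size : RamExpr → ℕ
  | var _ => 1
  | const k => k
  | add e f => e.size + f.size
  | sub e f => e.size + f.size
  -- Array entries are bounded by four times the bound for the variables, because offsets are sums
  -- of at most `n` degrees.
  | load _ e => e.size + 4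
  | ifLt e f g h => e.size + f.size + g.size + h.size
  | sum _ _ e => 4 * e.size + 8

end RamExpr

/-- The program `p` stops when started in `s`, and `Q` holds for the number of steps and the final
state. -/
def RamProg.Spec (W : ℕ) (p : RamProg) (s : RamState) (Q : ℕ → RamState → Prop) : Prop :=
  ∃ k t, p.Runs W s k t ∧ Q k t

/-! ### Rules for reasoning about programs, with postconditions as continuations -/

namespace RamProg

variable {W : ℕ} {s : RamState} {Q : ℕ → RamState → Prop}

theorem Spec.mono {p : RamProg} {Q' : ℕ → RamState → Prop} (h : p.Spec W s Q)
    (hQ : ∀ k t, Q k t → Q' k t) : p.Spec W s Q' := by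
  obtain ⟨k, t, h1, h2⟩ := h
  exact ⟨k, t, h1, hQ k t h2⟩

theorem Spec.seq {p q : RamProg}
    (h : p.Spec W s fun k t => q.Spec W t fun l r => Q (k + l) r) : (p.seq q).Spec W s Q := by
  obtain ⟨k, t, h1, l, r, h2, h3⟩ := h
  exact ⟨_, _, .seq h1 h2, h3⟩

theorem Spec.skip (h : Q 1 s) : RamProg.skip.Spec W s Q := ⟨_, _, .skip s, h⟩

theorem Spec.const {x k : ℕ} (hk : k ≤ W) (h : Q 1 (s.setReg x k)) :
    (RamProg.const x k).Spec W s Q := ⟨_, _, .const s x k hk, h⟩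

theorem Spec.copy {x y : ℕ} (hk : s.reg y ≤ W) (h : Q 1 (s.setReg x (s.reg y))) :
    (RamProg.copy x y).Spec W s Q := ⟨_, _, .copy s x y hk, h⟩

theorem Spec.add {x y z : ℕ} (hk : s.reg y + s.reg z ≤ W)
    (h : Q 1 (s.setReg x (s.reg y + s.reg z))) :
    (RamProg.add x y z).Spec W s Q := ⟨_, _, .add s x y z hk, h⟩

theorem Spec.sub {x y z : ℕ} (hk : s.reg y - s.reg z ≤ W)
    (h : Q 1 (s.setReg x (s.reg y - s.reg z))) :
    (RamProg.sub x y z).Spec W s Q := ⟨_, _, .sub s x y z hk, h⟩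

theorem Spec.load {x a y : ℕ} (hk : s.arr a (s.reg y) ≤ W)
    (h : Q 1 (s.setReg x (s.arr a (s.reg y)))) :
    (RamProg.load x a y).Spec W s Q := ⟨_, _, .load s x a y hk, h⟩

theorem Spec.store {a x y : ℕ} (hk : s.reg y ≤ W)
    (h : Q 1 (s.setArr a (s.reg x) (s.reg y))) :
    (RamProg.store a x y).Spec W s Q := ⟨_, _, .store s a x y hk, h⟩

theorem Spec.ifLt {x y : ℕ} {p q : RamProg}
    (h1 : s.reg x < s.reg y → p.Spec W s fun k t => Q (k + 1) t)
    (h2 : ¬ s.reg x < s.reg y → q.Spec W s fun k t => Q (k + 1) t) :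
    (RamProg.ifLt x y p q).Spec W s Q := by
  by_cases h : s.reg x < s.reg y
  · obtain ⟨k, t, h3, h4⟩ := h1 h
    exact ⟨_, _, .ifTrue h h3, h4⟩
  · obtain ⟨k, t, h3, h4⟩ := h2 h
    exact ⟨_, _, .ifFalse h h3, h4⟩

/-- The rule for loops, with a budget `b` from which each iteration pays its steps. -/
theorem Spec.whileLt {x y : ℕ} {p : RamProg} (I : ℕ → RamState → Prop)
    (h : ∀ b s, I b s → s.reg x < s.reg y →
      p.Spec W s fun k t => ∃ b', k + 1 + b' ≤ b ∧ I b' t) :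
    ∀ b s, I b s → (RamProg.whileLt x y p).Spec W s fun k t =>
      ¬ t.reg x < t.reg y ∧ ∃ b', k + b' ≤ b + 1 ∧ I b' t := by
  intro b
  induction b using Nat.strong_induction_on with
  | _ b ih =>
    intro s hs
    by_cases hxy : s.reg x < s.reg y
    · obtain ⟨k, t, h1, b', h2, h3⟩ := h b s hs hxy
      obtain ⟨l, r, h4, h5, b'', h6, h7⟩ := ih b' (by omega) t h3
      exact ⟨_, _, .whileTrue hxy h1 h4, h5, b'', by omega, h7⟩
    · exact ⟨_, _, .whileFalse hxy, hxy, b, by omega, hs⟩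

end RamProg

namespace RamState

@[simp] theorem setReg_arr (s : RamState) (x v : ℕ) : (s.setReg x v).arr = s.arr := rfl

@[simp] theorem setReg_reg (s : RamState) (x v y : ℕ) :
    (s.setReg x v).reg y = if y = x then v else s.reg y := by
  simp [setReg, Function.update_apply]

@[simp] theorem setArr_reg (s : RamState) (a x v : ℕ) : (s.setArr a x v).reg = s.reg := rfl

@[simp] theorem setArr_arr (s : RamState) (a x v b y : ℕ) :
    (s.setArr a x v).arr b y = if b = a ∧ y = x then v else s.arr b y := by
  by_cases h : b = a
  · subst h; simp [setArr, Function.update_apply]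
  · simp [setArr, h]

end RamState

/-- The adjacency lists `A` are stored in the arrays 0 and 1, and `N` bounds all words. -/
structure StoresLists (A : ℕ → List ℕ) (N : ℕ) (M : ℕ → ℕ → ℕ) : Prop where
  pos : 0 < N
  length_le : ∀ x, (A x).length ≤ 4
  lt : ∀ x, ∀ a ∈ A x, a ≤ N
  le : ∀ a i, M a i ≤ 4 * N
  -- The first alternative covers numbers that are no vertices: the loop over the list must not
  -- start there.
  window : ∀ x, (A x = [] ∧ M 0 (x + 1) ≤ M 0 x) ∨ (M 0 (x + 1) = M 0 x + (A x).length ∧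
    ∀ i (h : i < (A x).length), M 1 (M 0 x + i) = (A x)[i])

/-! ### Correctness and cost of compiled expressions -/

namespace RamExpr

variable {A : ℕ → List ℕ} {N W : ℕ} {M : ℕ → ℕ → ℕ}

theorem eval_le (hM : StoresLists A N M) (e : RamExpr) :
    ∀ ρ, (∀ j, ρ j ≤ N) → e.eval A M ρ ≤ e.size * N := by
  have hN := hM.pos
  induction e with
  | var x => intro ρ h; simpa [eval, size] using h x
  | const k => intro ρ h; simpa [eval, size] using Nat.le_mul_of_pos_right k hN
  | add e f he hf => intro ρ h; simp only [eval, size, add_mul]; exact add_le_add (he ρ h) (hf ρ h)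
  | sub e f he hf =>
    intro ρ h
    have := he ρ h
    simp only [eval, size, add_mul]; omega
  | load a e he =>
    intro ρ h
    have := hM.le a (e.eval A M ρ)
    simp only [eval, size, add_mul]; omega
  | ifLt e f g h he hf hg hh =>
    intro ρ hρ
    have := hg ρ hρ
    have := hh ρ hρ
    simp only [eval, size, add_mul]
    split_ifs <;> omega
  | sum x y e he =>
    intro ρ hρ
    simp only [eval, size]
    have h1 : ((A (ρ x)).map fun a => e.eval A M (Function.update ρ y a)).sum ≤
        (A (ρ x)).length • (e.size * N) := by
      rw [← List.length_map (as := A (ρ x)) (fun a => e.eval A M (Function.update ρ y a))]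
      refine List.sum_le_card_nsmul _ _ fun z hz => ?_
      obtain ⟨a, ha, rfl⟩ := List.mem_map.1 hz
      refine he _ fun j => ?_
      rw [Function.update_apply]
      split_ifs
      · exact hM.lt _ _ ha
      · exact hρ j
    have h2 := hM.length_le (ρ x)
    rw [smul_eq_mul] at h1
    nlinarith [Nat.mul_le_mul_right (e.size * N) h2]

/-- Induction on the part `l` of the neighbour list that is still to be read. The hypothesis `he` on
the body is needed for all register maps, as the body runs with `y` moved to `r + 3`. -/
theorem compile_sum_loop {e : RamExpr} (hM : StoresLists A N M) {m : ℕ → ℕ} {y r : ℕ}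
    (hm : ∀ j, m j < r) {ρ : ℕ → ℕ} (hρ : ∀ j, ρ j ≤ N) (hW : (4 * e.size + 8) * N ≤ W)
    (he : ∀ (m : ℕ → ℕ) (r : ℕ) (ρ : ℕ → ℕ) (s : RamState), (∀ j, m j < r) →
      (∀ j, s.reg (m j) = ρ j) → (∀ j, ρ j ≤ N) → s.arr = M →
      (e.compile m r).Spec W s fun k t => k ≤ e.cost ∧ t.arr = M ∧ (∀ x < r, t.reg x = s.reg x) ∧
        t.reg r = e.eval A M ρ) (l : List ℕ) :
    ∀ s : RamState, (∀ j, s.reg (m j) = ρ j) → s.arr = M →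
      s.reg r + l.length * (e.size * N) ≤ W → (∀ a ∈ l, a ≤ N) →
      s.reg (r + 1) + l.length ≤ 4 * N →
      s.reg (r + 2) = s.reg (r + 1) + l.length →
      (∀ i (h : i < l.length), M 1 (s.reg (r + 1) + i) = l[i]) →
      (RamProg.whileLt (r + 1) (r + 2) (.seq (.load (r + 3) 1 (r + 1))
          (.seq (e.compile (Function.update m y (r + 3)) (r + 4)) (.seq (.add r r (r + 4))
            (.seq (.const (r + 4) 1) (.add (r + 1) (r + 1) (r + 4))))))).Spec W s fun k t =>
        k ≤ l.length * (e.cost + 5) + 1 ∧ t.arr = M ∧ (∀ x < r, t.reg x = s.reg x) ∧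
          t.reg r = s.reg r + (l.map fun a => e.eval A M (Function.update ρ y a)).sum := by
  have hN := hM.pos
  induction l with
  | nil =>
    intro s _ hs _ _ _ h2 _
    exact ⟨1, s, .whileFalse (by simp [h2]), by simp [hs]⟩
  | cons a l ih =>
    intro s hreg hs hacc hl h1 h2 hget
    simp only [List.length_cons] at hacc h1 h2
    have ha := hl a List.mem_cons_self
    have hb := eval_le hM e (Function.update ρ y a) fun j => by
      rw [Function.update_apply]; split_ifs
      · exact ha
      · exact hρ j
    have h8 : 8 * N ≤ W := le_trans (by gcongr; omega) hW
    have hga : M 1 (s.reg (r + 1)) = a := hget 0 (by simp)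
    obtain ⟨k, t, hrun, hk, ht, htr, hte⟩ := he (Function.update m y (r + 3)) (r + 4)
      (Function.update ρ y a) (s.setReg (r + 3) a) (by
        intro j; rw [Function.update_apply]; split_ifs
        · omega
        · have := hm j; omega) (by
        intro j
        simp only [Function.update_apply]
        split_ifs with hj
        · simp
        · have := hm j
          rw [RamState.setReg_reg, if_neg (by omega), hreg]) (by
        intro j; rw [Function.update_apply]; split_ifs
        · exact ha
        · exact hρ j) hs
    have e0 : t.reg r = s.reg r := by rw [htr r (by omega)]; simp
    have e1 : t.reg (r + 1) = s.reg (r + 1) := by rw [htr _ (by omega)]; simp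
    have e2 : t.reg (r + 2) = s.reg (r + 2) := by rw [htr _ (by omega)]; simp
    have er : ∀ x < r, t.reg x = s.reg x := fun x hx => by
      rw [htr x (by omega), RamState.setReg_reg, if_neg (by omega)]
    rw [add_mul, one_mul] at hacc
    obtain ⟨k', t', hrun', hk', ht', htr', hte'⟩ := ih
      (((t.setReg r (t.reg r + t.reg (r + 4))).setReg (r + 4) 1).setReg (r + 1)
        (t.reg (r + 1) + 1)) (by
          intro j
          have := hm j
          simp only [RamState.setReg_reg]
          rw [if_neg (by omega), if_neg (by omega), if_neg (by omega), er _ this, hreg]) ht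
      (by simp [e0, hte]; omega) (fun b hb => hl b (List.mem_cons_of_mem _ hb))
      (by simp [e1]; omega) (by simp [e1, e2, h2]; omega) (by
        intro i hi
        have := hget (i + 1) (by simpa using hi)
        simp only [List.getElem_cons_succ] at this
        rw [← this]
        congr 1
        simp [e1]; omega)
    have hlast : (RamProg.add (r + 1) (r + 1) (r + 4)).Runs W
        ((t.setReg r (t.reg r + t.reg (r + 4))).setReg (r + 4) 1) 1
        (((t.setReg r (t.reg r + t.reg (r + 4))).setReg (r + 4) 1).setReg (r + 1)
          (t.reg (r + 1) + 1)) := by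
      have := RamProg.Runs.add (W := W) ((t.setReg r (t.reg r + t.reg (r + 4))).setReg (r + 4) 1)
        (r + 1) (r + 1) (r + 4) (by simp [e1]; omega)
      simpa using this
    have hload := RamProg.Runs.load (W := W) s (r + 3) 1 (r + 1) (by rw [hs, hga]; omega)
    rw [hs, hga] at hload
    refine ⟨_, t', .whileTrue (by omega) (.seq hload (.seq hrun (.seq
      (.add _ _ _ _ (by rw [e0, hte]; omega)) (.seq (.const _ _ _ (by omega)) hlast)))) hrun',
      ?_, ht', ?_, ?_⟩
    · simp only [List.length_cons, add_mul, one_mul]; omega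
    · intro x hx
      rw [htr' x hx]
      simp only [RamState.setReg_reg]
      rw [if_neg (by omega), if_neg (by omega), if_neg (by omega), er x hx]
    · rw [hte']
      simp [e0, hte, add_assoc]

/-- Variables live below `r`, and a second operand is computed from `r + 1` on, so neither the
variables nor the first operand are overwritten. -/
theorem compile_spec (hM : StoresLists A N M) (e : RamExpr) (hW : e.size * N ≤ W) :
    ∀ (m : ℕ → ℕ) (r : ℕ) (ρ : ℕ → ℕ) (s : RamState), (∀ j, m j < r) →
      (∀ j, s.reg (m j) = ρ j) → (∀ j, ρ j ≤ N) → s.arr = M →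
      (e.compile m r).Spec W s fun k t => k ≤ e.cost ∧ t.arr = M ∧ (∀ x < r, t.reg x = s.reg x) ∧
        t.reg r = e.eval A M ρ := by
  have hN := hM.pos
  have step : ∀ {m : ℕ → ℕ} {r : ℕ} {ρ : ℕ → ℕ} {s t : RamState}, (∀ j, m j < r) →
      (∀ j, s.reg (m j) = ρ j) → (∀ x < r, t.reg x = s.reg x) → ∀ j, t.reg (m j) = ρ j :=
    fun hm hs ht j => by rw [ht _ (hm j), hs]
  induction e with
  | var x =>
    intro m r ρ s hm hreg hρ hs
    have := hρ x
    simp only [size, one_mul] at hW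
    refine .copy (by rw [hreg]; omega) ⟨le_rfl, hs, fun z hz => ?_, ?_⟩
    · rw [RamState.setReg_reg, if_neg (by omega)]
    · simp [eval, hreg]
  | const k =>
    intro m r ρ s hm hreg hρ hs
    have : k ≤ k * N := Nat.le_mul_of_pos_right k hN
    refine .const (this.trans hW) ⟨le_rfl, hs, fun z hz => ?_, ?_⟩
    · rw [RamState.setReg_reg, if_neg (by omega)]
    · simp [eval]
  | add e f he hf =>
    intro m r ρ s hm hreg hρ hs
    simp only [size, add_mul] at hW
    have be := eval_le hM e ρ hρ
    have bf := eval_le hM f ρ hρ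
    refine .seq ((he (by omega) m r ρ s hm hreg hρ hs).mono ?_)
    rintro k t ⟨h1, h2, h3, h4⟩
    refine .seq ((hf (by omega) m (r + 1) ρ t (fun j => (hm j).trans (by omega))
      (step hm hreg h3) hρ h2).mono ?_)
    rintro k' t' ⟨h1', h2', h3', h4'⟩
    refine .add (by rw [h3' r (by omega), h4, h4']; omega) ⟨by simp only [cost]; omega, h2', ?_, ?_⟩
    · intro z hz
      rw [RamState.setReg_reg, if_neg (by omega), h3' _ (by omega), h3 z hz]
    · simp [eval, h4', h3' r (by omega), h4]
  | sub e f he hf =>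
    intro m r ρ s hm hreg hρ hs
    simp only [size, add_mul] at hW
    have be := eval_le hM e ρ hρ
    refine .seq ((he (by omega) m r ρ s hm hreg hρ hs).mono ?_)
    rintro k t ⟨h1, h2, h3, h4⟩
    refine .seq ((hf (by omega) m (r + 1) ρ t (fun j => (hm j).trans (by omega))
      (step hm hreg h3) hρ h2).mono ?_)
    rintro k' t' ⟨h1', h2', h3', h4'⟩
    refine .sub (by rw [h3' r (by omega), h4, h4']; omega) ⟨by simp only [cost]; omega, h2', ?_, ?_⟩
    · intro z hz
      rw [RamState.setReg_reg, if_neg (by omega), h3' _ (by omega), h3 z hz]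
    · simp [eval, h4', h3' r (by omega), h4]
  | load a e he =>
    intro m r ρ s hm hreg hρ hs
    simp only [size, add_mul] at hW
    refine .seq ((he (by omega) m r ρ s hm hreg hρ hs).mono ?_)
    rintro k t ⟨h1, h2, h3, h4⟩
    have := hM.le a (t.reg r)
    refine .load (by rw [h2]; omega) ⟨by simp only [cost]; omega, h2, ?_, ?_⟩
    · intro z hz
      rw [RamState.setReg_reg, if_neg (by omega), h3 z hz]
    · simp [eval, h2, h4]
  | ifLt e f g h he hf hg hh =>
    intro m r ρ s hm hreg hρ hs
    simp only [size, add_mul] at hW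
    refine .seq ((he (by omega) m r ρ s hm hreg hρ hs).mono ?_)
    rintro k t ⟨h1, h2, h3, h4⟩
    refine .seq ((hf (by omega) m (r + 1) ρ t (fun j => (hm j).trans (by omega))
      (step hm hreg h3) hρ h2).mono ?_)
    rintro k' t' ⟨h1', h2', h3', h4'⟩
    have h5 : t'.reg r = e.eval A M ρ := by rw [h3' r (by omega), h4]
    have h6 : ∀ x < r, t'.reg x = s.reg x := fun x hx => by rw [h3' x (by omega), h3 x hx]
    refine .ifLt (fun hlt => ?_) fun hlt => ?_
    · refine (hg (by omega) m r ρ t' hm (step hm hreg h6) hρ h2').mono ?_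
      rintro k'' t'' ⟨i1, i2, i3, i4⟩
      refine ⟨by simp only [cost]; omega, i2, fun x hx => by rw [i3 x hx, h6 x hx], ?_⟩
      rw [h5, h4'] at hlt
      rw [i4, eval, if_pos hlt]
    · refine (hh (by omega) m r ρ t' hm (step hm hreg h6) hρ h2').mono ?_
      rintro k'' t'' ⟨i1, i2, i3, i4⟩
      refine ⟨by simp only [cost]; omega, i2, fun x hx => by rw [i3 x hx, h6 x hx], ?_⟩
      rw [h5, h4'] at hlt
      rw [i4, eval, if_neg hlt]
  | sum x y e he =>
    intro m r ρ s hm hreg hρ hs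
    simp only [size] at hW
    have hW' : e.size * N ≤ W := le_trans (by gcongr; omega) hW
    have h8 : 8 * N ≤ W := le_trans (by gcongr; omega) hW
    have hmx := hm x
    have hx := hρ x
    have hlen := hM.length_le (ρ x)
    have b1 := hM.le 0 (ρ x)
    have b2 := hM.le 0 (ρ x + 1)
    refine .seq (.const (by omega) (.seq (.load ?_ (.seq (.const (by omega) (.seq (.add ?_
      (.seq (.load ?_ ?_)))))))))
    · simp only [RamState.setReg_arr, RamState.setReg_reg]
      rw [if_neg (by omega), hreg, hs]; omega
    · simp only [RamState.setReg_reg, if_true]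
      rw [if_neg (by omega), if_neg (by omega), if_neg (by omega), hreg]; omega
    · simp only [RamState.setReg_arr, hs]
      exact (hM.le _ _).trans (by omega)
    · have f1 : m x ≠ r := by omega
      have f2 : m x ≠ r + 1 := by omega
      have f3 : m x ≠ r + 2 := by omega
      simp only [RamState.setReg_arr, RamState.setReg_reg, hs, hreg, if_true, if_neg f1, if_neg f2,
        if_neg f3]
      set u := ((((s.setReg r 0).setReg (r + 1) (M 0 (ρ x))).setReg (r + 2) 1).setReg (r + 2)
        (ρ x + 1)).setReg (r + 2) (M 0 (ρ x + 1)) with hu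
      have u0 : u.reg r = 0 := by simp [hu]
      have u1 : u.reg (r + 1) = M 0 (ρ x) := by simp [hu]
      have u2 : u.reg (r + 2) = M 0 (ρ x + 1) := by simp [hu]
      have ur : ∀ z < r, u.reg z = s.reg z := fun z hz => by
        have g1 : z ≠ r := by omega
        have g2 : z ≠ r + 1 := by omega
        have g3 : z ≠ r + 2 := by omega
        simp [hu, g1, g2, g3]
      rcases hM.window (ρ x) with ⟨w1, w2⟩ | ⟨w1, w2⟩
      · refine ⟨1, u, .whileFalse (by omega), ?_, hs, ur, ?_⟩
        · simp [cost]
        · simp [eval, w1, u0]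
      · have hb : (A (ρ x)).length * (e.size * N) ≤ 4 * (e.size * N) := by gcongr
        have hW2 : 4 * (e.size * N) ≤ W := by nlinarith
        refine (compile_sum_loop hM hm hρ hW (fun m r ρ s => he hW' m r ρ s) (A (ρ x)) u
          (fun j => by rw [ur _ (hm j), hreg]) hs (by omega) (hM.lt _) (by omega) (by omega)
          (by rw [u1]; exact w2)).mono ?_
        rintro k t ⟨h1, h2, h3, h4⟩
        refine ⟨?_, h2, fun z hz => by rw [h3 z hz, ur z hz], ?_⟩
        · simp only [cost]
          have : (A (ρ x)).length * (e.cost + 5) ≤ 4 * (e.cost + 5) := by gcongr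
          omega
        · rw [h4, u0, zero_add, eval]

end RamExpr

/-! ### Adjacency lists in the memory -/

theorem List.getD_flatten_take_sum {α : Type*} (Ls : List (List α)) (d : α) (i j : ℕ)
    (hi : i < Ls.length) (hj : j < Ls[i].length) :
    Ls.flatten.getD (((Ls.take i).map List.length).sum + j) d = Ls[i][j] := by
  induction Ls generalizing i with
  | nil => simp at hi
  | cons l Ls ih =>
    cases i with
    | zero =>
      simp only [List.getElem_cons_zero] at hj
      simp [List.getElem?_append_left hj, hj]
    | succ i =>
      simp only [List.length_cons, Nat.add_lt_add_iff_right] at hi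
      simp only [List.getElem_cons_succ] at hj ⊢
      rw [← ih i hi hj]
      simp only [List.take_succ_cons, List.map_cons, List.sum_cons, List.flatten_cons,
        List.getD_eq_getElem?_getD]
      rw [List.getElem?_append_right (by omega)]
      congr 2; omega

theorem GridEmbedding.vertexDegree_le {V : Type*} [Fintype V] {G : SimpleGraph V}
    (R : GridEmbedding G) (v : V) : vertexDegree G v ≤ 4 := by
  rw [vertexDegree_eq_nbrSum, R.nbrSum_eq v (e := (1, 0)) (by simp [IsUnitVec]) (fun _ => 1)
    (fun _ _ => rfl)]
  split_ifs <;> omega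

namespace AdjacencyLists

variable {n : ℕ} {G : SimpleGraph (Fin n)} (L : AdjacencyLists G)

/-- The list of the vertex `x`, as a list of numbers, and the empty list if `x` is no vertex. -/
def nbrsAt (x : ℕ) : List ℕ := if h : x < n then (L.nbrs ⟨x, h⟩).map Fin.val else []

theorem nbrsAt_val (v : Fin n) : L.nbrsAt v.val = (L.nbrs v).map Fin.val := by
  simp [nbrsAt]

theorem sum_map_nbrs (v : Fin n) (f : Fin n → ℕ) : ((L.nbrs v).map f).sum = nbrSum G v f := by
  classical
  rw [← List.sum_toFinset f (L.nodup v), nbrSum, ← Finset.sum_filter]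
  refine Finset.sum_congr ?_ fun _ _ => rfl
  ext a; simp [L.mem_iff]

theorem length_nbrs (v : Fin n) : (L.nbrs v).length = vertexDegree G v := by
  rw [vertexDegree_eq_nbrSum, ← L.sum_map_nbrs v]; simp

theorem offset_succ (v : Fin n) : L.offset (v.val + 1) = L.offset v.val + (L.nbrs v).length := by
  have : (L.nbrs v).length = ∑ u : Fin n, if u = v then (L.nbrs u).length else 0 := by simp
  rw [offset, offset, this, ← Finset.sum_add_distrib]
  refine Finset.sum_congr rfl fun u _ => ?_
  rcases lt_trichotomy u.val v.val with h | h | h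
  · rw [if_pos (by omega), if_pos h, if_neg (by rintro rfl; omega), add_zero]
  · rw [if_pos (by omega), if_neg (by omega), if_pos (Fin.ext h), zero_add]
  · rw [if_neg (by omega), if_neg (by omega), if_neg (by rintro rfl; omega)]

theorem offset_eq_sum_take (i : ℕ) (hi : i ≤ n) : L.offset i =
    ((((List.ofFn fun v => (L.nbrs v).map Fin.val).take i)).map List.length).sum := by
  induction i with
  | zero => simp [offset]
  | succ i ih =>
    have hi' : i < n := hi
    rw [L.offset_succ ⟨i, hi'⟩, ih hi'.le, List.take_add_one]
    simp [hi']

theorem offset_le (hdeg : ∀ v, (L.nbrs v).length ≤ 4) (i : ℕ) : L.offset i ≤ 4 * n := by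
  have : L.offset i ≤ ∑ _v : Fin n, 4 := Finset.sum_le_sum fun v _ => by
    split_ifs
    · exact hdeg v
    · omega
  simpa [mul_comm] using this

theorem heads_le (i : ℕ) : L.heads.getD i 0 ≤ n := by
  by_cases h : i < L.heads.length
  · rw [List.getD_eq_getElem _ _ h]
    have := List.getElem_mem h
    simp only [heads, List.mem_flatten, List.mem_ofFn] at this
    obtain ⟨_, ⟨v, rfl⟩, hv⟩ := this
    obtain ⟨a, -, ha⟩ := List.mem_map.1 hv
    have := a.isLt
    simp only [heads] at ha ⊢
    omega
  · rw [List.getD_eq_default _ _ (by omega)]; omega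

theorem heads_getD (v : Fin n) (j : ℕ) (hj : j < ((L.nbrs v).map Fin.val).length) :
    L.heads.getD (L.offset v.val + j) 0 = ((L.nbrs v).map Fin.val)[j] := by
  rw [L.offset_eq_sum_take v.val v.isLt.le, heads]
  rw [List.getD_flatten_take_sum _ 0 v.val j (by simp) (by simpa using hj)]
  simp

/-- The bound is `n + 1` because it has to be positive and because registers may hold a vertex plus
one. -/
theorem storesLists (hdeg : ∀ v, (L.nbrs v).length ≤ 4) {M : ℕ → ℕ → ℕ}
    (h0 : M 0 = L.input.arr 0) (h1 : M 1 = L.input.arr 1) (hM : ∀ a i, 2 ≤ a → M a i ≤ 1) :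
    StoresLists L.nbrsAt (n + 1) M where
  pos := by omega
  length_le x := by
    by_cases hx : x < n
    · simpa [nbrsAt, hx] using hdeg ⟨x, hx⟩
    · simp [nbrsAt, hx]
  lt x a ha := by
    by_cases hx : x < n
    · simp only [nbrsAt, hx, dite_true, List.mem_map] at ha
      obtain ⟨b, -, rfl⟩ := ha
      omega
    · simp [nbrsAt, hx] at ha
  le a i := by
    obtain rfl | rfl | h : a = 0 ∨ a = 1 ∨ 2 ≤ a := by omega
    · have := L.offset_le hdeg i
      rw [h0]
      simp only [input, if_true]
      split_ifs <;> omega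
    · have := L.heads_le i
      rw [h1]
      simp only [input, if_true, one_ne_zero, if_false]
      omega
    · have := hM a i h
      omega
  window x := by
    rw [h0, h1]
    by_cases hx : x < n
    · right
      have h2 := L.offset_succ ⟨x, hx⟩
      have h3 := L.nbrsAt_val ⟨x, hx⟩
      simp only at h2 h3
      rw [h3]
      simp only [input, if_true, one_ne_zero, if_false, if_pos hx.le,
        if_pos (show x + 1 ≤ n from hx), h2, List.length_map, true_and]
      intro i hi
      exact L.heads_getD ⟨x, hx⟩ i (by simpa using hi)
    · left
      simp only [nbrsAt, hx, dite_false, true_and]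
      simp only [input, if_true]
      rw [if_neg (by omega)]
      omega

end AdjacencyLists

/-! ### Expressions for the local structure of a graph -/

namespace RamExpr

/-- If `e = f` then `g` else `h`. -/
def ifEq (e f g h : RamExpr) : RamExpr := ifLt e f h (ifLt f e h g)

/-- In the expressions below, nested sums bind different variables among 8, 9, 10, 20, 21, 22, so
that no outer variable is captured. -/
def degree (x y : ℕ) : RamExpr := sum x y (const 1)

def adj (x y z : ℕ) : RamExpr := sum x z (ifEq (var z) (var y) (const 1) (const 0))

def squares (x y : ℕ) : RamExpr :=
  sum x 20 (sum y 21 (ifEq (var 20) (var y) (const 0)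
    (ifEq (var 21) (var x) (const 0) (adj 20 21 22))))

def boundary (x : ℕ) : RamExpr :=
  ifEq (degree x 10) (const 2) (ifEq (sum x 10 (squares x 10)) (const 2) (const 2) (const 0))
    (ifEq (degree x 10) (const 3) (ifEq (sum x 10 (squares x 10)) (const 4) (const 1) (const 0))
      (const 0))

def boundaryAdj (x y : ℕ) : RamExpr :=
  ifEq (squares x y) (const 1) (ifLt (const 0) (boundary x)
    (ifLt (const 0) (boundary y) (const 1) (const 0)) (const 0)) (const 0)

def boundaryDegree (x : ℕ) : RamExpr := sum x 9 (boundaryAdj x 9)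

/-- Array 3 marks the visited vertices. -/
def unvisited (x y : ℕ) : RamExpr :=
  ifEq (load 3 (var y)) (const 0) (boundaryAdj x y) (const 0)

/-- One more than the first unvisited boundary neighbour of `x`, or zero. -/
def next (x : ℕ) : RamExpr :=
  sum x 9 (ifEq (unvisited x 9) (const 1)
    (ifEq (sum x 8 (ifLt (var 8) (var 9) (unvisited x 8) (const 0))) (const 0)
      (add (var 9) (const 1)) (const 0)) (const 0))

def isLow (x : ℕ) : RamExpr := ifLt (degree x 10) (const 2) (const 1) (const 0)

def isCorner (x : ℕ) : RamExpr := ifEq (boundary x) (const 2) (const 1) (const 0)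

def isFree (x : ℕ) : RamExpr :=
  ifLt (const 0) (boundary x) (ifEq (load 3 (var x)) (const 0) (const 1) (const 0)) (const 0)

def isFreeEnd (x : ℕ) : RamExpr :=
  ifLt (boundaryDegree x) (const 2) (isFree x) (const 0)

variable {n : ℕ} {G : SimpleGraph (Fin n)} {L : AdjacencyLists G} {M : ℕ → ℕ → ℕ} {ρ : ℕ → ℕ}

theorem eval_ifEq (A : ℕ → List ℕ) (e f g h : RamExpr) : (ifEq e f g h).eval A M ρ =
    if e.eval A M ρ = f.eval A M ρ then g.eval A M ρ else h.eval A M ρ := by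
  simp only [ifEq, eval]
  split_ifs <;> first | rfl | omega

theorem eval_ifEq_const (A : ℕ → List ℕ) (e g h : RamExpr) (k : ℕ) :
    (ifEq e (const k) g h).eval A M ρ =
      if e.eval A M ρ = k then g.eval A M ρ else h.eval A M ρ :=
  eval_ifEq A e (const k) g h

theorem eval_sum {x y : ℕ} {e : RamExpr} {v : Fin n} {f : Fin n → ℕ} (hx : ρ x = v)
    (h : ∀ a : Fin n, G.Adj v a → e.eval L.nbrsAt M (Function.update ρ y a) = f a) :
    (sum x y e).eval L.nbrsAt M ρ = nbrSum G v f := by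
  rw [eval, hx, L.nbrsAt_val, List.map_map, L.sum_map_nbrs]
  exact nbrSum_congr h

theorem eval_degree {x y : ℕ} {v : Fin n} (hx : ρ x = v) :
    (degree x y).eval L.nbrsAt M ρ = vertexDegree G v := by
  rw [vertexDegree_eq_nbrSum]
  exact eval_sum hx fun _ _ => rfl

open Classical in
theorem eval_adj {x y z : ℕ} {v w : Fin n} (hx : ρ x = v) (hy : ρ y = w) (hyz : y ≠ z) :
    (adj x y z).eval L.nbrsAt M ρ = if G.Adj v w then 1 else 0 := by
  rw [adj, eval_sum (f := fun a => if a = w then 1 else 0) hx]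
  · rw [nbrSum, Finset.sum_eq_single w]
    · simp
    · intro b _ hb; simp [hb]
    · simp
  · intro a _
    simp [eval_ifEq, eval, Function.update_of_ne hyz, hy, Fin.ext_iff]

theorem eval_squares {x y : ℕ} {v a : Fin n} (hx : ρ x = v) (hy : ρ y = a) (hx' : x < 20)
    (hy' : y < 20) : (squares x y).eval L.nbrsAt M ρ = squareCount G v a := by
  classical
  refine eval_sum hx fun b hb => eval_sum (by rw [Function.update_of_ne (by omega), hy]) fun c hc => ?_
  have e1 : ∀ p q : ℕ, Function.update (Function.update ρ 20 p) 21 q 20 = p := by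
    intro p q; simp
  have e2 : ∀ p q : ℕ, Function.update (Function.update ρ 20 p) 21 q 21 = q := by
    intro p q; simp
  have e3 : ∀ p q : ℕ, Function.update (Function.update ρ 20 p) 21 q x = v := by
    intro p q; rw [Function.update_of_ne (by omega), Function.update_of_ne (by omega), hx]
  have e4 : ∀ p q : ℕ, Function.update (Function.update ρ 20 p) 21 q y = a := by
    intro p q; rw [Function.update_of_ne (by omega), Function.update_of_ne (by omega), hy]
  rw [eval_ifEq, eval_ifEq, eval_adj (e1 _ _) (e2 _ _) (by omega)]
  simp only [eval, e1, e2, e3, e4, ← Fin.ext_iff]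
  split_ifs <;> simp_all

theorem eval_boundary {x : ℕ} {v : Fin n} (hx : ρ x = v) (hx' : x < 10) :
    (boundary x).eval L.nbrsAt M ρ = boundaryType G v := by
  have h : (sum x 10 (squares x 10)).eval L.nbrsAt M ρ = nbrSum G v (squareCount G v) :=
    eval_sum hx fun a _ => eval_squares (by rw [Function.update_of_ne (by omega), hx])
      (by simp) (by omega) (by omega)
  simp only [boundary, eval_ifEq_const, eval_degree hx, h, boundaryType]
  simp only [eval]
  split_ifs <;> first | rfl | simp_all

open Classical in
theorem eval_boundaryAdj {x y : ℕ} {v a : Fin n} (hx : ρ x = v) (hy : ρ y = a) (hx' : x < 10)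
    (hy' : y < 10) (h : G.Adj v a) :
    (boundaryAdj x y).eval L.nbrsAt M ρ = if BoundaryAdj G v a then 1 else 0 := by
  simp only [boundaryAdj, eval_ifEq_const, eval_squares hx hy (by omega : x < 20) (by omega : y < 20)]
  simp only [eval, eval_boundary hx hx', eval_boundary hy hy', BoundaryAdj, h, true_and]
  split_ifs <;> first | rfl | simp_all

open Classical in
theorem eval_boundaryDegree {x : ℕ} {v : Fin n} (hx : ρ x = v) (hx' : x < 9) :
    (boundaryDegree x).eval L.nbrsAt M ρ =
      nbrSum G v fun a => if BoundaryAdj G v a then 1 else 0 :=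
  eval_sum hx fun _ ha => eval_boundaryAdj (by rw [Function.update_of_ne (by omega), hx])
    (by simp) (by omega) (by omega) ha

open Classical in
theorem eval_unvisited {x y : ℕ} {v a : Fin n} (hx : ρ x = v) (hy : ρ y = a) (hx' : x < 10)
    (hy' : y < 10) (h : G.Adj v a) :
    (unvisited x y).eval L.nbrsAt M ρ = if BoundaryAdj G v a ∧ M 3 a = 0 then 1 else 0 := by
  simp only [unvisited, eval_ifEq_const, eval_boundaryAdj hx hy hx' hy' h, eval, hy]
  split_ifs <;> first | rfl | simp_all

/-- Only the smallest unvisited boundary neighbour contributes to the sum, so that a sum acts as a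
choice; the shift by one keeps vertex 0 apart from an empty sum. -/
theorem eval_next {x : ℕ} {v : Fin n} (hx : ρ x = v) (hx' : x < 8) :
    ((next x).eval L.nbrsAt M ρ = 0 ∧ ∀ a : Fin n, BoundaryAdj G v a → M 3 a ≠ 0) ∨
      ∃ w : Fin n, BoundaryAdj G v w ∧ M 3 w = 0 ∧ (next x).eval L.nbrsAt M ρ = w + 1 := by
  classical
  have hin : ∀ a : Fin n, G.Adj v a → (sum x 8 (ifLt (var 8) (var 9) (unvisited x 8)
      (const 0))).eval L.nbrsAt M (Function.update ρ 9 a) =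
      nbrSum G v fun b => if b < a ∧ BoundaryAdj G v b ∧ M 3 b = 0 then 1 else 0 := by
    intro a ha
    refine eval_sum (by rw [Function.update_of_ne (by omega), hx]) fun b hb => ?_
    rw [eval, eval_unvisited (v := v) (a := b)
      (by rw [Function.update_of_ne (by omega), Function.update_of_ne (by omega), hx])
      (by simp) (by omega) (by omega) hb]
    simp only [eval, Function.update_self, Function.update_of_ne (show 9 ≠ 8 by omega), ite_and]
    rfl
  have hval : (next x).eval L.nbrsAt M ρ = nbrSum G v fun a =>
      if (BoundaryAdj G v a ∧ M 3 a = 0) ∧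
        ∀ b, BoundaryAdj G v b → M 3 b = 0 → ¬ b < a then a.val + 1 else 0 := by
    refine eval_sum hx fun a ha => ?_
    have hz : (nbrSum G v fun b => if b < a ∧ BoundaryAdj G v b ∧ M 3 b = 0 then 1 else 0) = 0 ↔
        ∀ b, BoundaryAdj G v b → M 3 b = 0 → ¬ b < a := by
      rw [nbrSum, Finset.sum_eq_zero_iff]
      constructor
      · intro h b hb hM hlt
        have := h b (Finset.mem_univ _)
        rw [if_pos hb.1, if_pos ⟨hlt, hb, hM⟩] at this
        omega
      · intro h b _
        split_ifs with h1 h2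
        · exact absurd h2.1 (h b h2.2.1 h2.2.2)
        · rfl
        · rfl
    rw [eval_ifEq_const, eval_ifEq_const, hin a ha, eval_unvisited (v := v) (a := a)
      (by rw [Function.update_of_ne (by omega), hx]) (by simp) (by omega) (by omega) ha]
    simp only [eval, hz, Function.update_self]
    split_ifs <;> first | rfl | simp_all
  rw [hval]
  by_cases hex : ∃ a, BoundaryAdj G v a ∧ M 3 (a : Fin n).val = 0
  · right
    obtain ⟨w, hw, hmin⟩ := Set.Finite.exists_minimal (s := {a | BoundaryAdj G v a ∧ M 3 (a : Fin n).val = 0})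
      (Set.toFinite _) hex
    have hmin' : ∀ b, BoundaryAdj G v b → M 3 (b : Fin n).val = 0 → ¬ b < w := fun b h1 h2 hlt =>
      absurd (hmin ⟨h1, h2⟩ hlt.le) (not_le.2 hlt)
    refine ⟨w, hw.1, hw.2, ?_⟩
    rw [nbrSum, Finset.sum_eq_single w]
    · rw [if_pos hw.1.1, if_pos ⟨hw, hmin'⟩]
    · intro b _ hb
      split_ifs with h1 h2
      · rcases lt_or_gt_of_ne hb with h3 | h3
        · exact absurd h3 (hmin' b h2.1.1 h2.1.2)
        · exact absurd h3 (h2.2 w hw.1 hw.2)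
      · rfl
      · rfl
    · simp
  · left
    push Not at hex
    refine ⟨?_, hex⟩
    rw [nbrSum, Finset.sum_eq_zero]
    intro a _
    split_ifs with h1 h2
    · exact absurd h2.1.2 (hex a h2.1.1)
    · rfl
    · rfl

theorem eval_isLow {x : ℕ} {v : Fin n} (hx : ρ x = v) :
    (isLow x).eval L.nbrsAt M ρ = if vertexDegree G v ≤ 1 then 1 else 0 := by
  simp only [isLow, eval, eval_degree hx]
  split_ifs <;> first | rfl | omega

theorem eval_isCorner {x : ℕ} {v : Fin n} (hx : ρ x = v) (hx' : x < 10) :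
    (isCorner x).eval L.nbrsAt M ρ = if boundaryType G v = 2 then 1 else 0 := by
  simp only [isCorner, eval_ifEq_const, eval_boundary hx hx', eval]

theorem eval_isFree {x : ℕ} {v : Fin n} (hx : ρ x = v) (hx' : x < 10) :
    (isFree x).eval L.nbrsAt M ρ = if 0 < boundaryType G v ∧ M 3 v = 0 then 1 else 0 := by
  simp only [isFree, eval, eval_ifEq_const, eval_boundary hx hx', hx, ite_and]

open Classical in
theorem eval_isFreeEnd {x : ℕ} {v : Fin n} (hx : ρ x = v) (hx' : x < 9) :
    (isFreeEnd x).eval L.nbrsAt M ρ = if (0 < boundaryType G v ∧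
      (nbrSum G v fun a => if BoundaryAdj G v a then 1 else 0) ≤ 1) ∧ M 3 v = 0 then 1 else 0 := by
  simp only [isFreeEnd, eval, eval_boundaryDegree hx hx', eval_isFree hx (by omega : x < 10)]
  split_ifs <;> first | rfl | omega

end RamExpr

/-! ### Program fragments -/

/-- The expressions of the program may use the registers below 6. -/
def regMap (j : ℕ) : ℕ := if j < 6 then j else 0

theorem regMap_lt (j : ℕ) : regMap j < 6 := by
  unfold regMap; split_ifs <;> omega

namespace RamProg

def assign (x : ℕ) (e : RamExpr) : RamProg := .seq (e.compile regMap 6) (.copy x 6)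

/-- Register 1 always holds zero. -/
def whenPos (e : RamExpr) (p : RamProg) : RamProg :=
  .seq (e.compile regMap 6) (.ifLt 1 6 p .skip)

def mark (a x : ℕ) : RamProg := .seq (.const 6 1) (.store a x 6)

/-- Register 2 runs through the vertices, and register 0 holds their number. -/
def forAll (p : RamProg) : RamProg :=
  .seq (.const 2 0) (.whileLt 2 0 (.seq p (.assign 2 (.add (.var 2) (.const 1)))))

end RamProg

/-- The state outside the arrays 2 and 3, which hold zeros and ones. -/
structure RamState.IsRegular {n : ℕ} {G : SimpleGraph (Fin n)} (L : AdjacencyLists G)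
    (s : RamState) : Prop where
  zero : s.reg 0 = n
  one : s.reg 1 = 0
  le : ∀ x < 6, s.reg x ≤ n + 1
  offsets : s.arr 0 = L.input.arr 0
  heads : s.arr 1 = L.input.arr 1
  flags : ∀ a i, 2 ≤ a → s.arr a i ≤ 1

/-- The value of an expression in a state. -/
def RamState.value {n : ℕ} {G : SimpleGraph (Fin n)} (L : AdjacencyLists G) (s : RamState)
    (e : RamExpr) : ℕ := e.eval L.nbrsAt s.arr fun j => s.reg (regMap j)

section Fragments

variable {n W : ℕ} {G : SimpleGraph (Fin n)} {L : AdjacencyLists G}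

theorem RamState.IsRegular.congr {s t : RamState} (hs : s.IsRegular L)
    (h : ∀ x < 6, t.reg x = s.reg x) (ha : t.arr = s.arr) : t.IsRegular L where
  zero := by rw [h 0 (by omega), hs.zero]
  one := by rw [h 1 (by omega), hs.one]
  le x hx := by rw [h x hx]; exact hs.le x hx
  offsets := by rw [ha, hs.offsets]
  heads := by rw [ha, hs.heads]
  flags := by rw [ha]; exact hs.flags

theorem RamState.IsRegular.update {s t : RamState} (hs : s.IsRegular L) {z : ℕ} (hz : 2 ≤ z)
    (h : ∀ x < 6, x ≠ z → t.reg x = s.reg x) (hle : t.reg z ≤ n + 1) (ha : t.arr = s.arr) :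
    t.IsRegular L where
  zero := by rw [h 0 (by omega) (by omega), hs.zero]
  one := by rw [h 1 (by omega) (by omega), hs.one]
  le x hx := by
    by_cases hxz : x = z
    · rw [hxz]; exact hle
    · rw [h x hx hxz]; exact hs.le x hx
  offsets := by rw [ha, hs.offsets]
  heads := by rw [ha, hs.heads]
  flags := by rw [ha]; exact hs.flags

namespace RamProg

theorem compile_spec_of_isRegular (hdeg : ∀ v, (L.nbrs v).length ≤ 4) {s : RamState}
    (hs : s.IsRegular L) (e : RamExpr) (hW : e.size * (n + 1) ≤ W) :
    (e.compile regMap 6).Spec W s fun k t => k ≤ e.cost ∧ t.IsRegular L ∧ t.arr = s.arr ∧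
      (∀ x < 6, t.reg x = s.reg x) ∧ t.reg 6 = s.value L e ∧ t.reg 6 ≤ W := by
  have hM := L.storesLists hdeg hs.offsets hs.heads hs.flags
  have hle : ∀ j, s.reg (regMap j) ≤ n + 1 := fun j => hs.le _ (regMap_lt j)
  refine (RamExpr.compile_spec hM e hW regMap 6 (fun j => s.reg (regMap j)) s regMap_lt
    (fun _ => rfl) hle rfl).mono ?_
  rintro k t ⟨h1, h2, h3, h4⟩
  refine ⟨h1, hs.congr h3 h2, h2, h3, h4, ?_⟩
  rw [h4]
  exact (RamExpr.eval_le hM e _ hle).trans hW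

theorem assign_spec (hdeg : ∀ v, (L.nbrs v).length ≤ 4) {s : RamState} (hs : s.IsRegular L)
    {e : RamExpr} {x : ℕ} (hx : 2 ≤ x) (hW : e.size * (n + 1) ≤ W)
    (hle : s.value L e ≤ n + 1) :
    (assign x e).Spec W s fun k t => k ≤ e.cost + 1 ∧ t.IsRegular L ∧ t.arr = s.arr ∧
      t.reg x = s.value L e ∧ ∀ y < 6, y ≠ x → t.reg y = s.reg y := by
  refine .seq ((compile_spec_of_isRegular hdeg hs e hW).mono ?_)
  rintro k t ⟨h1, h2, h3, h4, h5, h6⟩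
  have key : ∀ y < 6, y ≠ x → (t.setReg x (t.reg 6)).reg y = s.reg y := fun y hy hyx => by
    rw [RamState.setReg_reg, if_neg hyx, h4 y hy]
  refine .copy h6 ⟨by omega, hs.update hx key ?_ h3, h3, by simp [h5], key⟩
  simp only [RamState.setReg_reg, if_true]
  omega

theorem whenPos_spec (hdeg : ∀ v, (L.nbrs v).length ≤ 4) {s : RamState} (hs : s.IsRegular L)
    {e : RamExpr} {p : RamProg} {Q : ℕ → RamState → Prop} (hW : e.size * (n + 1) ≤ W)
    (h1 : 0 < s.value L e → ∀ t : RamState, t.IsRegular L → t.arr = s.arr →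
      (∀ x < 6, t.reg x = s.reg x) → p.Spec W t fun k u => ∀ l ≤ e.cost + 1, Q (l + k) u)
    (h0 : s.value L e = 0 → ∀ t : RamState, t.IsRegular L → t.arr = s.arr →
      (∀ x < 6, t.reg x = s.reg x) → ∀ l ≤ e.cost + 2, Q l t) : (whenPos e p).Spec W s Q := by
  refine .seq ((compile_spec_of_isRegular hdeg hs e hW).mono ?_)
  rintro k t ⟨i1, i2, i3, i4, i5, -⟩
  refine .ifLt (fun h => ?_) fun h => ?_
  · rw [i2.one, i5] at h
    refine (h1 h t i2 i3 i4).mono fun l u hu => ?_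
    have := hu (k + 1) (by omega)
    rwa [show k + (l + 1) = k + 1 + l by omega]
  · rw [i2.one, i5] at h
    exact .skip (h0 (by omega) t i2 i3 i4 _ (by omega))

theorem mark_spec {s : RamState} (hs : s.IsRegular L) {a x : ℕ} (ha : 2 ≤ a) (hx : x < 6)
    (hW : 1 ≤ W) : (mark a x).Spec W s fun k t => k ≤ 2 ∧ t.IsRegular L ∧
      (∀ b i, t.arr b i = if b = a ∧ i = s.reg x then 1 else s.arr b i) ∧
      ∀ y < 6, t.reg y = s.reg y := by
  refine .seq (.const hW (.store (by simpa using hW) ?_))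
  have hr : ∀ y < 6, (((s.setReg 6 1).setArr a ((s.setReg 6 1).reg x)
      ((s.setReg 6 1).reg 6)).reg y) = s.reg y := fun y hy => by
    simp; omega
  have hA : ∀ b i, ((s.setReg 6 1).setArr a ((s.setReg 6 1).reg x)
      ((s.setReg 6 1).reg 6)).arr b i = if b = a ∧ i = s.reg x then 1 else s.arr b i := by
    intro b i
    simp only [RamState.setArr_arr, RamState.setReg_reg, if_neg (show x ≠ 6 by omega),
      RamState.setReg_arr, if_true]
  refine ⟨by omega, ⟨?_, ?_, ?_, ?_, ?_, ?_⟩, hA, hr⟩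
  · rw [hr 0 (by omega), hs.zero]
  · rw [hr 1 (by omega), hs.one]
  · intro y hy; rw [hr y hy]; exact hs.le y hy
  · ext i; rw [hA, if_neg (by omega), hs.offsets]
  · ext i; rw [hA, if_neg (by omega), hs.heads]
  · intro b i hb
    rw [hA]
    split_ifs
    · rfl
    · exact hs.flags b i hb

/-- The rule for loops over all vertices. Each iteration pays `c` steps, and further steps from the
budget `b`. -/
theorem forAll_spec (hdeg : ∀ v, (L.nbrs v).length ≤ 4) {p : RamProg} {c : ℕ}
    (hW : 2 * (n + 1) ≤ W) (J : ℕ → ℕ → (ℕ → ℕ → ℕ) → Prop)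
    (hp : ∀ (v : Fin n) b (s : RamState), s.IsRegular L → s.reg 2 = v → J v b s.arr →
      p.Spec W s fun k t => ∃ b', t.IsRegular L ∧ t.reg 2 = v ∧ J (v + 1) b' t.arr ∧
        k + b' ≤ b + c) {b : ℕ} {s : RamState} (hs : s.IsRegular L) (hJ : J 0 b s.arr) :
    (forAll p).Spec W s fun k t => ∃ b', t.IsRegular L ∧ J n b' t.arr ∧
      k + b' ≤ b + (c + 5) * n + 2 := by
  refine .seq (.const (by omega) ?_)
  have hs' : (s.setReg 2 0).IsRegular L := hs.update le_rfl
    (fun x _ hx => by simp [hx]) (by simp) rfl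
  -- Each iteration pays five steps besides the body: four for the increment and one for the test.
  -- The final 2 covers the initialisation and the last test.
  refine (Spec.whileLt (fun B t => ∃ b', t.IsRegular L ∧ t.reg 2 ≤ n ∧ J (t.reg 2) b' t.arr ∧
    B = b' + (c + 5) * (n - t.reg 2)) ?_ (b + (c + 5) * n) _
    ⟨b, hs', by simp, by simpa using hJ, by simp⟩).mono ?_
  · rintro B t ⟨b', h1, h2, h3, rfl⟩ hlt
    rw [h1.zero] at hlt
    refine .seq ((hp ⟨t.reg 2, hlt⟩ b' t h1 rfl h3).mono ?_)
    rintro k u ⟨b'', i1, i2, i3, i4⟩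
    simp only at i2 i3
    have hval : u.value L (.add (.var 2) (.const 1)) = t.reg 2 + 1 := by
      simp [RamState.value, RamExpr.eval, regMap, i2]
    refine (assign_spec hdeg i1 le_rfl (by simpa [RamExpr.size] using hW)
      (by rw [hval]; omega)).mono ?_
    rintro l w ⟨j1, j2, j3, j4, j5⟩
    rw [hval] at j4
    refine ⟨_, ?_, b'', j2, by omega, by rw [j4, j3]; exact i3, rfl⟩
    simp only [RamExpr.cost] at j1
    obtain ⟨d, hd⟩ : ∃ d, n - t.reg 2 = d + 1 := ⟨n - t.reg 2 - 1, by omega⟩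
    have hd' : n - w.reg 2 = d := by omega
    rw [hd, hd', mul_add]
    omega
  · rintro k t ⟨h1, B, h2, b', h3, h4, h5, rfl⟩
    rw [h3.zero] at h1
    have e : t.reg 2 = n := by omega
    rw [e] at h5 h2
    exact ⟨b', h3, h5, by simp at h2; omega⟩

end RamProg

end Fragments

/-! ### The program -/

/-- The incremental form: one parity bit decides whether a newly visited corner is selected. -/
theorem everySecond_concat {α : Type*} (c : α) : ∀ l : List α,
    everySecond (l ++ [c]) = everySecond l ++ if l.length % 2 = 1 then [c] else []
  | [] => by simp [everySecond]
  | [_] => by simp [everySecond]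
  | _ :: _ :: l => by
    have : (l.length + 1 + 1) % 2 = l.length % 2 := by omega
    simp [everySecond, everySecond_concat c l, this]

theorem cornersOf_concat {V : Type*} [Fintype V] {G : SimpleGraph V} (l : List V) (v : V) :
    cornersOf G (l ++ [v]) = cornersOf G l ++ if boundaryType G v = 2 then [v] else [] := by
  simp only [cornersOf, List.filter_append, List.filter_cons, List.filter_nil, decide_eq_true_eq]

open RamExpr in
/-- Visit the vertex in register 3 (plus one) and put the next one into this register. Register 5
holds the parity of the number of visited corners. -/
def visitProgram : RamProg :=
  .seq (.assign 4 (.sub (.var 3) (.const 1))) (.seq (.mark 3 4)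
    (.seq (.whenPos (isCorner 4) (.ifLt 1 5 (.seq (.const 5 0) (.mark 2 4)) (.const 5 1)))
      (.assign 3 (next 4))))

/-- Follow the boundary, starting with the vertex in register 2. -/
def traverseProgram : RamProg :=
  .seq (.const 5 0) (.seq (.assign 3 (.add (.var 2) (.const 1))) (.whileLt 1 3 visitProgram))

-- Components that are paths have to be started at an end, so the second pass starts only at
-- vertices with at most one boundary neighbour. What remains unvisited lies on cycles, where the
-- last pass may start anywhere.
open RamExpr in
def geodeticProgram : RamProg :=
  .seq (.forAll (.whenPos (isLow 2) (.mark 2 2)))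
    (.seq (.forAll (.whenPos (isFreeEnd 2) traverseProgram))
      (.forAll (.whenPos (isFree 2) traverseProgram)))

open RamExpr in
/-- The word size that the program needs, in multiples of the number of vertices plus one. -/
def geodeticProgramSize : ℕ :=
  (isLow 2).size + (isCorner 4).size + (next 4).size + (isFreeEnd 2).size + (isFree 2).size + 2

/-- A bound for the time of one visit. -/
def visitCost : ℕ := (RamExpr.isCorner 4).cost + (RamExpr.next 4).cost + 15

/-! ### Correctness and running time of the program -/

section Correctness

variable {n W : ℕ} {G : SimpleGraph (Fin n)} {L : AdjacencyLists G}

open Classical in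
/-- The arrays record the finished chains `C` and the chain `l` under construction. -/
structure Records (G : SimpleGraph (Fin n)) (M : ℕ → ℕ → ℕ) (C : List (List (Fin n)))
    (l : List (Fin n)) : Prop where
  visited : ∀ v : Fin n, M 3 v = if v ∈ C.flatten ∨ v ∈ l then 1 else 0
  output : ∀ v : Fin n, M 2 v = if v ∈ lowDegreeVertices G ∨
    (∃ l' ∈ C, v ∈ everySecond (cornersOf G l')) ∨ v ∈ everySecond (cornersOf G l) then 1 else 0

/-- The invariant of the traversal that starts with the vertex `v`. -/
structure IsTraversal (L : AdjacencyLists G) (C : List (List (Fin n))) (v : Fin n)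
    (s : RamState) (l : List (Fin n)) : Prop where
  regular : s.IsRegular L
  start : s.reg 2 = v
  records : Records G s.arr C l
  nodup : (C.flatten ++ l).Nodup
  chain : l.IsChain (BoundaryAdj G)
  pos : ∀ x ∈ l, 0 < boundaryType G x
  head : ∀ x ∈ l.head?, x = v
  parity : s.reg 5 = (cornersOf G l).length % 2
  -- Register 3 is the stop signal 0 when the chain is stuck, and otherwise announces the next
  -- vertex, which at the beginning is `v` itself.
  next : (s.reg 3 = 0 ∧ ∃ x ∈ l.getLast?, ∀ y, BoundaryAdj G x y → y ∈ C.flatten ∨ y ∈ l) ∨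
    ∃ w : Fin n, s.reg 3 = w + 1 ∧ 0 < boundaryType G w ∧ w ∉ C.flatten ∧ w ∉ l ∧
      (∀ x ∈ l.getLast?, BoundaryAdj G x w) ∧ (l = [] → w = v)

theorem length_le_of_nodup {l : List (Fin n)} (h : l.Nodup) : l.length ≤ n := by
  simpa using h.length_le_card

theorem visitProgram_spec (hdeg : ∀ v, (L.nbrs v).length ≤ 4)
    (hW : geodeticProgramSize * (n + 1) ≤ W) {C : List (List (Fin n))} {v : Fin n} {s : RamState}
    {l : List (Fin n)} (h : IsTraversal L C v s l) (hpos : 0 < s.reg 3) :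
    visitProgram.Spec W s fun k t => k + 1 ≤ visitCost ∧ ∃ w, IsTraversal L C v t (l ++ [w]) := by
  have hWe : ∀ e : RamExpr, e.size ≤ geodeticProgramSize → e.size * (n + 1) ≤ W :=
    fun e he => (Nat.mul_le_mul_right _ he).trans hW
  have hW1 : 2 * (n + 1) ≤ W :=
    (Nat.mul_le_mul_right _ (by unfold geodeticProgramSize; omega)).trans hW
  obtain ⟨h3, -⟩ | ⟨w, h3, hw, hwC, hwl, hlast, hnil⟩ := h.next
  · omega
  have hval : s.value L (.sub (.var 3) (.const 1)) = w := by
    simp [RamState.value, RamExpr.eval, regMap, h3]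
  refine .seq ((RamProg.assign_spec hdeg h.regular (by omega)
    (by simpa [RamExpr.size] using hW1) (by rw [hval]; omega)).mono ?_)
  rintro k₁ s₁ ⟨hk₁, r₁, a₁, v₁, u₁⟩
  rw [hval] at v₁
  refine .seq ((RamProg.mark_spec (a := 3) (x := 4) r₁ (by omega) (by omega) (by omega)).mono ?_)
  rintro k₂ s₂ ⟨hk₂, r₂, a₂, u₂⟩
  rw [v₁, a₁] at a₂
  have e5 : s₂.reg 5 = (cornersOf G l).length % 2 := by
    rw [u₂ 5 (by omega), u₁ 5 (by omega) (by omega), h.parity]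
  have e4 : s₂.reg 4 = w := by rw [u₂ 4 (by omega), v₁]
  have e2 : s₂.reg 2 = v := by rw [u₂ 2 (by omega), u₁ 2 (by omega) (by omega), h.start]
  have hvis : ∀ x : Fin n, s₂.arr 3 x = if x ∈ C.flatten ∨ x ∈ l ++ [w] then 1 else 0 := by
    classical
    intro x
    rw [a₂, h.records.visited]
    by_cases hx : x = w
    · simp [hx]
    · simp [hx, Fin.val_ne_of_ne hx]
  have hout : ∀ x : ℕ, s₂.arr 2 x = s.arr 2 x := fun x => by rw [a₂]; simp
  have hcor : s₂.value L (RamExpr.isCorner 4) = if boundaryType G w = 2 then 1 else 0 :=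
    RamExpr.eval_isCorner (by simp [regMap, e4]) (by omega)
  have hpar2 := h.parity
  refine .seq ?_
  -- At a corner the parity bit flips, and the corner is marked exactly if the bit was 1, that is,
  -- if its position in the list of corners is even.
  have hmid : (RamProg.whenPos (RamExpr.isCorner 4)
      (.ifLt 1 5 (.seq (.const 5 0) (.mark 2 4)) (.const 5 1))).Spec W s₂ fun k t =>
        k ≤ (RamExpr.isCorner 4).cost + 5 ∧ t.IsRegular L ∧ t.reg 4 = w ∧ t.reg 2 = v ∧
        t.reg 5 = (cornersOf G (l ++ [w])).length % 2 ∧ Records G t.arr C (l ++ [w]) := by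
    classical
    refine RamProg.whenPos_spec hdeg r₂ (hWe _ (by unfold geodeticProgramSize; omega)) ?_ ?_
    · intro hc t rt ta tr
      have hc2 : boundaryType G w = 2 := by
        by_contra hne
        rw [hcor, if_neg hne] at hc
        omega
      have hlen : (cornersOf G (l ++ [w])).length = (cornersOf G l).length + 1 := by
        simp [cornersOf_concat, hc2]
      refine .ifLt (fun hlt => ?_) fun hlt => ?_
      · rw [rt.one, tr 5 (by omega), e5] at hlt
        have rt' : (t.setReg 5 0).IsRegular L := rt.update (z := 5) (by omega)
          (fun x _ hx => by simp [hx]) (by simp) rfl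
        refine .seq (.const (by omega) ((RamProg.mark_spec (a := 2) (x := 4) rt' (by omega)
          (by omega) (by omega)).mono ?_))
        rintro k₃ s₃ ⟨hk₃, r₃, a₃, u₃⟩ k₄ hk₄
        have e4' : (t.setReg 5 0).reg 4 = w := by simp [tr 4 (by omega), e4]
        rw [e4', RamState.setReg_arr, ta] at a₃
        refine ⟨by omega, r₃, by rw [u₃ 4 (by omega), e4'],
          by rw [u₃ 2 (by omega)]; simp [tr 2 (by omega), e2], ?_, ?_, ?_⟩
        · rw [u₃ 5 (by omega), hlen]
          simp only [RamState.setReg_reg, if_true]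
          omega
        · intro x
          rw [a₃, if_neg (by omega), hvis]
        · intro x
          have hev : everySecond (cornersOf G (l ++ [w])) = everySecond (cornersOf G l) ++ [w] := by
            rw [cornersOf_concat, if_pos hc2, everySecond_concat, if_pos (by omega)]
          rw [a₃, hout, h.records.output, hev]
          by_cases hx : x = w
          · simp [hx]
          · simp [hx, Fin.val_ne_of_ne hx]
      · rw [rt.one, tr 5 (by omega), e5] at hlt
        refine .const (by omega) ?_
        intro k₄ hk₄
        refine ⟨by omega, rt.update (z := 5) (by omega) (fun x _ hx => by simp [hx])
          (by simp) rfl, by simp [tr 4 (by omega), e4], by simp [tr 2 (by omega), e2], ?_, ?_, ?_⟩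
        · rw [hlen]
          simp only [RamState.setReg_reg, if_true]
          omega
        · intro x
          rw [RamState.setReg_arr, ta, hvis]
        · intro x
          have hev : everySecond (cornersOf G (l ++ [w])) = everySecond (cornersOf G l) := by
            rw [cornersOf_concat, if_pos hc2, everySecond_concat, if_neg (by omega),
              List.append_nil]
          rw [RamState.setReg_arr, ta, hout, h.records.output, hev]
    · intro hc t rt ta tr k₃ hk₃
      have hc2 : boundaryType G w ≠ 2 := by
        intro he
        rw [hcor, if_pos he] at hc
        omega
      have hcc : cornersOf G (l ++ [w]) = cornersOf G l := by simp [cornersOf_concat, hc2]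
      refine ⟨by omega, rt, by rw [tr 4 (by omega), e4], by rw [tr 2 (by omega), e2],
        by rw [tr 5 (by omega), e5, hcc], ?_, ?_⟩
      · intro x; rw [ta, hvis]
      · intro x; rw [ta, hout, h.records.output, hcc]
  refine hmid.mono ?_
  rintro k₃ s₃ ⟨hk₃, r₃, f4, f2, f5, rec₃⟩
  have hnext := RamExpr.eval_next (G := G) (L := L) (M := s₃.arr)
    (ρ := fun j => s₃.reg (regMap j)) (x := 4) (v := w) (by simp [regMap, f4]) (by omega)
  have hle : s₃.value L (RamExpr.next 4) ≤ n + 1 := by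
    rcases hnext with ⟨h0, -⟩ | ⟨y, -, -, hy⟩
    · unfold RamState.value; omega
    · have := y.isLt
      unfold RamState.value; omega
  refine (RamProg.assign_spec hdeg r₃ (x := 3) (by omega)
    (hWe _ (by unfold geodeticProgramSize; omega)) hle).mono ?_
  rintro k₄ s₄ ⟨hk₄, r₄, a₄, v₄, u₄⟩
  refine ⟨?_, w, r₄, by rw [u₄ 2 (by omega) (by omega), f2], by rw [a₄]; exact rec₃, ?_, ?_, ?_, ?_,
    by rw [u₄ 5 (by omega) (by omega), f5], ?_⟩
  · simp only [RamExpr.cost] at hk₁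
    unfold visitCost
    omega
  · rw [← List.append_assoc, List.nodup_append]
    refine ⟨h.nodup, by simp, ?_⟩
    rintro a ha b hb rfl
    rw [List.mem_singleton.1 hb, List.mem_append] at ha
    exact ha.elim hwC hwl
  · rw [List.isChain_append]
    exact ⟨h.chain, by simp, fun x hx y hy => by
      simp only [List.head?_cons, Option.mem_def, Option.some.injEq] at hy
      exact hy ▸ hlast x hx⟩
  · intro x hx
    rcases List.mem_append.1 hx with hx | hx
    · exact h.pos x hx
    · rw [List.mem_singleton.1 hx]; exact hw
  · intro x hx
    match l, h, hx with
    | [], _, hx =>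
      simp only [List.nil_append, List.head?_cons, Option.mem_def, Option.some.injEq] at hx
      rw [← hx, hnil rfl]
    | a :: l, h, hx => exact h.head x (by simpa using hx)
  · rcases hnext with ⟨h0, hall⟩ | ⟨y, hy1, hy2, hy3⟩
    · left
      refine ⟨by rw [v₄]; exact h0, w, by simp, fun y hy => ?_⟩
      by_contra hcon
      exact hall y hy (by rw [rec₃.visited, if_neg hcon])
    · right
      rw [rec₃.visited] at hy2
      have hy4 : ¬ (y ∈ C.flatten ∨ y ∈ l ++ [w]) := fun hcon => by
        rw [if_pos hcon] at hy2; omega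
      rw [not_or] at hy4
      refine ⟨y, by rw [v₄]; exact hy3, hy1.2.2.2, hy4.1, hy4.2, ?_, by simp⟩
      intro x hx
      simp only [List.getLast?_append, List.getLast?_singleton, Option.some_or, Option.mem_def,
        Option.some.injEq] at hx
      exact hx ▸ hy1

/-- A finished traversal has filled a component of `BoundaryAdj`. -/
theorem IsTraversal.isChainFamily {R : GridEmbedding G} (hR : R.IsSolid)
    {C : List (List (Fin n))} (hC : IsChainFamily G C) {v : Fin n} {s : RamState}
    {l : List (Fin n)} (h : IsTraversal L C v s l) (h0 : s.reg 3 = 0)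
    (hend : (∀ y z, BoundaryAdj G v y → BoundaryAdj G v z → y = z) ∨
      ∀ u, u ∉ C.flatten → 0 < boundaryType G u → ∃ y z, y ≠ z ∧ BoundaryAdj G u y ∧
        BoundaryAdj G u z) : IsChainFamily G (C ++ [l]) ∧ v ∈ l := by
  obtain ⟨-, x, hx, hstuck⟩ | ⟨w, hw, -⟩ := h.next
  swap
  · omega
  have hne : l ≠ [] := by rintro rfl; simp at hx
  have hlen : 0 < l.length := List.length_pos_iff.2 hne
  have hnd := List.nodup_append.1 h.nodup
  have hget : ∀ i (hi : i < l.length), l.getD i v = l[i] := fun i hi => by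
    rw [List.getD_eq_getElem]
  have hmem : ∀ i, i ≤ l.length - 1 → l.getD i v ∈ l := fun i hi => by
    rw [hget i (by omega)]; exact List.getElem_mem _
  have hhead : l.getD 0 v = v := by
    rw [hget 0 hlen]
    exact h.head _ (by simp [List.head?_eq_getElem?, hlen])
  have hlast : l.getD (l.length - 1) v = x := by
    rw [hget _ (by omega)]
    rw [List.getLast?_eq_getElem?, Option.mem_def, List.getElem?_eq_getElem (by omega)] at hx
    exact Option.some.inj hx
  -- Finished chains are closed under `BoundaryAdj`, so the chain got stuck because of its own
  -- vertices only.
  have hnot : ∀ y ∈ l, ∀ z, BoundaryAdj G y z → z ∉ C.flatten := by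
    intro y hy z hyz hz
    obtain ⟨l', hl', hz'⟩ := List.mem_flatten.1 hz
    have := hC.closed l' hl' z hz' y hyz.symm
    exact hnd.2.2 y (List.mem_flatten.2 ⟨l', hl', this⟩) y hy rfl
  have hex : ∀ y ∈ l, ∃ i ≤ l.length - 1, y = l.getD i v := by
    intro y hy
    obtain ⟨i, hi, rfl⟩ := List.getElem_of_mem hy
    exact ⟨i, by omega, (hget i hi).symm⟩
  have hclosed := closed_of_stuck (F := BoundaryAdj G) (fun _ _ h => h.symm) (fun _ _ h => h.ne)
    (fun _ _ _ _ => hR.boundaryAdj_two) (x := fun i => l.getD i v) (m := l.length - 1) ?_ ?_ ?_ ?_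
  · refine ⟨⟨?_, ?_, ?_, ?_⟩, hhead ▸ hmem 0 (by omega)⟩
    · simpa using h.nodup
    · intro l' hl'
      rcases List.mem_append.1 hl' with h' | h'
      · exact hC.chain l' h'
      · rw [List.mem_singleton.1 h']; exact h.chain
    · intro l' hl'
      rcases List.mem_append.1 hl' with h' | h'
      · exact hC.pos l' h'
      · rw [List.mem_singleton.1 h']; exact h.pos
    · intro l' hl'
      rcases List.mem_append.1 hl' with h' | h'
      · exact hC.closed l' h'
      · rw [List.mem_singleton.1 h']
        intro y hy z hyz
        obtain ⟨i, hi, rfl⟩ := hex y hy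
        obtain ⟨j, hj, rfl⟩ := hclosed i hi z hyz
        exact hmem j hj
  · intro i hi j hj hij
    simp only [hget i (by omega), hget j (by omega)] at hij
    exact hnd.2.1.getElem_inj_iff.1 hij
  · intro i hi
    simp only [hget i (by omega), hget (i + 1) (by omega)]
    exact List.isChain_iff_getElem.1 h.chain i (by omega)
  · intro y hy
    simp only [hlast] at hy
    have hxl : x ∈ l := hlast ▸ hmem _ le_rfl
    exact hex y ((hstuck y hy).resolve_left (hnot x hxl y hy))
  · rcases hend with h1 | h1
    · left
      simpa only [hhead] using h1
    · right
      intro i hi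
      have hi' := hmem i hi
      exact h1 _ (fun hc => hnd.2.2 _ hc _ hi' rfl) (h.pos _ hi')

/-- Each visit is paid by the vertex that it adds to the chains, so all traversals together cost
`visitCost` per vertex, plus at most six steps per start. -/
theorem traverseProgram_spec {R : GridEmbedding G} (hR : R.IsSolid)
    (hdeg : ∀ v, (L.nbrs v).length ≤ 4) (hW : geodeticProgramSize * (n + 1) ≤ W)
    {C : List (List (Fin n))} (hC : IsChainFamily G C) {v : Fin n} {s : RamState}
    (hs : s.IsRegular L) (hv : s.reg 2 = v) (hrec : Records G s.arr C [])
    (hpos : 0 < boundaryType G v) (hvC : v ∉ C.flatten)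
    (hend : (∀ y z, BoundaryAdj G v y → BoundaryAdj G v z → y = z) ∨
      ∀ u, u ∉ C.flatten → 0 < boundaryType G u → ∃ y z, y ≠ z ∧ BoundaryAdj G u y ∧
        BoundaryAdj G u z) :
    traverseProgram.Spec W s fun k t => ∃ C', t.IsRegular L ∧ t.reg 2 = v ∧
      Records G t.arr C' [] ∧ IsChainFamily G C' ∧ v ∈ C'.flatten ∧ C.flatten ⊆ C'.flatten ∧
      k + visitCost * (n - C'.flatten.length) ≤ visitCost * (n - C.flatten.length) + 6 := by
  have hW1 : 2 * (n + 1) ≤ W :=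
    (Nat.mul_le_mul_right _ (by unfold geodeticProgramSize; omega)).trans hW
  have hs' : (s.setReg 5 0).IsRegular L := hs.update (z := 5) (by omega)
    (fun x _ hx => by simp [hx]) (by simp) rfl
  have hv' : (s.setReg 5 0).reg 2 = v := by simp [hv]
  have hval : (s.setReg 5 0).value L (.add (.var 2) (.const 1)) = v + 1 := by
    simp [RamState.value, RamExpr.eval, regMap, hv]
  refine .seq (.const (by omega) (.seq ((RamProg.assign_spec hdeg hs' (x := 3) (by omega)
    (by simpa [RamExpr.size] using hW1) (by rw [hval]; omega)).mono ?_)))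
  rintro k₁ s₁ ⟨hk₁, r₁, a₁, v₁, u₁⟩
  rw [hval] at v₁
  simp only [RamExpr.cost] at hk₁
  have hinit : IsTraversal L C v s₁ [] := by
    refine ⟨r₁, by rw [u₁ 2 (by omega) (by omega), hv'], by rw [a₁]; exact hrec,
      by simpa using hC.nodup, by simp, by simp, by simp,
      by rw [u₁ 5 (by omega) (by omega)]; simp [cornersOf], Or.inr ⟨v, v₁, hpos, hvC, by simp,
      by simp, fun _ => rfl⟩⟩
  refine (RamProg.Spec.whileLt (fun b t => ∃ l, IsTraversal L C v t l ∧
    b = visitCost * (n - (C.flatten.length + l.length))) ?_ _ _ ⟨[], hinit, rfl⟩).mono ?_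
  · rintro b t ⟨l, hl, rfl⟩ hlt
    rw [hl.regular.one] at hlt
    refine (visitProgram_spec hdeg hW hl hlt).mono ?_
    rintro k u ⟨hk, w, hu⟩
    refine ⟨_, ?_, l ++ [w], hu, rfl⟩
    have hlen := length_le_of_nodup hu.nodup
    simp only [List.length_append, List.length_singleton] at hlen ⊢
    obtain ⟨d, hd⟩ : ∃ d, n - (C.flatten.length + l.length) = d + 1 :=
      ⟨n - (C.flatten.length + l.length) - 1, by omega⟩
    have hd' : n - (C.flatten.length + (l.length + 1)) = d := by omega
    rw [hd, hd', mul_add]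
    omega
  · rintro k t ⟨h0, b, hb, l, hl, rfl⟩
    rw [hl.regular.one] at h0
    obtain ⟨hC', hvl⟩ := hl.isChainFamily hR hC (by omega) hend
    have hflat : (C ++ [l]).flatten = C.flatten ++ l := by simp
    refine ⟨C ++ [l], hl.regular, hl.start, ⟨?_, ?_⟩, hC', ?_, ?_, ?_⟩
    · classical
      intro x
      rw [hl.records.visited, hflat]
      simp
    · classical
      intro x
      rw [hl.records.output]
      congr 1
      simp [everySecond, cornersOf, or_and_right, exists_or]
    · rw [hflat]; exact List.mem_append_right _ hvl
    · rw [hflat]; exact List.subset_append_left _ _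
    · rw [hflat, List.length_append]
      simp only [List.length_nil, add_zero] at hb
      omega

/-- One pass over all vertices that traverses the components of `BoundaryAdj` from all unvisited
vertices with the property `P`. -/
theorem forAll_traverseProgram_spec {R : GridEmbedding G} (hR : R.IsSolid)
    (hdeg : ∀ v, (L.nbrs v).length ≤ 4) (hW : geodeticProgramSize * (n + 1) ≤ W) {e : RamExpr}
    (he : e.size ≤ geodeticProgramSize) {P : Fin n → Prop} {C₀ : List (List (Fin n))}
    (hval : ∀ (M : ℕ → ℕ → ℕ) (ρ : ℕ → ℕ) (v : Fin n), ρ 2 = v →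
      (0 < e.eval L.nbrsAt M ρ ↔ P v ∧ M 3 v = 0))
    (hpos : ∀ v, P v → 0 < boundaryType G v)
    (hend : ∀ v, P v → (∀ y z, BoundaryAdj G v y → BoundaryAdj G v z → y = z) ∨
      ∀ u, u ∉ C₀.flatten → 0 < boundaryType G u → ∃ y z, y ≠ z ∧ BoundaryAdj G u y ∧
        BoundaryAdj G u z) {s : RamState} (hs : s.IsRegular L)
    (hrec : Records G s.arr C₀ []) (hC₀ : IsChainFamily G C₀) :
    (RamProg.forAll (.whenPos e traverseProgram)).Spec W s fun k t => ∃ C, t.IsRegular L ∧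
      Records G t.arr C [] ∧ IsChainFamily G C ∧ C₀.flatten ⊆ C.flatten ∧
      (∀ v, P v → v ∈ C.flatten) ∧ k ≤ visitCost * n + (e.cost + 12) * n + 2 := by
  refine (RamProg.forAll_spec hdeg (c := e.cost + 7)
    ((Nat.mul_le_mul_right _ (by unfold geodeticProgramSize; omega)).trans hW)
    (fun i b M => ∃ C, IsChainFamily G C ∧ Records G M C [] ∧ C₀.flatten ⊆ C.flatten ∧
      (∀ v : Fin n, v < i → P v → v ∈ C.flatten) ∧ b = visitCost * (n - C.flatten.length)) ?_ hs
    ⟨C₀, hC₀, hrec, List.Subset.refl _, by simp, rfl⟩).mono ?_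
  · rintro v b s hs hv ⟨C, hC, hrec, hsub, hvis, rfl⟩
    have hpv : (0 < s.value L e ↔ P v ∧ v ∉ C.flatten) := by
      refine (hval s.arr _ v (by simp [regMap, hv])).trans (and_congr_right fun _ => ?_)
      rw [hrec.visited]
      split_ifs with h <;> simp_all
    refine RamProg.whenPos_spec hdeg hs ((Nat.mul_le_mul_right _ he).trans hW) ?_ ?_
    · intro h t rt ta tr
      rw [hpv] at h
      refine (traverseProgram_spec hR hdeg hW hC rt (by rw [tr 2 (by omega), hv])
        (by rw [ta]; exact hrec) (hpos v h.1) h.2 ((hend v h.1).imp_right fun h' u hu =>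
          h' u fun hc => hu (hsub hc))).mono ?_
      rintro k u ⟨C', h1, h2, h3, h4, h5, h6, h7⟩ l hl
      refine ⟨_, h1, h2, ⟨C', h4, h3, List.Subset.trans hsub h6, ?_, rfl⟩, by omega⟩
      intro x hx hP
      by_cases hxv : x = v
      · rw [hxv]; exact h5
      · exact h6 (hvis x (by have := Fin.val_ne_of_ne hxv; omega) hP)
    · intro h t rt ta tr l hl
      refine ⟨_, rt, by rw [tr 2 (by omega), hv], ⟨C, hC, by rw [ta]; exact hrec, hsub, ?_, rfl⟩,
        by omega⟩
      intro x hx hP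
      by_cases hxv : x = v
      · by_contra hc
        subst hxv
        have := hpv.2 ⟨hP, hc⟩
        omega
      · exact hvis x (by have := Fin.val_ne_of_ne hxv; omega) hP
  · rintro k t ⟨b, h1, ⟨C, h2, h3, h4, h5, rfl⟩, h6⟩
    refine ⟨C, h1, h3, h2, h4, fun v => h5 v v.isLt, ?_⟩
    have : visitCost * (n - C₀.flatten.length) ≤ visitCost * n :=
      Nat.mul_le_mul_left _ (Nat.sub_le _ _)
    have e7 : e.cost + 7 + 5 = e.cost + 12 := by omega
    rw [e7] at h6
    omega

/-- The program marks the vertices of degree at most one. -/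
theorem forAll_isLow_spec (hdeg : ∀ v, (L.nbrs v).length ≤ 4)
    (hW : geodeticProgramSize * (n + 1) ≤ W) :
    (RamProg.forAll (.whenPos (.isLow 2) (.mark 2 2))).Spec W L.input fun k t =>
      t.IsRegular L ∧ Records G t.arr [] [] ∧ k ≤ ((RamExpr.isLow 2).cost + 8) * n + 2 := by
  have hs : L.input.IsRegular L := by
    refine ⟨by simp [AdjacencyLists.input], by simp [AdjacencyLists.input], ?_, rfl, rfl, ?_⟩
    · intro x _
      simp only [AdjacencyLists.input]
      split_ifs <;> omega
    · intro a i ha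
      simp only [AdjacencyLists.input]
      rw [if_neg (by omega), if_neg (by omega)]
      omega
  refine (RamProg.forAll_spec hdeg (c := (RamExpr.isLow 2).cost + 3)
    ((Nat.mul_le_mul_right _ (by unfold geodeticProgramSize; omega)).trans hW)
    (fun i b M => b = 0 ∧ (∀ v : Fin n, M 3 v = 0) ∧ (∀ v : Fin n, M 2 v ≤ 1) ∧
      ∀ v : Fin n, M 2 v = 1 ↔ vertexDegree G v ≤ 1 ∧ v < i) ?_ hs (b := 0)
    ⟨rfl, by simp [AdjacencyLists.input], by simp [AdjacencyLists.input],
      by simp [AdjacencyLists.input]⟩).mono ?_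
  · rintro v b s hs hv ⟨rfl, h1, h2, h3⟩
    have hval : s.value L (.isLow 2) = if vertexDegree G v ≤ 1 then 1 else 0 :=
      RamExpr.eval_isLow (by simp [regMap, hv])
    refine RamProg.whenPos_spec hdeg hs ((Nat.mul_le_mul_right _
      (by unfold geodeticProgramSize; omega)).trans hW) ?_ ?_
    · intro h t rt ta tr
      have hlow : vertexDegree G v ≤ 1 := by
        by_contra hc
        rw [hval, if_neg hc] at h
        omega
      refine (RamProg.mark_spec (a := 2) (x := 2) rt le_rfl (by omega) ?_).mono ?_
      · have : 1 * (n + 1) ≤ W :=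
          (Nat.mul_le_mul_right _ (by unfold geodeticProgramSize; omega)).trans hW
        omega
      rintro k u ⟨hk, ru, ua, ur⟩ l hl
      rw [tr 2 (by omega), hv, ta] at ua
      refine ⟨0, ru, by rw [ur 2 (by omega), tr 2 (by omega), hv], ⟨rfl, ?_, ?_, ?_⟩, by omega⟩
      · intro x; rw [ua, if_neg (by omega)]; exact h1 x
      · intro x; rw [ua]
        split_ifs
        · rfl
        · exact h2 x
      · intro x
        rw [ua]
        by_cases hxv : x = v
        · simp [hxv, hlow]
        · have := Fin.val_ne_of_ne hxv
          rw [if_neg (by omega), h3]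
          exact and_congr_right fun _ => by omega
    · intro h t rt ta tr l hl
      refine ⟨0, rt, by rw [tr 2 (by omega), hv], ⟨rfl, by rw [ta]; exact h1, by rw [ta]; exact h2,
        ?_⟩, by omega⟩
      intro x
      rw [ta, h3]
      refine and_congr_right fun hx => ?_
      have : x ≠ v := by
        rintro rfl
        rw [hval, if_pos hx] at h
        omega
      have := Fin.val_ne_of_ne this
      omega
  · rintro k t ⟨b, h1, ⟨rfl, h2, h3, h4⟩, h5⟩
    have e8 : (RamExpr.isLow 2).cost + 3 + 5 = (RamExpr.isLow 2).cost + 8 := by omega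
    rw [e8] at h5
    refine ⟨h1, ⟨by simpa using h2, ?_⟩, by omega⟩
    classical
    intro v
    have h6 := h3 v
    have h7 := h4 v
    have h8 : v ∈ lowDegreeVertices G ↔ vertexDegree G v ≤ 1 := Iff.rfl
    by_cases hv : vertexDegree G v ≤ 1
    · simpa [h8, hv, cornersOf, everySecond] using h7
    · have : t.arr 2 v ≠ 1 := fun h => hv (h7.1 h).1
      simp [h8, hv, cornersOf, everySecond]
      omega

/-- A bound for the running time of the program, in multiples of the number of vertices plus one. -/
def geodeticProgramCost : ℕ := (RamExpr.isLow 2).cost + (RamExpr.isFreeEnd 2).cost +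
  (RamExpr.isFree 2).cost + 2 * visitCost + 50

open Classical in
theorem nbrSum_le_one_iff {V : Type*} [Fintype V] {G : SimpleGraph V} {v : V} {F : V → Prop}
    (hF : ∀ a, F a → G.Adj v a) :
    (nbrSum G v fun a => if F a then 1 else 0) ≤ 1 ↔ ∀ y z, F y → F z → y = z := by
  have : (nbrSum G v fun a => if F a then 1 else 0) = (Finset.univ.filter F).card := by
    rw [nbrSum, Finset.card_eq_sum_ones, Finset.sum_filter]
    refine Finset.sum_congr rfl fun a _ => ?_
    by_cases ha : F a
    · simp [ha, hF a ha]
    · simp [ha]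
  rw [this, Finset.card_le_one]
  simp only [Finset.mem_filter, Finset.mem_univ, true_and]
  exact ⟨fun h y z hy hz => h y hy z hz, fun h y hy z hz => h y z hy hz⟩

theorem geodeticProgram_spec {R : GridEmbedding G} (hR : R.IsSolid)
    (hW : geodeticProgramSize * (n + 1) ≤ W) :
    geodeticProgram.Spec W L.input fun k t => k ≤ geodeticProgramCost * (n + 1) ∧
      ∃ C, IsChainFamily G C ∧ (∀ v, 0 < boundaryType G v → ∃ l ∈ C, v ∈ l) ∧
        t.outputSet n = lowDegreeVertices G ∪ {v | ∃ l ∈ C, v ∈ everySecond (cornersOf G l)} := by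
  classical
  have hdeg : ∀ v, (L.nbrs v).length ≤ 4 := fun v => by
    rw [L.length_nbrs]; exact R.vertexDegree_le v
  refine .seq ((forAll_isLow_spec hdeg hW).mono ?_)
  rintro k₁ s₁ ⟨r₁, rec₁, hk₁⟩
  refine .seq ((forAll_traverseProgram_spec hR hdeg hW (e := .isFreeEnd 2)
    (by unfold geodeticProgramSize; omega)
    (P := fun v => 0 < boundaryType G v ∧
      (nbrSum G v fun a => if BoundaryAdj G v a then 1 else 0) ≤ 1) ?_ (fun v hv => hv.1)
    (fun v hv => Or.inl ((nbrSum_le_one_iff fun a h => h.1).1 hv.2)) r₁ rec₁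
    ⟨by simp, by simp, by simp, by simp⟩).mono ?_)
  · intro M ρ v hv
    rw [RamExpr.eval_isFreeEnd hv (by omega)]
    split_ifs with h <;> simp [h]
  rintro k₂ s₂ ⟨C₂, r₂, rec₂, hC₂, -, hall₂, hk₂⟩
  refine (forAll_traverseProgram_spec hR hdeg hW (e := .isFree 2)
    (by unfold geodeticProgramSize; omega)
    (P := fun v => 0 < boundaryType G v) ?_ (fun v hv => hv)
    (fun v hv => Or.inr fun u hu hpos => ?_) r₂ rec₂ hC₂).mono ?_
  · intro M ρ v hv
    rw [RamExpr.eval_isFree hv (by omega)]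
    split_ifs with h <;> simp [h]
  -- After the second pass every unvisited boundary vertex has two boundary neighbours; this is the
  -- condition for a start at an arbitrary vertex.
  · have := mt (fun h => hall₂ u ⟨hpos, h⟩) hu
    rw [nbrSum_le_one_iff fun a h => h.1] at this
    push Not at this
    obtain ⟨y, z, hy, hz, hne⟩ := this
    exact ⟨y, z, hne, hy, hz⟩
  rintro k₃ s₃ ⟨C₃, r₃, rec₃, hC₃, -, hall₃, hk₃⟩
  refine ⟨?_, C₃, hC₃, fun v hv => List.mem_flatten.1 (hall₃ v hv), ?_⟩
  · unfold geodeticProgramCost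
    simp only [add_mul, mul_add, mul_one, mul_assoc] at hk₁ hk₂ hk₃ ⊢
    omega
  · ext v
    have := rec₃.output v
    simp only [RamState.outputSet, Set.mem_ofPred_eq, Set.mem_union, this]
    simp [everySecond, cornersOf, or_iff_not_imp_left]

end Correctness

theorem theorem1 :
    -- the set is a minimum geodetic set, and its cardinality is the lower bound
    (∀ (n : ℕ) (G : SimpleGraph (Fin n)) (R : GridEmbedding G), R.IsSolid →
      ∀ 𝒮 : Finset (List (Fin n)), R.IsCornerSystem 𝒮 →
        IsMinGeodeticSet G (cornerSelection G 𝒮) ∧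
        (cornerSelection G 𝒮).ncard = (lowDegreeVertices G).ncard + ∑ S ∈ 𝒮, S.length / 2) ∧
    -- one program computes such a set in linear time from the adjacency lists alone
    (∃ (P : RamProg) (c : ℕ), ∀ (n : ℕ) (G : SimpleGraph (Fin n)) (L : AdjacencyLists G),
      IsSolidGrid G →
        ∃ (k : ℕ) (s : RamState), k ≤ c * (n + 1) ∧ P.Runs (c * (n + 1)) L.input k s ∧
          IsMinGeodeticSet G (s.outputSet n) ∧
          ∀ R : GridEmbedding G, R.IsSolid →
            ∃ 𝒮 : Finset (List (Fin n)), R.IsUnorientedCornerSystem 𝒮 ∧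
              s.outputSet n = cornerSelection G 𝒮) := by
  constructor
  · intro n G R hR 𝒮 h𝒮
    exact ⟨hR.isMinGeodeticSet_cornerSelection h𝒮.unoriented,
      hR.ncard_cornerSelection h𝒮.unoriented⟩
  · refine ⟨geodeticProgram, geodeticProgramSize + geodeticProgramCost, fun n G L hG => ?_⟩
    obtain ⟨R₀, hR₀⟩ := hG
    obtain ⟨k, s, hrun, hk, C, hC, hcov, hout⟩ := geodeticProgram_spec (L := L)
      (W := (geodeticProgramSize + geodeticProgramCost) * (n + 1)) hR₀
      (Nat.mul_le_mul_right _ (Nat.le_add_right _ _))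
    -- The chains `C` and their closure properties do not mention an embedding, so the same output
    -- is read as a corner selection for every solid embedding.
    have key : ∀ R : GridEmbedding G, R.IsSolid → ∃ 𝒮 : Finset (List (Fin n)),
        R.IsUnorientedCornerSystem 𝒮 ∧ s.outputSet n = cornerSelection G 𝒮 := by
      intro R hR
      obtain ⟨𝒮, h1, h2⟩ := hR.exists_cornerSystem hC hcov
      exact ⟨𝒮, h1, by rw [hout, h2]⟩
    refine ⟨k, s, hk.trans (Nat.mul_le_mul_right _ (Nat.le_add_left _ _)), hrun, ?_, key⟩
    obtain ⟨𝒮, h1, h2⟩ := key R₀ hR₀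
    rw [h2]
    exact hR₀.isMinGeodeticSet_cornerSelection h1
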